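/- **Setting.** A *weighted homogeneous deformation of an invertible polynomial* in the variables $x_1,x_2,x_3=x,y,z$ is a polynomial $f=\sum_{k=1}^N a_k\prod_j x_j^{E_{kj}}$ with $N\ge 3$, $a_k\in\mathbb C^*$ and pairwise distinct monomials, such that the matrix $(E_{kj})_{k,j\le 3}$ is invertible over $\mathbb Q$ and all $N$ monomials have the same degree $d$ for a system of positive integral weights $(w_1,w_2,w_3;d)$, taken reduced (greatest common divisor $1$). Put $\varepsilon_f=w_1+w_2+w_3-d$ and let $L_f$ be the quotient of $\bigoplus_j\mathbb Z\vec x_j\oplus\mathbb Z\vec f$ by the relations $\vec f=\sum_jE_{kj}\vec x_j$ ($k=1,\dots,N$). Let $S=\mathbb C[x,y,z]$, graded by $L_f$. *Dolgachev numbers.* Let $m\ge1$, $p_1,p_2,p_3\ge 1$, and let $\lambda_3=1,\lambda_4,\dots,\lambda_{m+2}$ be distinct non-zero complex numbers. In each row below the fractions in the polynomial are required to be integers, and $\prod$ runs over $i=3,\dots,m+2$. I: $-\prod(y^{p_2/m}-\lambda_ix^{p_1/m})+z^{p_3}$; $(\alpha_1,\alpha_2,\alpha_3)=(\frac{p_1}m,\frac{p_2}m,p_3)$;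 $(x,y,z)\mapsto(X_1,X_2,X_3\cdots X_{m+2})$. II$_1$: $-x\prod(y^{p_2/m}-\lambda_ix^{(p_1-1)/m})+z^{p_3}$; $(\frac{p_3(p_1-1)}m,\frac{p_2}m,p_3)$; $(X_1^{p_3},X_2,X_1X_3\cdots X_{m+2})$. II$_2$: $-\prod(z^{p_3/m}-\lambda_ix^{p_1/m})+xy^{p_2}$; $(\frac{p_3(p_1-1)}m,\frac{p_3}m,p_2)$; $(X_1^{p_3},X_3\cdots X_{m+2},X_1X_2)$. III: $-xy\prod(y^{(p_2-1)/m}-\lambda_ix^{(p_1-1)/m})+z^{p_3}$; $(\frac{p_3(p_1-1)}m,\frac{p_3(p_2-1)}m,p_3)$; $(X_1^{p_3},X_2^{p_3},X_1X_2X_3\cdots X_{m+2})$. IV: $-x\prod(y^{p_2/m}-\lambda_ix^{(p_1-1)/m})+yz^{p_3}$; $(\frac{p_3(p_1-1)}m,\frac{p_1p_2-p_1+1}m,p_3)$; $(X_1^{p_3}X_2,X_2^{p_1},X_1X_3\cdots X_{m+2})$. V ($m=1$): $-z(xz^{p_3-1}-y^{p_2})+yx^{p_1}$; $(p_2p_3-p_3+1,\,p_1p_3-p_1+1,\,p_1p_2-p_2+1)$;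 $(X_2X_3^{p_2},X_1^{p_3}X_3,X_1X_2^{p_1})$. The last entry of each row describes the embedding of $\mathbb C[x,y,z]/(f_0)$, where $f_0$ is the polynomial of the row, into the ring $R_{A,\lambda}=\mathbb C[X_1,\dots,X_r]/(X_i^{\alpha_i}-X_2^{\alpha_2}+\lambda_iX_1^{\alpha_1},\ i=3,\dots,r)$ of a weighted projective line, $r=m+2$, $A=(\alpha_1,\alpha_2,\alpha_3,\dots,\alpha_3)$. We say that $f$ *has Dolgachev numbers* $A$ if $f$ arises by a weighted homogeneous change of coordinates from such an $f_0$ which is itself a weighted homogeneous deformation of an invertible polynomial with $L_{f_0}\cong\mathbb Z$. The *$i$-th exceptional orbit* is the $\mathbb C^*$-orbit in $\{f=0\}\setminus\{0\}$ that is the image of $\{X_i=0\}$. *Arm objects.* Let $\alpha_i\ge2$. The outermost object $V_{i,\alpha_i}$ of the $i$-th arm of the Kajiura–Saito–Takahashi full strongly exceptional collection is, up to a grading shift, the object of the homotopy category of $L_f$-graded matrix factorizations of $f$ given by the simple torsion sheaf at the $i$-th exceptional point: the stabilization of the graded $S/(f)$-module $\mathbb C[T]$ of functions on the normalization of the closure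 of the $i$-th exceptional orbit, with $1$ in degree $0$. It is *of rank $2$* if it is isomorphic in this category to a matrix factorization of size $2$. *The associated singularity.* If $f=p_1h_1+p_2h_2$ with $L_f$-homogeneous entries ($p_j$ of degree $\vec p_j$, $h_j$ of degree $\vec f-\vec p_j$) and a regular sequence $p_1,p_2$, let $Q$ be the Koszul matrix factorization with $F_0=S\oplus S(\vec f-\vec p_1-\vec p_2)$, $F_1=S(\vec f-\vec p_1)\oplus S(\vec f-\vec p_2)$, $q_0=\begin{pmatrix}h_1&-p_2\\h_2&p_1\end{pmatrix}$, $q_1=\begin{pmatrix}p_1&p_2\\-h_2&h_1\end{pmatrix}$, and let $\mathbf F_Q(w,x,y,z)=(h_1-wp_2,\;h_2+wp_1)$, where $w$ has weight $\deg(\vec f-\vec p_1-\vec p_2)$. A weighted homogeneous complete intersection $\mathbf F=0$ with positive weights has *signature* $(\beta_1,\dots,\beta_r)$ if it is singular at most at $0$, the sum of its weights minus the sum of its degrees is $-1$, the orbit space $(\{\mathbf F=0\}\setminus\{0\})/\mathbb C^*$ has genus $0$, and there are $r$ distinct orbits with isotropy groups of orders $\beta_1,\dots,\beta_r$ such that $\mathbb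 C^*$ acts freely outside these orbits. **Theorem.** Let $f$ be a weighted homogeneous deformation of an invertible polynomial in three variables with $\varepsilon_f=-1$ and $L_f\cong\mathbb Z$, with Dolgachev numbers $A=(\alpha_1,\dots,\alpha_r)$, and let $1\le i\le r$ with $\alpha_i\ge2$. Suppose that $V_{i,\alpha_i}$ is of rank $2$. Then $V_{i,\alpha_i}$ is isomorphic to a Koszul matrix factorization $Q$ as above, and for every such $Q$ isomorphic to $V_{i,\alpha_i}$ the complete intersection singularity $\mathbf F_Q$ has signature $(\alpha_1,\dots,\alpha_i+1,\dots,\alpha_r)$: the $i$-th number goes up by one and the others do not change. -/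

import Mathlib

open MvPolynomial

noncomputable section

namespace EbelingTakahashi

/-! ### Weighted homogeneous deformations of invertible polynomials -/

/-- A weighted homogeneous deformation of an invertible polynomial in `n` variables:
`f = ∑ k, a k * ∏ j, x_j ^ (E k j)` with `N ≥ n` monomials, non-zero coefficients, the first `n`
monomials forming an invertible polynomial (their exponent matrix is invertible over `ℚ`) and all
monomials having the same degree with respect to its weights.  `(w; d)` is the reduced system of
weights; it is determined by the first `n` monomials. -/
structure Deformation (n : ℕ) where
  N : ℕ
  le_N : n ≤ N
  a : Fin N → ℂ
  a_ne_zero : ∀ k, a k ≠ 0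
  E : Fin N → (Fin n →₀ ℕ)
  E_injective : Function.Injective E
  det_ne_zero : (Matrix.of fun i j : Fin n => (E (Fin.castLE le_N i) j : ℤ)).det ≠ 0
  w : Fin n → ℕ
  d : ℕ
  w_pos : ∀ j, 0 < w j
  d_pos : 0 < d
  reduced : Nat.gcd (Finset.univ.gcd w) d = 1
  homogeneous : ∀ k, ∑ j, E k j * w j = d

namespace Deformation

variable {n : ℕ} (D : Deformation n)

/-- The polynomial `f`. -/
def poly : MvPolynomial (Fin n) ℂ := ∑ k, monomial (D.E k) (D.a k)

/-- `ε_f = w_1 + ⋯ + w_n - d` for the reduced system of weights. -/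
def epsilon : ℤ := (∑ j, (D.w j : ℤ)) - D.d

/-- The subgroup `I_f` of `⊕ ℤ x_j ⊕ ℤ f`, generated by the elements `f - ∑ j, E k j • x_j`. -/
def relations : AddSubgroup ((Fin n → ℤ) × ℤ) :=
  AddSubgroup.closure (Set.range fun k => ((fun j => -(D.E k j : ℤ)), (1 : ℤ)))

/-- The maximal grading group `L_f`. -/
abbrev L : Type := ((Fin n → ℤ) × ℤ) ⧸ D.relations

/-- The class of the generator `x_j` in `L_f`. -/
def xvec (j : Fin n) : D.L := QuotientAddGroup.mk (Pi.single j 1, 0)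

/-- The class of the generator `f` in `L_f`. -/
def fvec : D.L := QuotientAddGroup.mk (0, 1)

/-- The degree map on the free group. -/
def degFree : (Fin n → ℤ) × ℤ →+ ℤ where
  toFun u := (∑ j, u.1 j * D.w j) + u.2 * D.d
  map_zero' := by simp
  map_add' u v := by
    simp only [Prod.fst_add, Prod.snd_add, Pi.add_apply, add_mul, Finset.sum_add_distrib]
    ring

lemma relations_le_ker : D.relations ≤ D.degFree.ker := by
  rw [relations, AddSubgroup.closure_le]
  rintro _ ⟨k, rfl⟩
  have h : (∑ j, (D.E k j : ℤ) * D.w j) = D.d := by exact_mod_cast D.homogeneous k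
  simp [degFree, AddMonoidHom.mem_ker, h]

/-- The degree map `L_f → ℤ`, `x_j ↦ w_j`, `f ↦ d` (reduced weights). -/
def deg : D.L →+ ℤ := QuotientAddGroup.lift D.relations D.degFree D.relations_le_ker

/-- `p ∈ S_l`: the polynomial `p` is homogeneous of degree `l ∈ L_f`. -/
def IsHomog (p : MvPolynomial (Fin n) ℂ) (l : D.L) : Prop := IsWeightedHomogeneous D.xvec p l

lemma IsHomog.neg {D : Deformation n} {p : MvPolynomial (Fin n) ℂ} {l : D.L}
    (h : D.IsHomog p l) : D.IsHomog (-p) l :=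
  (weightedHomogeneousSubmodule ℂ D.xvec l).neg_mem h

end Deformation

/-! ### Graded matrix factorizations and their homotopy category -/

/-- An `L_f`-graded matrix factorization of `f` with `F_0 = ⊕_{i ∈ ι₀} S(a i)`,
`F_1 = ⊕_{i ∈ ι₁} S(b i)`, given by the matrices `q0` of `f_0 : F_0 → F_1` and `q1` of
`f_1 : F_1 → F_0(f)`.  (A degree-preserving map `S(l) → S(l')` is an element of `S_{l' - l}`.)
Its rank is the cardinality of `ι₁`, which equals that of `ι₀`. -/
structure GradedMF {n : ℕ} (D : Deformation n) (ι₀ ι₁ : Type) [Fintype ι₀] [Fintype ι₁]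
    [DecidableEq ι₀] [DecidableEq ι₁] where
  a : ι₀ → D.L
  b : ι₁ → D.L
  q0 : Matrix ι₁ ι₀ (MvPolynomial (Fin n) ℂ)
  q1 : Matrix ι₀ ι₁ (MvPolynomial (Fin n) ℂ)
  homog0 : ∀ i j, D.IsHomog (q0 i j) (b i - a j)
  homog1 : ∀ i j, D.IsHomog (q1 i j) (a i + D.fvec - b j)
  q1_mul_q0 : q1 * q0 = Matrix.scalar ι₀ D.poly
  q0_mul_q1 : q0 * q1 = Matrix.scalar ι₁ D.poly

namespace GradedMF

variable {n : ℕ} {D : Deformation n}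
variable {ι₀ ι₁ κ₀ κ₁ : Type} [Fintype ι₀] [Fintype ι₁] [Fintype κ₀] [Fintype κ₁]
  [DecidableEq ι₀] [DecidableEq ι₁] [DecidableEq κ₀] [DecidableEq κ₁]

/-- A morphism of graded matrix factorizations (of degree `0`). -/
structure Hom (P : GradedMF D ι₀ ι₁) (Q : GradedMF D κ₀ κ₁) where
  m0 : Matrix κ₀ ι₀ (MvPolynomial (Fin n) ℂ)
  m1 : Matrix κ₁ ι₁ (MvPolynomial (Fin n) ℂ)
  homog0 : ∀ i j, D.IsHomog (m0 i j) (Q.a i - P.a j)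
  homog1 : ∀ i j, D.IsHomog (m1 i j) (Q.b i - P.b j)
  comm0 : m1 * P.q0 = Q.q0 * m0
  comm1 : m0 * P.q1 = Q.q1 * m1

/-- The pair of matrices `(m0, m1)`, of an endomorphism of `P`, is homotopic to the identity:
there are graded maps `s0 : F_0 → F_1(-f)` and `s1 : F_1 → F_0` with
`m0 - 1 = q1 s0 + s1 q0` and `m1 - 1 = q0 s1 + s0 q1`. -/
def HomotopicToId (P : GradedMF D ι₀ ι₁) (m0 : Matrix ι₀ ι₀ (MvPolynomial (Fin n) ℂ))
    (m1 : Matrix ι₁ ι₁ (MvPolynomial (Fin n) ℂ)) : Prop :=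
  ∃ (s0 : Matrix ι₁ ι₀ (MvPolynomial (Fin n) ℂ)) (s1 : Matrix ι₀ ι₁ (MvPolynomial (Fin n) ℂ)),
    (∀ i j, D.IsHomog (s0 i j) (P.b i - D.fvec - P.a j)) ∧
    (∀ i j, D.IsHomog (s1 i j) (P.a i - P.b j)) ∧
    m0 - 1 = P.q1 * s0 + s1 * P.q0 ∧
    m1 - 1 = P.q0 * s1 + s0 * P.q1

/-- `P` and `Q` are isomorphic in the homotopy category of graded matrix factorizations. -/
def Iso (P : GradedMF D ι₀ ι₁) (Q : GradedMF D κ₀ κ₁) : Prop :=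
  ∃ (φ : Hom P Q) (ψ : Hom Q P),
    P.HomotopicToId (ψ.m0 * φ.m0) (ψ.m1 * φ.m1) ∧ Q.HomotopicToId (φ.m0 * ψ.m0) (φ.m1 * ψ.m1)

end GradedMF

/-! ### Dolgachev numbers -/

/-- The types of invertible polynomials in three variables. -/
inductive TableType
  | I
  | II₁
  | II₂
  | III
  | IV
  | V

/-- The parameters of a normal form: a type, the number `m`, the exponents `p₁, p₂, p₃` and the
numbers `lam 0, …, lam (m - 1)` (that is `λ_3, …, λ_{m+2}`). -/
structure NormalForm where
  type : TableType
  m : ℕ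
  p₁ : ℕ
  p₂ : ℕ
  p₃ : ℕ
  lam : Fin m → ℂ
  m_pos : 1 ≤ m
  p₁_pos : 1 ≤ p₁
  p₂_pos : 1 ≤ p₂
  p₃_pos : 1 ≤ p₃
  divisibility : match type with
    | .I => m ∣ p₁ ∧ m ∣ p₂
    | .II₁ => m ∣ p₁ - 1 ∧ m ∣ p₂
    | .II₂ => m ∣ p₁ ∧ m ∣ p₃
    | .III => m ∣ p₁ - 1 ∧ m ∣ p₂ - 1
    | .IV => m ∣ p₁ - 1 ∧ m ∣ p₂
    | .V => m = 1
  lam_first : lam ⟨0, m_pos⟩ = 1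
  lam_ne_zero : ∀ i, lam i ≠ 0
  lam_injective : Function.Injective lam

namespace NormalForm

variable (T : NormalForm)

/-- The polynomial of the normal form, in the variables `x = X 0`, `y = X 1`, `z = X 2`. -/
def poly : MvPolynomial (Fin 3) ℂ :=
  let x : MvPolynomial (Fin 3) ℂ := X 0
  let y : MvPolynomial (Fin 3) ℂ := X 1
  let z : MvPolynomial (Fin 3) ℂ := X 2
  match T.type with
  | .I => -(∏ i, (y ^ (T.p₂ / T.m) - C (T.lam i) * x ^ (T.p₁ / T.m))) + z ^ T.p₃
  | .II₁ => -(x * ∏ i, (y ^ (T.p₂ / T.m) - C (T.lam i) * x ^ ((T.p₁ - 1) / T.m))) + z ^ T.p₃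
  | .II₂ => -(∏ i, (z ^ (T.p₃ / T.m) - C (T.lam i) * x ^ (T.p₁ / T.m))) + x * y ^ T.p₂
  | .III => -(x * y * ∏ i, (y ^ ((T.p₂ - 1) / T.m) - C (T.lam i) * x ^ ((T.p₁ - 1) / T.m)))
      + z ^ T.p₃
  | .IV => -(x * ∏ i, (y ^ (T.p₂ / T.m) - C (T.lam i) * x ^ ((T.p₁ - 1) / T.m))) + y * z ^ T.p₃
  | .V => -(z * (x * z ^ (T.p₃ - 1) - y ^ T.p₂)) + y * x ^ T.p₁

/-- The first Dolgachev number `α_1`. -/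
def alpha₁ : ℕ :=
  match T.type with
  | .I => T.p₁ / T.m
  | .II₁ => T.p₃ * ((T.p₁ - 1) / T.m)
  | .II₂ => T.p₃ / T.m * (T.p₁ - 1)
  | .III => T.p₃ * ((T.p₁ - 1) / T.m)
  | .IV => T.p₃ * ((T.p₁ - 1) / T.m)
  | .V => T.p₂ * T.p₃ - T.p₃ + 1

/-- The second Dolgachev number `α_2`. -/
def alpha₂ : ℕ :=
  match T.type with
  | .I => T.p₂ / T.m
  | .II₁ => T.p₂ / T.m
  | .II₂ => T.p₃ / T.m
  | .III => T.p₃ * ((T.p₂ - 1) / T.m)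
  | .IV => (T.p₁ * T.p₂ - T.p₁ + 1) / T.m
  | .V => T.p₁ * T.p₃ - T.p₁ + 1

/-- The remaining `m` equal Dolgachev numbers `α_3 = ⋯ = α_{m+2}`. -/
def alpha₃ : ℕ :=
  match T.type with
  | .I => T.p₃
  | .II₁ => T.p₃
  | .II₂ => T.p₂
  | .III => T.p₃
  | .IV => T.p₃
  | .V => T.p₁ * T.p₂ - T.p₂ + 1

/-- The Dolgachev numbers `A = (α_1, α_2, α_3, …, α_3)`, an `(m + 2)`-tuple. -/
def A : Fin (T.m + 2) → ℕ := Fin.cons T.alpha₁ (Fin.cons T.alpha₂ fun _ => T.alpha₃)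

/-- The defining equations `X_i ^ α_i - X_2 ^ α_2 + λ_i X_1 ^ α_1`, `i = 3, …, m + 2`, of the ring
`R_{A,λ}` of the weighted projective line (`X_1, X_2, X_{i+3}` are `X 0`, `X 1`, `X i.succ.succ`).
-/
def wplEquation (i : Fin T.m) : MvPolynomial (Fin (T.m + 2)) ℂ :=
  X i.succ.succ ^ T.A i.succ.succ - X 1 ^ T.A 1 + C (T.lam i) * X 0 ^ T.A 0

/-- The images of `x, y, z` under the embedding of `ℂ[x,y,z]/(poly)` into `R_{A,λ}`. -/
def image : Fin 3 → MvPolynomial (Fin (T.m + 2)) ℂ :=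
  let X₁ : MvPolynomial (Fin (T.m + 2)) ℂ := X 0
  let X₂ : MvPolynomial (Fin (T.m + 2)) ℂ := X 1
  let P : MvPolynomial (Fin (T.m + 2)) ℂ := ∏ i : Fin T.m, X i.succ.succ
  match T.type with
  | .I => ![X₁, X₂, P]
  | .II₁ => ![X₁ ^ T.p₃, X₂, X₁ * P]
  | .II₂ => ![X₁ ^ T.p₃, P, X₁ * X₂]
  | .III => ![X₁ ^ T.p₃, X₂ ^ T.p₃, X₁ * X₂ * P]
  | .IV => ![X₁ ^ T.p₃ * X₂, X₂ ^ T.p₁, X₁ * P]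
  | .V => ![X₂ * P ^ T.p₂, X₁ ^ T.p₃ * P, X₁ * X₂ ^ T.p₁]

end NormalForm

/-- `f` has the normal form `form`: a coordinate change, homogeneous for the weights, transforms
the normal form `form.poly`, which is itself a weighted homogeneous deformation with maximal
grading `ℤ`, into `f`.  The Dolgachev numbers of `f` are then `form.A`. -/
structure DolgachevData (D : Deformation 3) where
  form : NormalForm
  D₀ : Deformation 3
  poly_eq : D₀.poly = form.poly
  grading : Nonempty (D₀.L ≃+ ℤ)
  change : MvPolynomial (Fin 3) ℂ ≃ₐ[ℂ] MvPolynomial (Fin 3) ℂ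
  change_homog : ∀ j, IsWeightedHomogeneous D.w (change (X j)) (D₀.w j)
  change_poly : change form.poly = D.poly

/-- The point `c` of `{f = 0}` lies on the `i`-th exceptional orbit, the image of `{X_i = 0}` under
`Spec R_{A,λ} → Spec ℂ[x,y,z]/(f)`. -/
def DolgachevData.OnExceptionalOrbit {D : Deformation 3} (T : DolgachevData D)
    (i : Fin (T.form.m + 2)) (c : Fin 3 → ℂ) : Prop :=
  ∃ b : Fin (T.form.m + 2) → ℂ, b ≠ 0 ∧ (∀ k, eval b (T.form.wplEquation k) = 0) ∧ b i = 0 ∧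
    ∀ j, eval c (T.change (X j)) = eval b (T.form.image j)

/-! ### The outermost objects of the arms -/

/-- The order of the isotropy group of the point `c` under the `ℂ^*`-action with weights `w`. -/
def isotropyOrder {n : ℕ} (D : Deformation n) (c : Fin n → ℂ) : ℕ :=
  open Classical in (Finset.univ.filter fun j => c j ≠ 0).gcd D.w

/-- The restriction of functions to the normalization `ℂ → closure of ℂ^* • c` of the closure of the
orbit of `c`: `x_j ↦ c_j T ^ (w_j / α)`, where `α` is the order of the isotropy group of `c`.
It makes `ℂ[T]`, with `T` in degree `α`, a graded module over `S = ℂ[x_1, …, x_n]`. -/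
def orbitMap {n : ℕ} (D : Deformation n) (c : Fin n → ℂ) :
    MvPolynomial (Fin n) ℂ →ₐ[ℂ] Polynomial ℂ :=
  aeval fun j => Polynomial.C (c j) * Polynomial.X ^ (D.w j / isotropyOrder D c)

/-- `W` is the graded matrix factorization of `f` attached to (the stabilization of) the graded
module `M = ℂ[T]` of functions on the normalization of the closure of the orbit of `c`: there is
a graded free resolution `0 → K₂ → K₁ → K₀ → M → 0` over `S` with differentials `d₁, d₂` and with
null-homotopies `h₀ : K₀ → K₁`, `h₁ : K₁ → K₂` of the multiplication by `f`, such that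
`F_0 = K₀ ⊕ K₂(f)`, `F_1 = K₁(f)`, `q1 = (d₁, h₁)` and `q0 = (h₀, d₂)`.
The identities `d₁ h₀ = f`, `h₀ d₁ + d₂ h₁ = f`, `h₁ d₂ = f` are those of `W`. -/
def IsStabilization {n : ℕ} {D : Deformation n} {κ₀ κ₁ κ₂ : Type} [Fintype κ₀] [Fintype κ₁]
    [Fintype κ₂] [DecidableEq κ₀] [DecidableEq κ₁] [DecidableEq κ₂]
    (c : Fin n → ℂ) (W : GradedMF D (κ₀ ⊕ κ₂) κ₁) : Prop :=
  let d₁ : Matrix κ₀ κ₁ (MvPolynomial (Fin n) ℂ) := W.q1.submatrix Sum.inl id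
  let d₂ : Matrix κ₁ κ₂ (MvPolynomial (Fin n) ℂ) := W.q0.submatrix id Sum.inr
  ∃ u : κ₀ → Polynomial ℂ,
    (∀ k, ∀ e ∈ (u k).support, (isotropyOrder D c : ℤ) * e = -D.deg (W.a (Sum.inl k))) ∧
    (∀ g : Polynomial ℂ, ∃ v : κ₀ → MvPolynomial (Fin n) ℂ,
      ∑ k, orbitMap D c (v k) * u k = g) ∧
    (∀ v : κ₀ → MvPolynomial (Fin n) ℂ,
      ∑ k, orbitMap D c (v k) * u k = 0 ↔ ∃ y, d₁.mulVec y = v) ∧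
    (∀ y : κ₁ → MvPolynomial (Fin n) ℂ, d₁.mulVec y = 0 ↔ ∃ t, d₂.mulVec t = y) ∧
    Function.Injective d₂.mulVec

/-- `V` represents the outermost object `V_{i,α_i}` of the `i`-th arm: the object of the homotopy
category given by the simple torsion sheaf at the `i`-th exceptional point of the weighted
projective line, that is by the graded module of functions on the normalization of the closure of
the `i`-th exceptional orbit (normalized so that the function `1` has degree `0`). -/
def DolgachevData.IsOutermost {D : Deformation 3} (T : DolgachevData D)
    (i : Fin (T.form.m + 2)) {ι₀ ι₁ : Type} [Fintype ι₀] [Fintype ι₁] [DecidableEq ι₀]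
    [DecidableEq ι₁] (V : GradedMF D ι₀ ι₁) : Prop :=
  ∃ c : Fin 3 → ℂ, T.OnExceptionalOrbit i c ∧
    ∃ (k₀ k₁ k₂ : ℕ) (W : GradedMF D (Fin k₀ ⊕ Fin k₂) (Fin k₁)),
      IsStabilization c W ∧ W.Iso V

/-! ### The complete intersection singularity of a matrix factorization of size two -/

/-- A presentation `f = p₁ h₁ + p₂ h₂` with homogeneous entries and `p₁, p₂` a regular sequence. -/
structure KoszulData (D : Deformation 3) where
  p₁ : MvPolynomial (Fin 3) ℂ
  p₂ : MvPolynomial (Fin 3) ℂ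
  h₁ : MvPolynomial (Fin 3) ℂ
  h₂ : MvPolynomial (Fin 3) ℂ
  l₁ : D.L
  l₂ : D.L
  homog_p₁ : D.IsHomog p₁ l₁
  homog_p₂ : D.IsHomog p₂ l₂
  homog_h₁ : D.IsHomog h₁ (D.fvec - l₁)
  homog_h₂ : D.IsHomog h₂ (D.fvec - l₂)
  regular : RingTheory.Sequence.IsRegular (MvPolynomial (Fin 3) ℂ) [p₁, p₂]
  eq_poly : p₁ * h₁ + p₂ * h₂ = D.poly

namespace KoszulData

variable {D : Deformation 3} (K : KoszulData D)

/-- The Koszul matrix factorization `Q` of size two, with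
`F_0 = S(0) ⊕ S(f - p₁ - p₂)` and `F_1 = S(f - p₁) ⊕ S(f - p₂)`. -/
def mf : GradedMF D (Fin 2) (Fin 2) where
  a := ![0, D.fvec - K.l₁ - K.l₂]
  b := ![D.fvec - K.l₁, D.fvec - K.l₂]
  q0 := !![K.h₁, -K.p₂; K.h₂, K.p₁]
  q1 := !![K.p₁, K.p₂; -K.h₂, K.h₁]
  homog0 := by
    have e₁ : D.fvec - K.l₁ - (D.fvec - K.l₁ - K.l₂) = K.l₂ := by abel
    have e₂ : D.fvec - K.l₂ - (D.fvec - K.l₁ - K.l₂) = K.l₁ := by abel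
    intro i j
    fin_cases i <;> fin_cases j
    · simpa using K.homog_h₁
    · simpa [e₁] using K.homog_p₂.neg
    · simpa using K.homog_h₂
    · simpa [e₂] using K.homog_p₁
  homog1 := by
    have e₁ : D.fvec - K.l₁ - K.l₂ + D.fvec - (D.fvec - K.l₁) = D.fvec - K.l₂ := by abel
    have e₂ : D.fvec - K.l₁ - K.l₂ + D.fvec - (D.fvec - K.l₂) = D.fvec - K.l₁ := by abel
    intro i j
    fin_cases i <;> fin_cases j
    · simpa using K.homog_p₁
    · simpa using K.homog_p₂
    · simpa [e₁] using K.homog_h₂.neg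
    · simpa [e₂] using K.homog_h₁
  q1_mul_q0 := by
    have h := K.eq_poly
    ext1 i j
    fin_cases i <;> fin_cases j <;> simp [Matrix.mul_apply, Fin.sum_univ_two, ← h] <;> ring
  q0_mul_q1 := by
    have h := K.eq_poly
    ext1 i j
    fin_cases i <;> fin_cases j <;> simp [Matrix.mul_apply, Fin.sum_univ_two, ← h] <;> ring

/-- The equations `F_{Q,1} = h₁ - w p₂`, `F_{Q,2} = h₂ + w p₁` of the complete intersection
singularity `(X_Q, 0)`, in the variables `w = X 0`, `x = X 1`, `y = X 2`, `z = X 3`. -/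
def equations : Fin 2 → MvPolynomial (Fin 4) ℂ :=
  ![rename Fin.succ K.h₁ - X 0 * rename Fin.succ K.p₂,
    rename Fin.succ K.h₂ + X 0 * rename Fin.succ K.p₁]

/-- The weights of `w, x, y, z` for which `F_Q` is weighted homogeneous. -/
def weights : Fin 4 → ℤ := Fin.cons (D.deg (D.fvec - K.l₁ - K.l₂)) fun j => (D.w j : ℤ)

end KoszulData

/-! ### The signature of a weighted homogeneous singularity -/

section Signature

variable {n m : ℕ}

/-- The punctured cone `{F = 0} ∖ {0}`. -/
def puncturedCone (F : Fin m → MvPolynomial (Fin n) ℂ) : Set (Fin n → ℂ) :=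
  {x | x ≠ 0 ∧ ∀ k, eval x (F k) = 0}

/-- The action of `t ∈ ℂ^*` with weights `v`. -/
def act (v : Fin n → ℤ) (t : ℂˣ) (x : Fin n → ℂ) : Fin n → ℂ :=
  fun j => ((t ^ v j : ℂˣ) : ℂ) * x j

/-- Two points of the punctured cone are in the same `ℂ^*`-orbit. -/
def orbitSetoid (v : Fin n → ℤ) (F : Fin m → MvPolynomial (Fin n) ℂ) :
    Setoid (puncturedCone F) where
  r x y := ∃ t : ℂˣ, act v t x = y
  iseqv :=
    { refl := fun x => ⟨1, by funext j; simp [act]⟩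
      symm := by
        rintro x y ⟨t, h⟩
        refine ⟨t⁻¹, ?_⟩
        rw [← h]
        funext j
        have ht : ((t : ℂ) ^ v j) ≠ 0 := zpow_ne_zero _ t.ne_zero
        simp [act, ht]
      trans := by
        rintro x y z ⟨t, h⟩ ⟨s, h'⟩
        refine ⟨s * t, ?_⟩
        rw [← h', ← h]
        funext j
        simp [act, mul_zpow, mul_assoc] }

/-- The weighted homogeneous complete intersection `{F = 0}` with `ℂ^*`-action of weights `v` is a
Fuchsian singularity of genus `0` with signature `(A 0, …, A (r - 1))`:
* all weights are positive and the equations are weighted homogeneous, with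
  `∑ weights - ∑ degrees = -1`;
* it is a complete intersection with (at most) an isolated singularity at `0`;
* the orbit space `({F = 0} ∖ {0}) / ℂ^*` has genus `0`, i.e. is homeomorphic to the sphere;
* there are pairwise distinct orbits with isotropy groups of orders `A 0, …, A (r - 1)`, and the
  action is free on all other orbits. -/
def HasSignature (F : Fin m → MvPolynomial (Fin n) ℂ) (v : Fin n → ℤ) {r : ℕ} (A : Fin r → ℕ) :
    Prop :=
  (∀ j, 0 < v j) ∧
  (∃ e : Fin m → ℤ, (∀ k, IsWeightedHomogeneous v (F k) (e k)) ∧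
    (∑ j, v j) - ∑ k, e k = -1) ∧
  (∀ x ∈ puncturedCone F, LinearIndependent ℂ fun k j => eval x (pderiv j (F k))) ∧
  Nonempty (Quotient (orbitSetoid v F) ≃ₜ OnePoint ℂ) ∧
  ∃ O : Fin r → puncturedCone F,
    (∀ i j, (orbitSetoid v F).r (O i) (O j) → i = j) ∧
    (∀ i, Nat.card {t : ℂˣ // act v t (O i) = O i} = A i) ∧
    ∀ x : puncturedCone F, (∀ i, ¬ (orbitSetoid v F).r (O i) x) →
      ∀ t : ℂˣ, act v t x = x → t = 1

end Signature

end EbelingTakahashi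

end

/-!
The proof computes the outermost object of an arm explicitly, reads off which data of a Koszul
matrix factorization are determined by its isomorphism class, and then compares the orbits of
`f = 0` with those of `F_Q = 0`.

*The grading.* As `L_f ≅ ℤ` and the weights are reduced, the degree map `L_f → ℤ` is an isomorphism
(`Deformation.deg_bijective`). Hence homogeneity for `L_f` is weighted homogeneity, and every
diagonal symmetry of `f` lies in the `ℂ^*` of the weights (`Deformation.exists_unit_of_eval_scale`).

*The outermost object.* A stabilization of `ℂ[T]` is unique up to isomorphism in the homotopy
category, by comparison of resolutions (`iso_of_resolves`). A point with non-trivial isotropy group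
has a vanishing coordinate, `x` say. If `y` is the coordinate of smallest weight that does not
vanish, then `y = c_y T ^ p` on the normalized orbit closure, `ℂ[T]` is free over `ℂ[y]` with basis
`1, …, T ^ (p - 1)`, and this yields a free resolution over `ℂ[x, y, z]` of ranks `p, 2p, p`. Since
`ε_f = -1`, the weight of no variable is the degree of `f`, so `f` has no linear terms; therefore
the matrix factorization of size `2p` built from the resolution is reduced
(`OrbitCoordinates.exists_reduced_stabilization`), and `2p` is the smallest size in its isomorphism
class. If it is of rank two, then `p = 1`: the closure of the orbit is the smooth curve `x = 0`,
`z = a y ^ n`, the object is the Koszul matrix factorization with `p₁ = z - a y ^ n`, `p₂ = x`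
(`exists_koszulData_of_stabilization`), and the isotropy group of the orbit has order `α_i = w_y`.
The weight of the extra variable `w` is `d - w_z - w_x = w_y + 1 = α_i + 1`; this is where `α_i + 1`
comes from.

*Invariants.* For degree reasons an isomorphism to any other Koszul matrix factorization is
triangular at the origin, so it preserves the weight of `w` and the ideal `(p₁, p₂)`
(`KoszulData.eq_of_iso`). Thus every `Q` as in the theorem has `w` of weight `α_i + 1`, the locus
`p₁ = p₂ = 0` is the closure of the `i`-th exceptional orbit, and `p₁`, `p₂` have independent linear
parts at the origin.

*The orbits of `f = 0`.* Each normal form is described by exponent vectors (`Chart`), from which one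
reads off that the embedding into `R_{A,λ}` induces a bijection from the points of the weighted
projective line to the orbits of `f₀ = 0`, with isotropy groups of the orders `A`
(`Chart.IsGood.isOrbifoldSphere`, `exists_chart`). Both the orbit space and the Riemann sphere are
Hausdorff quotients of one compact subset of the cone over the line by the same relation, so they
are homeomorphic. A weighted homogeneous change of coordinates carries this over to `f`
(`DolgachevData.isOrbifoldSphere`).

*The orbits of `F_Q = 0`.* On `F_Q = 0` one has `f = p₁ h₁ + p₂ h₂ = w (p₁ p₂ - p₂ p₁) = 0`. Off the
`w`-axis the projection to `f = 0` is injective, with image the complement of the locus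
`p₁ = p₂ = 0`: there `w` is determined by `h₁ = w p₂`, `h₂ = -w p₁`. The `w`-axis is one orbit with
isotropy group of order `α_i + 1`. So the orbit spaces agree, the `i`-th exceptional orbit being
replaced by the `w`-axis (`KoszulData.hasSignature`).
-/

namespace EbelingTakahashi

/-! ### The maximal grading group `ℤ` -/

namespace Deformation

variable {n : ℕ} (D : Deformation n)

lemma deg_xvec (j : Fin n) : D.deg (D.xvec j) = D.w j := by
  simp [deg, xvec, degFree, Pi.single_apply]

lemma deg_fvec : D.deg D.fvec = D.d := by
  simp [deg, fvec, degFree]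

variable {D}

lemma deg_eq_mul (e : D.L ≃+ ℤ) (l : D.L) : D.deg l = e l * D.deg (e.symm 1) := by
  have h : l = e l • e.symm 1 := by
    apply e.injective
    simp
  conv_lhs => rw [h]
  simp

/-- If `L_f ≅ ℤ`, then the degree map of the reduced weights is itself such an isomorphism. -/
lemma deg_bijective (hL : Nonempty (D.L ≃+ ℤ)) : Function.Bijective D.deg := by
  obtain ⟨e⟩ := hL
  have hd : D.deg (e.symm 1) ≠ 0 := by
    intro h
    have h1 := deg_eq_mul e D.fvec
    rw [h, deg_fvec, mul_zero] at h1
    exact D.d_pos.ne' (by exact_mod_cast h1)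
  constructor
  · rw [injective_iff_map_eq_zero]
    intro l hl
    rw [deg_eq_mul e] at hl
    have : e l = 0 := by simpa [hd] using hl
    simpa using this
  · have hdvd : ∀ l, D.deg (e.symm 1) ∣ D.deg l := fun l => ⟨e l, by rw [deg_eq_mul e l, mul_comm]⟩
    have h1 : (D.deg (e.symm 1)).natAbs ∣ Nat.gcd (Finset.univ.gcd D.w) D.d := by
      apply Nat.dvd_gcd
      · refine Finset.dvd_gcd fun j _ => ?_
        have := hdvd (D.xvec j)
        rw [deg_xvec] at this
        simpa using Int.natAbs_dvd_natAbs.mpr this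
      · have := hdvd D.fvec
        rw [deg_fvec] at this
        simpa using Int.natAbs_dvd_natAbs.mpr this
    rw [D.reduced, Nat.dvd_one] at h1
    intro z
    rcases Int.natAbs_eq (D.deg (e.symm 1)) with h | h <;> rw [h1] at h
    · exact ⟨z • e.symm 1, by rw [map_zsmul, h]; simp⟩
    · exact ⟨(-z) • e.symm 1, by rw [map_zsmul, h]; simp⟩

lemma deg_weight (m : Fin n →₀ ℕ) :
    D.deg (Finsupp.weight D.xvec m) = Finsupp.weight (fun j => (D.w j : ℤ)) m := by
  simp [Finsupp.weight_apply, Finsupp.sum, map_sum, deg_xvec]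

/-- If `L_f ≅ ℤ`, homogeneity in the `L_f`-grading is homogeneity for the reduced weights. -/
lemma isHomog_iff (hL : Nonempty (D.L ≃+ ℤ)) (p : MvPolynomial (Fin n) ℂ) (l : D.L) :
    D.IsHomog p l ↔ IsWeightedHomogeneous (fun j => (D.w j : ℤ)) p (D.deg l) := by
  unfold IsHomog IsWeightedHomogeneous
  refine forall_congr' fun m => imp_congr_right fun _ => ?_
  rw [← deg_weight, (deg_bijective hL).1.eq_iff]

lemma coeff_poly (m : Fin n →₀ ℕ) :
    coeff m D.poly = ∑ k, if D.E k = m then D.a k else 0 := by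
  simp [poly, coeff_sum, coeff_monomial]

lemma coeff_poly_E (k : Fin D.N) : coeff (D.E k) D.poly = D.a k := by
  rw [coeff_poly]
  simp [D.E_injective.eq_iff]

lemma isWeightedHomogeneous_poly : IsWeightedHomogeneous D.w D.poly D.d := by
  refine IsWeightedHomogeneous.sum _ _ _ fun k _ => ?_
  apply isWeightedHomogeneous_monomial
  rw [← D.homogeneous k]
  simp [Finsupp.weight_apply, Finsupp.sum_fintype]

/-- The Laurent monomials of the torus points `τ` on which all monomials of `f` take the same value
are the characters of `L_f ≅ ℤ`, so that these torus points form the one-parameter group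
`t ↦ (t ^ w_j)_j`. -/
lemma exists_unit_of_monomials_eq (hL : Nonempty (D.L ≃+ ℤ)) (τ : Fin n → ℂˣ) (χ : ℂˣ)
    (h : ∀ k, ∏ j, τ j ^ D.E k j = χ) : ∃ t : ℂˣ, ∀ j, τ j = t ^ D.w j := by
  let F : (Fin n → ℤ) × ℤ →+ Additive ℂˣ :=
    { toFun := fun u => Additive.ofMul ((∏ j, τ j ^ u.1 j) * χ ^ u.2)
      map_zero' := by simp
      map_add' := fun u v => by
        rw [← ofMul_mul]
        congr 1
        simp only [Prod.fst_add, Prod.snd_add, Pi.add_apply, zpow_add, Finset.prod_mul_distrib]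
        exact mul_mul_mul_comm _ _ _ _ }
  have hF : D.relations ≤ F.ker := by
    rw [relations, AddSubgroup.closure_le]
    rintro _ ⟨k, rfl⟩
    have := h k
    simp only [SetLike.mem_coe, AddMonoidHom.mem_ker, F]
    change Additive.ofMul _ = Additive.ofMul 1
    congr 1
    simp only [zpow_neg, zpow_natCast, zpow_one, Finset.prod_inv_distrib]
    rw [this, inv_mul_cancel]
  let G : D.L →+ Additive ℂˣ := QuotientAddGroup.lift D.relations F hF
  obtain ⟨g, hg⟩ := (deg_bijective hL).2 1
  refine ⟨(G g).toMul, fun j => ?_⟩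
  have h1 : D.xvec j = (D.w j : ℤ) • g := by
    apply (deg_bijective hL).1
    rw [deg_xvec, map_zsmul, hg]; simp
  have h2 : G (D.xvec j) = Additive.ofMul (τ j) := by
    simp [G, xvec, F, Pi.single_apply]
  rw [h1, map_zsmul] at h2
  have h3 := congrArg Additive.toMul h2
  rw [toMul_zsmul, toMul_ofMul] at h3
  rw [← h3, zpow_natCast]

lemma unit_eq_one (hn : 0 < n) (t : ℂˣ) (h : ∀ j, t ^ D.w j = 1) : t = 1 := by
  have hd : t ^ D.d = 1 := by
    rw [← D.homogeneous ⟨0, hn.trans_le D.le_N⟩, ← Finset.prod_pow_eq_pow_sum]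
    refine Finset.prod_eq_one fun j _ => ?_
    rw [mul_comm, pow_mul, h, one_pow]
  have : orderOf t ∣ Nat.gcd (Finset.univ.gcd D.w) D.d :=
    Nat.dvd_gcd (Finset.dvd_gcd fun j _ => orderOf_dvd_of_pow_eq_one (h j))
      (orderOf_dvd_of_pow_eq_one hd)
  rw [D.reduced, Nat.dvd_one, orderOf_eq_one_iff] at this
  exact this

end Deformation

/-! ### The homotopy category -/

namespace Deformation
variable {n : ℕ} {D : Deformation n}

lemma isHomog_sum {ι : Type*} {s : Finset ι} {p : ι → MvPolynomial (Fin n) ℂ} {l : D.L}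
    (h : ∀ i ∈ s, D.IsHomog (p i) l) : D.IsHomog (∑ i ∈ s, p i) l :=
  (weightedHomogeneousSubmodule ℂ D.xvec l).sum_mem h

lemma IsHomog.add {p q : MvPolynomial (Fin n) ℂ} {l : D.L} (hp : D.IsHomog p l)
    (hq : D.IsHomog q l) : D.IsHomog (p + q) l :=
  (weightedHomogeneousSubmodule ℂ D.xvec l).add_mem hp hq

lemma IsHomog.sub {p q : MvPolynomial (Fin n) ℂ} {l : D.L} (hp : D.IsHomog p l)
    (hq : D.IsHomog q l) : D.IsHomog (p - q) l :=
  (weightedHomogeneousSubmodule ℂ D.xvec l).sub_mem hp hq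

lemma IsHomog.zero (l : D.L) : D.IsHomog 0 l :=
  (weightedHomogeneousSubmodule ℂ D.xvec l).zero_mem

lemma isHomog_one : D.IsHomog 1 0 := isWeightedHomogeneous_one _ _

/-- Products of matrices of homogeneous polynomials are homogeneous. -/
lemma isHomog_mul {ι κ ν : Type} [Fintype κ] {a : ι → D.L} {b : κ → D.L} {c : ν → D.L}
    {A : Matrix ι κ (MvPolynomial (Fin n) ℂ)} {B : Matrix κ ν (MvPolynomial (Fin n) ℂ)}
    (hA : ∀ i j, D.IsHomog (A i j) (a i - b j)) (hB : ∀ i j, D.IsHomog (B i j) (b i - c j)) :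
    ∀ i j, D.IsHomog ((A * B) i j) (a i - c j) := by
  intro i j
  refine isHomog_sum fun k _ => ?_
  have := (hA i k).mul (hB k j)
  simpa [IsHomog] using this

lemma isHomog_poly : D.IsHomog D.poly D.fvec := by
  refine isHomog_sum fun k _ => isWeightedHomogeneous_monomial _ _ _ ?_
  have h : (QuotientAddGroup.mk ((fun j => -(D.E k j : ℤ)), (1 : ℤ)) : D.L) = 0 := by
    rw [QuotientAddGroup.eq_zero_iff]
    exact AddSubgroup.subset_closure ⟨k, rfl⟩
  have h2 : D.fvec - Finsupp.weight D.xvec (D.E k)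
      = (QuotientAddGroup.mk ((fun j => -(D.E k j : ℤ)), (1 : ℤ)) : D.L) := by
    rw [Finsupp.weight_apply, Finsupp.sum_fintype _ _ (by simp)]
    simp only [fvec, xvec, ← QuotientAddGroup.mk_nsmul, ← QuotientAddGroup.mk_sum,
      ← QuotientAddGroup.mk_sub]
    congr 1
    ext j
    · simp [Prod.fst_sum, Finset.sum_apply, Pi.single_apply]
    · simp [Prod.snd_sum]
  rw [h] at h2
  exact (sub_eq_zero.mp h2).symm

lemma weightedHomogeneousComponent_mul {p : MvPolynomial (Fin n) ℂ} {l : D.L}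
    (hp : D.IsHomog p l) (q : MvPolynomial (Fin n) ℂ) (m : D.L) :
    weightedHomogeneousComponent D.xvec (l + m) (p * q)
      = p * weightedHomogeneousComponent D.xvec m q := by
  induction q using MvPolynomial.induction_on' with
  | monomial s c =>
    have hs : IsWeightedHomogeneous D.xvec (monomial s c) (Finsupp.weight D.xvec s) :=
      isWeightedHomogeneous_monomial _ _ _ rfl
    by_cases h : Finsupp.weight D.xvec s = m
    · subst h
      rw [hs.weightedHomogeneousComponent_same, (hp.mul hs).weightedHomogeneousComponent_same]
    · rw [hs.weightedHomogeneousComponent_ne _ (Ne.symm h), mul_zero,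
        (hp.mul hs).weightedHomogeneousComponent_ne]
      simpa using Ne.symm h
  | add q r hq hr => rw [mul_add, map_add, map_add, hq, hr, mul_add]

/-- A linear system with homogeneous data that has a solution has a homogeneous one: take the
components of the right degrees. -/
lemma exists_homog_solution {ι κ ν : Type} [Fintype κ] {a : ι → D.L}
    {b : κ → D.L} {c : ν → D.L} {A : Matrix ι κ (MvPolynomial (Fin n) ℂ)}
    {B : Matrix ι ν (MvPolynomial (Fin n) ℂ)}
    (hA : ∀ i j, D.IsHomog (A i j) (a i - b j)) (hB : ∀ i j, D.IsHomog (B i j) (a i - c j))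
    (h : ∀ j, ∃ y, A.mulVec y = fun i => B i j) :
    ∃ X : Matrix κ ν (MvPolynomial (Fin n) ℂ), (∀ i j, D.IsHomog (X i j) (b i - c j)) ∧
      A * X = B := by
  choose y hy using h
  refine ⟨Matrix.of fun k j => weightedHomogeneousComponent D.xvec (b k - c j) (y j k), fun k j =>
    weightedHomogeneousComponent_isWeightedHomogeneous _ _, ?_⟩
  ext1 i j
  have h1 := congrFun (hy j) i
  have h2 := (hB i j).weightedHomogeneousComponent_same
  rw [← h1] at h2
  rw [← h2.trans h1, Matrix.mulVec, dotProduct, map_sum, Matrix.mul_apply]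
  refine Finset.sum_congr rfl fun k _ => ?_
  have e : a i - c j = (a i - b k) + (b k - c j) := by abel
  rw [e]
  exact (weightedHomogeneousComponent_mul (hA i k) (y j k) (b k - c j)).symm

end Deformation

namespace GradedMF

variable {n : ℕ} {D : Deformation n}
variable {ι₀ ι₁ κ₀ κ₁ ν₀ ν₁ : Type} [Fintype ι₀] [Fintype ι₁] [Fintype κ₀] [Fintype κ₁]
  [Fintype ν₀] [Fintype ν₁]
  [DecidableEq ι₀] [DecidableEq ι₁] [DecidableEq κ₀] [DecidableEq κ₁] [DecidableEq ν₀]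
  [DecidableEq ν₁]

lemma Iso.symm {P : GradedMF D ι₀ ι₁} {Q : GradedMF D κ₀ κ₁} (h : P.Iso Q) : Q.Iso P := by
  obtain ⟨φ, ψ, h1, h2⟩ := h
  exact ⟨ψ, φ, h2, h1⟩

/-- Composition of morphisms of graded matrix factorizations. -/
noncomputable def Hom.comp {P : GradedMF D ι₀ ι₁} {Q : GradedMF D κ₀ κ₁} {R : GradedMF D ν₀ ν₁}
    (ψ : Hom Q R) (φ : Hom P Q) : Hom P R where
  m0 := ψ.m0 * φ.m0
  m1 := ψ.m1 * φ.m1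
  homog0 := Deformation.isHomog_mul ψ.homog0 φ.homog0
  homog1 := Deformation.isHomog_mul ψ.homog1 φ.homog1
  comm0 := by rw [Matrix.mul_assoc, φ.comm0, ← Matrix.mul_assoc, ψ.comm0, Matrix.mul_assoc]
  comm1 := by rw [Matrix.mul_assoc, φ.comm1, ← Matrix.mul_assoc, ψ.comm1, Matrix.mul_assoc]

/-- Homotopies to the identity can be transported through morphisms that are mutually inverse up
to homotopy. -/
lemma HomotopicToId.conj {P : GradedMF D ι₀ ι₁} {Q : GradedMF D κ₀ κ₁} (φ : Hom P Q)
    (ψ : Hom Q P) (h : P.HomotopicToId (ψ.m0 * φ.m0) (ψ.m1 * φ.m1)) (θ : Hom Q Q)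
    (hθ : Q.HomotopicToId θ.m0 θ.m1) :
    P.HomotopicToId (ψ.m0 * θ.m0 * φ.m0) (ψ.m1 * θ.m1 * φ.m1) := by
  obtain ⟨s0, s1, g0, g1, e0, e1⟩ := h
  obtain ⟨r0, r1, k0, k1, f0, f1⟩ := hθ
  refine ⟨s0 + ψ.m1 * r0 * φ.m0, s1 + ψ.m0 * r1 * φ.m1, fun i j => ?_, fun i j => ?_, ?_, ?_⟩
  · refine (g0 i j).add ?_
    have h1 : ∀ i j, D.IsHomog ((ψ.m1 * r0) i j) (P.b i - (Q.a j + D.fvec)) := by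
      apply Deformation.isHomog_mul ψ.homog1
      intro i j
      convert k0 i j using 1
      abel
    have h2 := Deformation.isHomog_mul (c := fun j => P.a j + D.fvec) h1 (B := φ.m0) (by
      intro i j
      convert φ.homog0 i j using 1
      abel) i j
    convert h2 using 1
    abel
  · exact (g1 i j).add
      (Deformation.isHomog_mul (Deformation.isHomog_mul ψ.homog0 k1) φ.homog1 i j)
  · have h3 : ψ.m0 * θ.m0 * φ.m0 - 1 = (ψ.m0 * φ.m0 - 1) + ψ.m0 * (θ.m0 - 1) * φ.m0 := by
      simp only [Matrix.mul_sub, Matrix.sub_mul, Matrix.mul_one]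
      abel
    rw [h3, e0, f0]
    have c1 : ψ.m0 * (Q.q1 * r0) * φ.m0 = P.q1 * (ψ.m1 * r0 * φ.m0) := by
      rw [← Matrix.mul_assoc, ψ.comm1]; simp only [Matrix.mul_assoc]
    have c2 : ψ.m0 * (r1 * Q.q0) * φ.m0 = ψ.m0 * r1 * φ.m1 * P.q0 := by
      simp only [Matrix.mul_assoc]; rw [φ.comm0]
    simp only [Matrix.mul_add, Matrix.add_mul, c1, c2]
    abel
  · have h3 : ψ.m1 * θ.m1 * φ.m1 - 1 = (ψ.m1 * φ.m1 - 1) + ψ.m1 * (θ.m1 - 1) * φ.m1 := by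
      simp only [Matrix.mul_sub, Matrix.sub_mul, Matrix.mul_one]
      abel
    rw [h3, e1, f1]
    have c1 : ψ.m1 * (Q.q0 * r1) * φ.m1 = P.q0 * (ψ.m0 * r1 * φ.m1) := by
      rw [← Matrix.mul_assoc, ψ.comm0]; simp only [Matrix.mul_assoc]
    have c2 : ψ.m1 * (r0 * Q.q1) * φ.m1 = ψ.m1 * r0 * φ.m0 * P.q1 := by
      simp only [Matrix.mul_assoc]; rw [φ.comm1]
    simp only [Matrix.mul_add, Matrix.add_mul, c1, c2]
    abel

lemma Iso.trans {P : GradedMF D ι₀ ι₁} {Q : GradedMF D κ₀ κ₁} {R : GradedMF D ν₀ ν₁}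
    (h : P.Iso Q) (h' : Q.Iso R) : P.Iso R := by
  obtain ⟨φ, ψ, h1, h2⟩ := h
  obtain ⟨φ', ψ', h1', h2'⟩ := h'
  refine ⟨φ'.comp φ, ψ.comp ψ', ?_, ?_⟩
  · have := h1.conj φ ψ (ψ'.comp φ') h1'
    simpa only [Hom.comp, Matrix.mul_assoc] using this
  · have := h2'.conj ψ' φ' (φ.comp ψ) h2
    simpa only [Hom.comp, Matrix.mul_assoc] using this

/-- Matrix factorizations that agree up to a renaming of the basis elements are isomorphic. -/
lemma iso_of_reindex {P : GradedMF D ι₀ ι₁} {Q : GradedMF D κ₀ κ₁} (e₀ : ι₀ ≃ κ₀) (e₁ : ι₁ ≃ κ₁)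
    (ha : ∀ i, Q.a (e₀ i) = P.a i) (hb : ∀ i, Q.b (e₁ i) = P.b i)
    (h0 : ∀ i j, Q.q0 (e₁ i) (e₀ j) = P.q0 i j) (h1 : ∀ i j, Q.q1 (e₀ i) (e₁ j) = P.q1 i j) :
    P.Iso Q := by
  have one0 : ∀ i j, D.IsHomog ((1 : Matrix ι₀ ι₀ (MvPolynomial (Fin n) ℂ)) i j)
      (P.a i - P.a j) := by
    intro i j
    rw [Matrix.one_apply]
    split_ifs with h
    · subst h; rw [sub_self]; exact Deformation.isHomog_one
    · exact .zero _
  have one1 : ∀ i j, D.IsHomog ((1 : Matrix ι₁ ι₁ (MvPolynomial (Fin n) ℂ)) i j)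
      (P.b i - P.b j) := by
    intro i j
    rw [Matrix.one_apply]
    split_ifs with h
    · subst h; rw [sub_self]; exact Deformation.isHomog_one
    · exact .zero _
  have ha' : ∀ i, Q.a i = P.a (e₀.symm i) := fun i => by rw [← ha]; simp
  have hb' : ∀ i, Q.b i = P.b (e₁.symm i) := fun i => by rw [← hb]; simp
  have q0 : Q.q0 = P.q0.submatrix e₁.symm e₀.symm := by ext1 i j; simp [← h0]
  have q1 : Q.q1 = P.q1.submatrix e₀.symm e₁.symm := by ext1 i j; simp [← h1]
  let φ : Hom P Q :=
    { m0 := (1 : Matrix ι₀ ι₀ _).submatrix e₀.symm id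
      m1 := (1 : Matrix ι₁ ι₁ _).submatrix e₁.symm id
      homog0 := fun i j => by rw [ha']; exact one0 _ _
      homog1 := fun i j => by rw [hb']; exact one1 _ _
      comm0 := by
        rw [q0, Matrix.submatrix_mul_equiv, ← Matrix.submatrix_id_id P.q0]
        rw [Matrix.mul_one]
        ext1 i j
        simp [Matrix.mul_apply, Matrix.one_apply]
      comm1 := by
        rw [q1, Matrix.submatrix_mul_equiv, Matrix.mul_one]
        ext1 i j
        simp [Matrix.mul_apply, Matrix.one_apply] }
  let ψ : Hom Q P :=
    { m0 := (1 : Matrix ι₀ ι₀ _).submatrix id e₀.symm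
      m1 := (1 : Matrix ι₁ ι₁ _).submatrix id e₁.symm
      homog0 := fun i j => by rw [ha']; exact one0 _ _
      homog1 := fun i j => by rw [hb']; exact one1 _ _
      comm0 := by
        rw [q0, Matrix.submatrix_mul_equiv, Matrix.one_mul]
        ext1 i j
        simp [Matrix.mul_apply, Matrix.one_apply]
      comm1 := by
        rw [q1, Matrix.submatrix_mul_equiv, Matrix.one_mul]
        ext1 i j
        simp [Matrix.mul_apply, Matrix.one_apply] }
  refine ⟨φ, ψ, ⟨0, 0, fun _ _ => .zero _, fun _ _ => .zero _, ?_, ?_⟩,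
    ⟨0, 0, fun _ _ => .zero _, fun _ _ => .zero _, ?_, ?_⟩⟩
  · simp only [φ, ψ, Matrix.submatrix_mul_equiv]; simp
  · simp only [φ, ψ, Matrix.submatrix_mul_equiv]; simp
  · simp only [φ, ψ, ← Matrix.submatrix_mul _ _ _ _ _ Function.bijective_id]; simp
  · simp only [φ, ψ, ← Matrix.submatrix_mul _ _ _ _ _ Function.bijective_id]; simp

end GradedMF

/-! ### Uniqueness of stabilizations -/

section OrbitMap
variable {n : ℕ} {D : Deformation n} {c : Fin n → ℂ}

lemma isotropyOrder_dvd {j : Fin n} (hj : c j ≠ 0) : isotropyOrder D c ∣ D.w j :=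
  Finset.gcd_dvd (by simpa using hj)

/-- The restriction to the orbit of a homogeneous polynomial is homogeneous of the same degree, for
`T` in degree `α`. -/
lemma deg_of_coeff_orbitMap_ne_zero (hL : Nonempty (D.L ≃+ ℤ)) {p : MvPolynomial (Fin n) ℂ}
    {l : D.L} (hp : D.IsHomog p l) {e : ℕ} (he : (orbitMap D c p).coeff e ≠ 0) :
    (isotropyOrder D c : ℤ) * e = D.deg l := by
  rw [Deformation.isHomog_iff hL] at hp
  rw [p.as_sum, map_sum, Polynomial.finsetSum_coeff] at he
  obtain ⟨s, hs, hse⟩ := Finset.exists_ne_zero_of_sum_ne_zero he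
  rw [← hp (mem_support_iff.mp hs), Finsupp.weight_apply, Finsupp.sum_fintype _ _ (by simp)]
  rw [orbitMap, aeval_monomial, Finsupp.prod_fintype _ _ (by simp)] at hse
  simp only [mul_pow, Finset.prod_mul_distrib, ← pow_mul, ← Polynomial.C_pow, ← map_prod] at hse
  rw [Finset.prod_pow_eq_pow_sum, Polynomial.algebraMap_eq, Polynomial.coeff_C_mul,
    Polynomial.coeff_C_mul, Polynomial.coeff_X_pow] at hse
  have h1 := right_ne_zero_of_mul hse
  have h2 := right_ne_zero_of_mul h1
  have h3 := left_ne_zero_of_mul h1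
  rw [Finset.prod_ne_zero_iff] at h3
  have h4 : e = ∑ j, D.w j / isotropyOrder D c * s j := by
    by_contra h; simp [h] at h2
  rw [h4]
  push_cast
  rw [Finset.mul_sum]
  refine Finset.sum_congr rfl fun j _ => ?_
  by_cases hj : s j = 0
  · simp [hj]
  · have hcj : c j ≠ 0 := fun h => h3 j (Finset.mem_univ _) (by simp [h, hj])
    obtain ⟨k, hk⟩ := isotropyOrder_dvd (D := D) hcj
    by_cases hα : isotropyOrder D c = 0
    · have : D.w j = 0 := by rw [hk, hα, zero_mul]
      exact absurd this (D.w_pos j).ne'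
    · rw [hk]
      push_cast
      rw [Int.mul_ediv_cancel_left _ (by exact_mod_cast hα)]
      simp; ring

lemma deg_of_coeff_orbitMap_mul_ne_zero (hL : Nonempty (D.L ≃+ ℤ)) {p : MvPolynomial (Fin n) ℂ}
    {l : D.L} (hp : D.IsHomog p l) {g : Polynomial ℂ} {z : ℤ}
    (hg : ∀ e ∈ g.support, (isotropyOrder D c : ℤ) * e = z) {e : ℕ}
    (he : (orbitMap D c p * g).coeff e ≠ 0) : (isotropyOrder D c : ℤ) * e = D.deg l + z := by
  rw [Polynomial.coeff_mul] at he
  obtain ⟨⟨i, j⟩, hij, h⟩ := Finset.exists_ne_zero_of_sum_ne_zero he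
  rw [Finset.HasAntidiagonal.mem_antidiagonal] at hij
  rw [← deg_of_coeff_orbitMap_ne_zero hL hp (left_ne_zero_of_mul h),
    ← hg j (Polynomial.mem_support_iff.mpr (right_ne_zero_of_mul h)), ← hij]
  push_cast
  ring

/-- Taking components of polynomials corresponds to taking components of their restrictions to the
orbit. -/
lemma coeff_orbitMap_component (hL : Nonempty (D.L ≃+ ℤ)) (p : MvPolynomial (Fin n) ℂ)
    {l : D.L} {g : Polynomial ℂ} {z : ℤ}
    (hg : ∀ e ∈ g.support, (isotropyOrder D c : ℤ) * e = z) (e : ℕ) :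
    (orbitMap D c (weightedHomogeneousComponent D.xvec l p) * g).coeff e
      = if (isotropyOrder D c : ℤ) * e = D.deg l + z then (orbitMap D c p * g).coeff e else 0 := by
  induction p using MvPolynomial.induction_on' with
  | monomial s a =>
    have hs : D.IsHomog (monomial s a) (Finsupp.weight D.xvec s) :=
      isWeightedHomogeneous_monomial _ _ _ rfl
    by_cases h : Finsupp.weight D.xvec s = l
    · subst h
      rw [IsWeightedHomogeneous.weightedHomogeneousComponent_same hs]
      split_ifs with h1
      · rfl
      · by_contra h2
        exact h1 (deg_of_coeff_orbitMap_mul_ne_zero hL hs hg h2)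
    · rw [IsWeightedHomogeneous.weightedHomogeneousComponent_ne _ hs (Ne.symm h)]
      simp only [map_zero, zero_mul, Polynomial.coeff_zero]
      split_ifs with h1
      · by_contra h2
        have h3 := deg_of_coeff_orbitMap_mul_ne_zero hL hs hg (Ne.symm h2)
        rw [h1] at h3
        exact h ((Deformation.deg_bijective hL).1 (add_right_cancel h3)).symm
      · rfl
  | add p q hp hq =>
    rw [map_add, map_add, add_mul, Polynomial.coeff_add, hp, hq, map_add, add_mul,
      Polynomial.coeff_add]
    split_ifs <;> simp

end OrbitMap

section Uniqueness

set_option linter.unusedSectionVars false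

variable {n : ℕ} {D : Deformation n} {κ₀ κ₁ κ₂ κ₀' κ₁' κ₂' : Type} [Fintype κ₀] [Fintype κ₁]
    [Fintype κ₂] [DecidableEq κ₀] [DecidableEq κ₁] [DecidableEq κ₂] [Fintype κ₀'] [Fintype κ₁']
    [Fintype κ₂'] [DecidableEq κ₀'] [DecidableEq κ₁'] [DecidableEq κ₂']

/-- The conditions of `IsStabilization` for given generators `u` of the module `ℂ[T]`. -/
def Resolves (c : Fin n → ℂ) (u : κ₀ → Polynomial ℂ) (W : GradedMF D (κ₀ ⊕ κ₂) κ₁) : Prop :=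
  (∀ k, ∀ e ∈ (u k).support, (isotropyOrder D c : ℤ) * e = -D.deg (W.a (Sum.inl k))) ∧
  (∀ g : Polynomial ℂ, ∃ v : κ₀ → MvPolynomial (Fin n) ℂ, ∑ k, orbitMap D c (v k) * u k = g) ∧
  (∀ v : κ₀ → MvPolynomial (Fin n) ℂ,
    ∑ k, orbitMap D c (v k) * u k = 0 ↔ ∃ y, W.q1.toRows₁.mulVec y = v) ∧
  (∀ y : κ₁ → MvPolynomial (Fin n) ℂ,
    W.q1.toRows₁.mulVec y = 0 ↔ ∃ t, W.q0.toCols₂.mulVec t = y) ∧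
  Function.Injective W.q0.toCols₂.mulVec

lemma isStabilization_iff {c : Fin n → ℂ} {W : GradedMF D (κ₀ ⊕ κ₂) κ₁} :
    IsStabilization c W ↔ ∃ u, Resolves c u W := Iff.rfl

lemma block_identities (W : GradedMF D (κ₀ ⊕ κ₂) κ₁) :
    W.q1.toRows₁ * W.q0.toCols₁ = D.poly • (1 : Matrix κ₀ κ₀ _) ∧ W.q1.toRows₁ * W.q0.toCols₂ = 0 ∧
    W.q1.toRows₂ * W.q0.toCols₁ = 0 ∧ W.q1.toRows₂ * W.q0.toCols₂ = D.poly • (1 : Matrix κ₂ κ₂ _) ∧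
    W.q0.toCols₁ * W.q1.toRows₁ + W.q0.toCols₂ * W.q1.toRows₂ = D.poly • (1 : Matrix κ₁ κ₁ _) := by
  have h1 := W.q1_mul_q0
  have h2 := W.q0_mul_q1
  rw [← Matrix.fromRows_toRows W.q1, ← Matrix.fromCols_toCols W.q0] at h1 h2
  rw [Matrix.fromRows_mul_fromCols, ← Matrix.fromBlocks_toBlocks (Matrix.scalar _ _),
    Matrix.fromBlocks_inj] at h1
  rw [Matrix.fromCols_mul_fromRows] at h2
  obtain ⟨a, b, c, d⟩ := h1
  refine ⟨a.trans ?_, b.trans ?_, c.trans ?_, d.trans ?_,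
    h2.trans ?_⟩ <;> ext1 i j <;>
    simp [Matrix.toBlocks₁₁, Matrix.toBlocks₁₂, Matrix.toBlocks₂₁, Matrix.toBlocks₂₂,
      Matrix.diagonal_apply, Matrix.one_apply]

lemma mulVec_col {ι κ ν R : Type*} [Fintype κ] [CommSemiring R] (A : Matrix ι κ R)
    (B : Matrix κ ν R) (j : ν) : A.mulVec (fun k => B k j) = fun i => (A * B) i j := rfl

lemma mul_left_cancel_of_mulVec_injective {ι κ ν R : Type*} [Fintype κ] [CommSemiring R]
    {A : Matrix ι κ R} (hA : Function.Injective A.mulVec) {B C : Matrix κ ν R}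
    (h : A * B = A * C) : B = C := by
  ext i j
  have : (fun k => B k j) = fun k => C k j := hA (by rw [mulVec_col, mulVec_col, h])
  exact congrFun this i

/-- If a chain map `φ` commutes with null-homotopies `h, h'` of the multiplication by `f` in degree
zero up to `d₂ ρ`, then it commutes with them in degree one up to `-ρ d₁`. -/
lemma second_defect_eq {R : Type*} [CommRing R] {f : R} {d1 : Matrix κ₀ κ₁ R}
    {d1' : Matrix κ₀' κ₁' R} {d2 : Matrix κ₁ κ₂ R} {d2' : Matrix κ₁' κ₂' R}
    {h0 : Matrix κ₁ κ₀ R} {h0' : Matrix κ₁' κ₀' R} {h1 : Matrix κ₂ κ₁ R} {h1' : Matrix κ₂' κ₁' R}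
    {φ0 : Matrix κ₀' κ₀ R} {φ1 : Matrix κ₁' κ₁ R} {φ2 : Matrix κ₂' κ₂ R} {ρ : Matrix κ₂' κ₀ R}
    (inj' : Function.Injective d2'.mulVec) (b5 : h0 * d1 + d2 * h1 = f • 1)
    (b5' : h0' * d1' + d2' * h1' = f • 1) (hφ1 : d1' * φ1 = φ0 * d1) (hφ2 : d2' * φ2 = φ1 * d2)
    (hρ : d2' * ρ = φ1 * h0 - h0' * φ0) : φ2 * h1 - h1' * φ1 = -(ρ * d1) := by
  apply mul_left_cancel_of_mulVec_injective inj'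
  have h3 : d2' * (φ2 * h1) = f • φ1 - φ1 * h0 * d1 := by
    rw [← Matrix.mul_assoc, hφ2, Matrix.mul_assoc, ← sub_eq_of_eq_add' b5.symm, Matrix.mul_sub,
      Matrix.mul_smul, Matrix.mul_one, Matrix.mul_assoc]
  have h4 : d2' * (h1' * φ1) = f • φ1 - h0' * φ0 * d1 := by
    rw [← Matrix.mul_assoc, ← sub_eq_of_eq_add' b5'.symm, Matrix.sub_mul, Matrix.smul_mul,
      Matrix.one_mul, Matrix.mul_assoc, Matrix.mul_assoc, hφ1]
  rw [Matrix.mul_sub, h3, h4, Matrix.mul_neg, ← Matrix.mul_assoc, hρ, Matrix.sub_mul]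
  abel

variable {c : Fin n → ℂ} {u : κ₀ → Polynomial ℂ} {u' : κ₀' → Polynomial ℂ}
  {W : GradedMF D (κ₀ ⊕ κ₂) κ₁} {W' : GradedMF D (κ₀' ⊕ κ₂') κ₁'}

/-- A morphism between stabilizations of `ℂ[T]` that lifts the identity of `ℂ[T]`. -/
def LiftsId (c : Fin n → ℂ) (u : κ₀ → Polynomial ℂ) (u' : κ₀' → Polynomial ℂ)
    (φ : GradedMF.Hom W W') : Prop :=
  (∀ i j, φ.m0 (Sum.inl i) (Sum.inr j) = 0) ∧
    ∀ j, ∑ i, orbitMap D c (φ.m0 (Sum.inl i) (Sum.inl j)) * u' i = u j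

/-- The identity of `ℂ[T]` lifts to a map of the two resolutions. It extends to a morphism of the
matrix factorizations, because it commutes with the multiplication homotopies of `f` up to a
homotopy `ρ`, which becomes the lower left block of `m0`. -/
lemma exists_liftsId (hL : Nonempty (D.L ≃+ ℤ)) (h : Resolves c u W) (h' : Resolves c u' W') :
    ∃ φ : GradedMF.Hom W W', LiftsId c u u' φ := by
  obtain ⟨b1, b2, b3, b4, b5⟩ := block_identities W
  obtain ⟨b1', b2', b3', b4', b5'⟩ := block_identities W'
  obtain ⟨g, -, ex0, ex1, -⟩ := h
  obtain ⟨g', sur', ex0', ex1', inj'⟩ := h'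
  set d1 := W.q1.toRows₁ with hd1
  set h1 := W.q1.toRows₂ with hh1
  set h0 := W.q0.toCols₁ with hh0
  set d2 := W.q0.toCols₂ with hd2
  set d1' := W'.q1.toRows₁ with hd1'
  set h1' := W'.q1.toRows₂ with hh1'
  set h0' := W'.q0.toCols₁ with hh0'
  set d2' := W'.q0.toCols₂ with hd2'
  have gd1 : ∀ i j, D.IsHomog (d1 i j) (W.a (Sum.inl i) - (W.b j - D.fvec)) := fun i j => by
    rw [sub_sub_eq_add_sub]; exact W.homog1 (Sum.inl i) j
  have gd1' : ∀ i j, D.IsHomog (d1' i j) (W'.a (Sum.inl i) - (W'.b j - D.fvec)) := fun i j => by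
    rw [sub_sub_eq_add_sub]; exact W'.homog1 (Sum.inl i) j
  have gd2 : ∀ i j, D.IsHomog (d2 i j) (W.b i - D.fvec - (W.a (Sum.inr j) - D.fvec)) :=
    fun i j => by rw [sub_sub_sub_cancel_right]; exact W.homog0 i (Sum.inr j)
  have gd2' : ∀ i j, D.IsHomog (d2' i j) (W'.b i - D.fvec - (W'.a (Sum.inr j) - D.fvec)) :=
    fun i j => by rw [sub_sub_sub_cancel_right]; exact W'.homog0 i (Sum.inr j)
  -- the lift in homological degree zero
  choose v hv using fun j => sur' (u j)
  let φ0 : Matrix κ₀' κ₀ (MvPolynomial (Fin n) ℂ) := Matrix.of fun i j =>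
    weightedHomogeneousComponent D.xvec (W'.a (Sum.inl i) - W.a (Sum.inl j)) (v j i)
  have gφ0 : ∀ i j, D.IsHomog (φ0 i j) (W'.a (Sum.inl i) - W.a (Sum.inl j)) := fun i j =>
    weightedHomogeneousComponent_isWeightedHomogeneous _ _
  have hφ0 : ∀ j, ∑ i, orbitMap D c (φ0 i j) * u' i = u j := by
    intro j
    ext e
    rw [Polynomial.finsetSum_coeff]
    simp only [φ0, Matrix.of_apply]
    simp only [coeff_orbitMap_component hL _ (g' _), map_sub,
      sub_add_eq_add_sub, add_neg_cancel, zero_sub]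
    by_cases he : (isotropyOrder D c : ℤ) * e = -D.deg (W.a (Sum.inl j))
    · simp only [he, if_true]
      rw [← Polynomial.finsetSum_coeff, hv]
    · simp only [he, if_false, Finset.sum_const_zero]
      by_contra h2
      exact he (g j e (Polynomial.mem_support_iff.mpr (Ne.symm h2)))
  obtain ⟨φ1, gφ1, hφ1⟩ := Deformation.exists_homog_solution gd1'
    (Deformation.isHomog_mul gφ0 gd1) (fun j => by
      apply (ex0' _).mp
      have h3 : ∑ k, orbitMap D c (d1 k j) * u k = 0 :=
        (ex0 fun k => d1 k j).mpr ⟨Pi.single j 1, by ext1; simp⟩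
      rw [← h3]
      simp only [← hφ0, Matrix.mul_apply, map_sum, map_mul, Finset.mul_sum, Finset.sum_mul]
      rw [Finset.sum_comm]
      refine Finset.sum_congr rfl fun _ _ => Finset.sum_congr rfl fun _ _ => by ring)
  obtain ⟨φ2, gφ2, hφ2⟩ := Deformation.exists_homog_solution gd2'
    (Deformation.isHomog_mul gφ1 gd2) (fun j => by
      apply (ex1' _).mp
      rw [mulVec_col, ← Matrix.mul_assoc, hφ1, Matrix.mul_assoc, b2, Matrix.mul_zero]; rfl)
  -- the chain map commutes with the null-homotopies of `f` up to a map of degree two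
  have e0 : d1' * (φ1 * h0 - h0' * φ0) = 0 := by
    rw [Matrix.mul_sub, ← Matrix.mul_assoc, hφ1, Matrix.mul_assoc, b1, ← Matrix.mul_assoc, b1']
    simp
  have gh0 : ∀ i j, D.IsHomog (h0 i j) (W.b i - D.fvec - (W.a (Sum.inl j) - D.fvec)) :=
    fun i j => by rw [sub_sub_sub_cancel_right]; exact W.homog0 i (Sum.inl j)
  have gh0' : ∀ i j, D.IsHomog (h0' i j) (W'.b i - D.fvec - (W'.a (Sum.inl j) - D.fvec)) :=
    fun i j => by rw [sub_sub_sub_cancel_right]; exact W'.homog0 i (Sum.inl j)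
  obtain ⟨ρ, gρ, hρ⟩ := Deformation.exists_homog_solution (c := fun j => W.a (Sum.inl j) - D.fvec)
    (B := φ1 * h0 - h0' * φ0) gd2'
    (fun i j => (Deformation.isHomog_mul gφ1 gh0 i j).sub
      (Deformation.isHomog_mul gh0' (c := fun j => W.a (Sum.inl j) - D.fvec) (fun i j => by
        rw [sub_sub_sub_cancel_right]; exact gφ0 i j) i j)) (fun j => by
      apply (ex1' _).mp
      rw [mulVec_col, e0]; rfl)
  have e1 : φ2 * h1 - h1' * φ1 = -(ρ * d1) :=
    second_defect_eq inj' b5 b5' hφ1 hφ2 hρ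
  refine ⟨⟨Matrix.fromBlocks φ0 0 ρ φ2, φ1, ?_, ?_, ?_, ?_⟩, fun i j => rfl, hφ0⟩
  · rintro (i | i) (j | j)
    · exact gφ0 i j
    · exact .zero _
    · simpa using gρ i j
    · simpa using gφ2 i j
  · intro i j; simpa using gφ1 i j
  · rw [← Matrix.fromCols_toCols W.q0, ← Matrix.fromCols_toCols W'.q0,
      Matrix.fromCols_mul_fromBlocks, Matrix.mul_fromCols]
    congr 1
    · rw [hρ]; abel
    · rw [hφ2]; simp; rfl
  · rw [← Matrix.fromRows_toRows W.q1, ← Matrix.fromRows_toRows W'.q1,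
      Matrix.fromBlocks_mul_fromRows, Matrix.fromRows_mul]
    congr 1
    · rw [hφ1]; simp; rfl
    · rw [← sub_eq_zero, add_sub_assoc, e1]; exact add_neg_cancel _

/-- An endomorphism lifting the identity of `ℂ[T]` is homotopic to the identity: the homotopy
`s`, `s'` between the two lifts of the identity to the resolution is also one of matrix
factorizations, the lower left block being correct because the last differential is injective. -/
lemma homotopicToId_of_liftsId (h : Resolves c u W) (θ : GradedMF.Hom W W)
    (hθ : LiftsId c u u θ) : W.HomotopicToId θ.m0 θ.m1 := by
  obtain ⟨b1, b2, b3, b4, b5⟩ := block_identities W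
  obtain ⟨-, -, ex0, ex1, inj⟩ := h
  obtain ⟨hz, hid⟩ := hθ
  have q1 := W.q1.fromRows_toRows.symm
  have q0 := W.q0.fromCols_toCols.symm
  have m0 := θ.m0.fromBlocks_toBlocks.symm
  have z12 : θ.m0.toBlocks₁₂ = 0 := by ext1 i j; exact hz i j
  have g0 := W.homog0
  have g1 := W.homog1
  have gθ0 := θ.homog0
  have gθ1 := θ.homog1
  have c0 := θ.comm0
  have c1 := θ.comm1
  rw [m0, z12, q1, Matrix.fromBlocks_mul_fromRows, Matrix.fromRows_mul] at c1
  rw [m0, z12, q0, Matrix.fromCols_mul_fromBlocks, Matrix.mul_fromCols] at c0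
  unfold GradedMF.HomotopicToId
  have gd1 : ∀ i j, D.IsHomog (W.q1.toRows₁ i j) (W.a (Sum.inl i) - (W.b j - D.fvec)) :=
    fun i j => by rw [sub_sub_eq_add_sub]; exact g1 (Sum.inl i) j
  have gd2 : ∀ i j, D.IsHomog (W.q0.toCols₂ i j) (W.b i - W.a (Sum.inr j)) :=
    fun i j => g0 i (Sum.inr j)
  have gφ0 : ∀ i j, D.IsHomog (θ.m0.toBlocks₁₁ i j) (W.a (Sum.inl i) - W.a (Sum.inl j)) :=
    fun i j => gθ0 _ _
  set d1 := W.q1.toRows₁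
  set h1 := W.q1.toRows₂
  set h0 := W.q0.toCols₁
  set d2 := W.q0.toCols₂
  set φ0 := θ.m0.toBlocks₁₁
  set σ := θ.m0.toBlocks₂₁
  set φ2 := θ.m0.toBlocks₂₂
  set φ1 := θ.m1
  obtain ⟨c01, c02⟩ := Matrix.fromCols_inj c0
  obtain ⟨c11, c12⟩ := Matrix.fromRows_inj c1
  simp only [Matrix.zero_mul, Matrix.mul_zero, add_zero, zero_add] at c02 c11
  have one0 : ∀ i j, D.IsHomog ((1 : Matrix κ₀ κ₀ (MvPolynomial (Fin n) ℂ)) i j)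
      (W.a (Sum.inl i) - W.a (Sum.inl j)) := by
    intro i j
    rw [Matrix.one_apply]
    split_ifs with h
    · subst h; rw [sub_self]; exact Deformation.isHomog_one
    · exact .zero _
  have one1 : ∀ i j, D.IsHomog ((1 : Matrix κ₁ κ₁ (MvPolynomial (Fin n) ℂ)) i j)
      (W.b i - W.b j) := by
    intro i j
    rw [Matrix.one_apply]
    split_ifs with h
    · subst h; rw [sub_self]; exact Deformation.isHomog_one
    · exact .zero _
  -- the homotopy on the resolution
  obtain ⟨s, gs, hs⟩ := Deformation.exists_homog_solution (B := φ0 - 1) gd1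
    (fun i j => (gφ0 i j).sub (one0 i j)) (fun j => by
      apply (ex0 _).mp
      simp only [Matrix.sub_apply, map_sub, sub_mul, Finset.sum_sub_distrib]
      rw [sub_eq_zero]
      refine (hid j).trans ?_
      rw [Finset.sum_eq_single j] <;> simp +contextual)
  obtain ⟨s', gs', hs'⟩ := Deformation.exists_homog_solution (B := φ1 - 1 - s * d1) gd2
    (fun i j => ((gθ1 i j).sub (one1 i j)).sub (by
      have := Deformation.isHomog_mul gs gd1 i j
      rwa [sub_sub_sub_cancel_right] at this)) (fun j => by
      apply (ex1 _).mp
      rw [mulVec_col, Matrix.mul_sub, Matrix.mul_sub, ← c11, ← Matrix.mul_assoc, hs,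
        Matrix.sub_mul, Matrix.mul_one, Matrix.one_mul, sub_self]; rfl)
  have e2 : φ2 - 1 = s' * d2 := by
    apply mul_left_cancel_of_mulVec_injective inj
    rw [Matrix.mul_sub, ← c02, ← Matrix.mul_assoc, hs', Matrix.sub_mul, Matrix.sub_mul,
      Matrix.mul_assoc s, b2, Matrix.mul_one, Matrix.mul_zero, sub_zero, Matrix.one_mul]
  have e3 : σ = h1 * s + s' * h0 := by
    apply mul_left_cancel_of_mulVec_injective inj
    have e4 : d2 * σ = φ1 * h0 - h0 * (d1 * s + 1) := by rw [hs, sub_add_cancel, c01]; abel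
    rw [e4, Matrix.mul_add d2, ← Matrix.mul_assoc d2 s', hs', ← Matrix.mul_assoc d2 h1,
      ← sub_eq_of_eq_add' b5.symm]
    simp only [Matrix.sub_mul, Matrix.mul_add, Matrix.smul_mul, Matrix.one_mul, Matrix.mul_one,
      Matrix.mul_assoc, b1, Matrix.mul_smul]
    abel
  refine ⟨Matrix.fromCols s 0, Matrix.fromRows 0 s', ?_, ?_, ?_, ?_⟩
  · rintro i (j | j)
    · exact gs i j
    · exact .zero _
  · rintro (i | i) j
    · exact .zero _
    · exact gs' i j
  · rw [m0, z12, q1, q0, Matrix.fromRows_mul_fromCols, Matrix.fromRows_mul_fromCols,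
      Matrix.fromBlocks_add, ← Matrix.fromBlocks_one, sub_eq_add_neg, Matrix.fromBlocks_neg,
      Matrix.fromBlocks_add, Matrix.fromBlocks_inj]
    refine ⟨?_, ?_, ?_, ?_⟩
    · rw [hs]; simp [sub_eq_add_neg]
    · simp
    · rw [neg_zero, add_zero]; exact e3
    · rw [Matrix.mul_zero, zero_add, ← e2, sub_eq_add_neg]
  · rw [q1, q0, Matrix.fromCols_mul_fromRows, Matrix.fromCols_mul_fromRows, hs']
    simp

lemma LiftsId.comp {κ₀'' κ₁'' κ₂'' : Type} [Fintype κ₀''] [Fintype κ₁''] [Fintype κ₂'']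
    [DecidableEq κ₀''] [DecidableEq κ₁''] [DecidableEq κ₂''] {u'' : κ₀'' → Polynomial ℂ}
    {W'' : GradedMF D (κ₀'' ⊕ κ₂'') κ₁''} {φ : GradedMF.Hom W W'} {ψ : GradedMF.Hom W' W''}
    (hφ : LiftsId c u u' φ) (hψ : LiftsId c u' u'' ψ) : LiftsId c u u'' (ψ.comp φ) := by
  constructor
  · intro i j
    simp [GradedMF.Hom.comp, Matrix.mul_apply, hφ.1, hψ.1]
  · intro j
    rw [← hφ.2 j]
    simp only [GradedMF.Hom.comp, Matrix.mul_apply, Fintype.sum_sum_type, hψ.1, zero_mul,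
      Finset.sum_const_zero, add_zero, map_sum, map_mul, Finset.sum_mul, ← hψ.2, Finset.mul_sum]
    rw [Finset.sum_comm]
    refine Finset.sum_congr rfl fun _ _ => Finset.sum_congr rfl fun _ _ => by ring

/-- Any two stabilizations of the module of functions on the normalized orbit closure are
isomorphic in the homotopy category. -/
lemma iso_of_resolves (hL : Nonempty (D.L ≃+ ℤ)) (h : Resolves c u W) (h' : Resolves c u' W') :
    W.Iso W' := by
  obtain ⟨φ, hφ⟩ := exists_liftsId hL h h'
  obtain ⟨ψ, hψ⟩ := exists_liftsId hL h' h
  exact ⟨φ, ψ, homotopicToId_of_liftsId h (ψ.comp φ) (hφ.comp hψ),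
    homotopicToId_of_liftsId h' (φ.comp ψ) (hψ.comp hφ)⟩

end Uniqueness

/-! ### The resolution of the functions on the normalized orbit closure -/

section LinearTerms
variable {n : ℕ}

lemma eval_zero_pderiv (p : MvPolynomial (Fin n) ℂ) (j : Fin n) :
    eval 0 (pderiv j p) = coeff (Finsupp.single j 1) p := by
  simp [MvPolynomial.eval_zero, constantCoeff_eq, coeff_pderiv]

/-- The linear part of a weighted homogeneous polynomial involves only variables of its degree. -/
lemma weight_eq_of_eval_zero_pderiv_ne_zero {M : Type*} [AddCommMonoid M] {w : Fin n → M}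
    {p : MvPolynomial (Fin n) ℂ} {m : M} (hp : IsWeightedHomogeneous w p m) {j : Fin n}
    (h : eval 0 (pderiv j p) ≠ 0) : w j = m := by
  rw [eval_zero_pderiv] at h
  rw [← hp h]
  simp [Finsupp.weight_single]

lemma degree_eq_of_eval_zero_ne_zero {M : Type*} [AddCommMonoid M] {w : Fin n → M}
    {p : MvPolynomial (Fin n) ℂ} {m : M} (hp : IsWeightedHomogeneous w p m)
    (h : eval 0 p ≠ 0) : m = 0 := by
  rw [MvPolynomial.eval_zero, constantCoeff_eq] at h
  rw [← hp h, map_zero]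

lemma eval_zero_pderiv_poly {D : Deformation 3} (hε : D.epsilon = -1) (j : Fin 3) :
    eval 0 (pderiv j D.poly) = 0 := by
  by_contra h
  have h1 := weight_eq_of_eval_zero_pderiv_ne_zero D.isWeightedHomogeneous_poly h
  rw [Deformation.epsilon, Fin.sum_univ_three] at hε
  have h2 : D.w j ≤ D.w 0 + D.w 1 + D.w 2 := by fin_cases j <;> simp <;> omega
  omega

end LinearTerms

section Existence

variable {n : ℕ} {D : Deformation n} {c : Fin n → ℂ} {κ₀ κ₁ κ₂ : Type} [Fintype κ₀] [Fintype κ₁]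
  [Fintype κ₂] [DecidableEq κ₀] [DecidableEq κ₁] [DecidableEq κ₂]

lemma eval_one_orbitMap (p : MvPolynomial (Fin n) ℂ) : (orbitMap D c p).eval 1 = eval c p := by
  induction p using MvPolynomial.induction_on with
  | C a => simp [orbitMap]
  | add p q hp hq => simp [hp, hq]
  | mul_X p j hp => rw [map_mul, Polynomial.eval_mul, hp]; simp [orbitMap]

lemma isotropyOrder_pos (hc : c ≠ 0) : 0 < isotropyOrder D c := by
  obtain ⟨j, hj⟩ := Function.ne_iff.mp hc
  exact Nat.pos_of_dvd_of_pos (isotropyOrder_dvd hj) (D.w_pos j)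

lemma orbitMap_poly (hL : Nonempty (D.L ≃+ ℤ)) (hc : c ≠ 0) (h : eval c D.poly = 0) :
    orbitMap D c D.poly = 0 := by
  by_contra h0
  obtain ⟨e, he⟩ : ∃ e, (orbitMap D c D.poly).coeff e ≠ 0 := by
    by_contra! h1
    exact h0 (Polynomial.ext (by simpa using h1))
  have hα := isotropyOrder_pos (D := D) hc
  have he' := deg_of_coeff_orbitMap_ne_zero hL Deformation.isHomog_poly he
  rw [← eval_one_orbitMap (D := D), Polynomial.eval_eq_sum, Polynomial.sum,
    Finset.sum_eq_single e] at h
  · simp at h; exact he h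
  · intro b hb hbe
    have hb' := deg_of_coeff_orbitMap_ne_zero hL Deformation.isHomog_poly
      (Polynomial.mem_support_iff.mp hb)
    rw [← he'] at hb'
    have := mul_left_cancel₀ (by exact_mod_cast hα.ne') hb'
    exact absurd (by exact_mod_cast this) hbe
  · intro h1
    simpa using h1

/-- A graded free resolution of `ℂ[T]` carries null-homotopies of the multiplication by `f`, since
`f` annihilates `ℂ[T]`; together with the differentials they form a stabilization. -/
lemma exists_resolves (hL : Nonempty (D.L ≃+ ℤ)) (hc : c ≠ 0) (h : eval c D.poly = 0)
    {a0 : κ₀ → D.L} {b1 : κ₁ → D.L} {a2 : κ₂ → D.L} {u : κ₀ → Polynomial ℂ}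
    {d1 : Matrix κ₀ κ₁ (MvPolynomial (Fin n) ℂ)} {d2 : Matrix κ₁ κ₂ (MvPolynomial (Fin n) ℂ)}
    (g1 : ∀ i j, D.IsHomog (d1 i j) (a0 i - b1 j)) (g2 : ∀ i j, D.IsHomog (d2 i j) (b1 i - a2 j))
    (hu : ∀ k, ∀ e ∈ (u k).support, (isotropyOrder D c : ℤ) * e = -D.deg (a0 k))
    (sur : ∀ g : Polynomial ℂ, ∃ v : κ₀ → MvPolynomial (Fin n) ℂ,
      ∑ k, orbitMap D c (v k) * u k = g)
    (ex0 : ∀ v : κ₀ → MvPolynomial (Fin n) ℂ,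
      ∑ k, orbitMap D c (v k) * u k = 0 ↔ ∃ y, d1.mulVec y = v)
    (ex1 : ∀ y : κ₁ → MvPolynomial (Fin n) ℂ, d1.mulVec y = 0 ↔ ∃ t, d2.mulVec t = y)
    (inj : Function.Injective d2.mulVec) :
    ∃ W : GradedMF D (κ₀ ⊕ κ₂) κ₁, Resolves c u W ∧ W.q1.toRows₁ = d1 ∧ W.q0.toCols₂ = d2 ∧
      W.a = Sum.elim a0 (fun k => a2 k + D.fvec) ∧ W.b = fun k => b1 k + D.fvec := by
  have hf := orbitMap_poly hL hc h
  have d12 : d1 * d2 = 0 := by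
    ext1 i j
    have := (ex1 (fun k => d2 k j)).mpr ⟨Pi.single j 1, by ext1; simp⟩
    rw [mulVec_col] at this
    exact congrFun this i
  have smul_homog : ∀ {κ : Type} [DecidableEq κ] (a : κ → D.L), ∀ i j,
      D.IsHomog ((D.poly • (1 : Matrix κ κ (MvPolynomial (Fin n) ℂ))) i j)
        (a i - (a j - D.fvec)) := by
    intro κ _ a i j
    rw [Matrix.smul_apply, Matrix.one_apply]
    split_ifs with hij
    · subst hij; rw [sub_sub_cancel, smul_eq_mul, mul_one]; exact Deformation.isHomog_poly
    · rw [smul_zero]; exact .zero _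
  obtain ⟨h0, gh0, e0⟩ := Deformation.exists_homog_solution (B := D.poly • 1) g1 (smul_homog a0)
    (fun j => by
      apply (ex0 _).mp
      simp [Matrix.smul_apply, hf])
  obtain ⟨h1, gh1, e1⟩ := Deformation.exists_homog_solution (B := D.poly • 1 - h0 * d1) g2
    (fun i j => (smul_homog b1 i j).sub (Deformation.isHomog_mul gh0
      (c := fun j => b1 j - D.fvec) (fun i j => by
        rw [sub_sub_sub_cancel_right]; exact g1 i j) i j)) (fun j => by
      apply (ex1 _).mp
      rw [mulVec_col, Matrix.mul_sub, ← Matrix.mul_assoc, e0]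
      ext1 i
      simp)
  have e2 : h1 * d2 = D.poly • 1 := by
    apply mul_left_cancel_of_mulVec_injective inj
    rw [← Matrix.mul_assoc, e1, Matrix.sub_mul, Matrix.mul_assoc, d12]
    simp
  have e3 : h1 * h0 = 0 := by
    apply mul_left_cancel_of_mulVec_injective inj
    rw [← Matrix.mul_assoc, e1, Matrix.sub_mul, Matrix.mul_assoc, e0]
    simp
  refine ⟨⟨Sum.elim a0 (fun k => a2 k + D.fvec), fun k => b1 k + D.fvec, Matrix.fromCols h0 d2,
    Matrix.fromRows d1 h1, ?_, ?_, ?_, ?_⟩, ⟨hu, sur, ex0, ex1, inj⟩, ?_, ?_, rfl, rfl⟩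
  · rintro i (j | j)
    · have := gh0 i j
      rwa [← sub_add, sub_add_eq_add_sub] at this
    · simpa using g2 i j
  · rintro (i | i) j
    · simpa using g1 i j
    · have := gh1 i j
      simpa [← sub_add, sub_add_eq_add_sub] using this
  · rw [Matrix.fromRows_mul_fromCols, e0, d12, e3, e2]
    ext1 (i | i) (j | j) <;> simp [Matrix.diagonal_apply, Matrix.one_apply]
  · rw [Matrix.fromCols_mul_fromRows, e1]
    ext1 i j
    simp [Matrix.diagonal_apply, Matrix.one_apply]
  · rfl
  · rfl

end Existence

/-- A choice of names `x`, `y`, `z` for the three coordinates at a point `c ≠ 0` of a coordinate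
hyperplane: `c_x` vanishes, `c_y` does not, and `y` has minimal weight among the coordinates that do
not vanish at `c`. -/
structure OrbitCoordinates (D : Deformation 3) (c : Fin 3 → ℂ) where
  x : Fin 3
  y : Fin 3
  z : Fin 3
  cover : ∀ j, j = x ∨ j = y ∨ j = z
  xy : x ≠ y
  xz : x ≠ z
  yz : y ≠ z
  cx : c x = 0
  cy : c y ≠ 0
  cz : c z ≠ 0 → D.w y ≤ D.w z

lemma exists_orbitCoordinates {D : Deformation 3} {c : Fin 3 → ℂ} (hc : c ≠ 0)
    (h : ∃ j, c j = 0) : Nonempty (OrbitCoordinates D c) := by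
  obtain ⟨x, hx⟩ := h
  have key : ∃ y z : Fin 3, (∀ j, j = x ∨ j = y ∨ j = z) ∧ x ≠ y ∧ x ≠ z ∧ y ≠ z := by
    fin_cases x
    · exact ⟨1, 2, by decide, by decide, by decide, by decide⟩
    · exact ⟨0, 2, by decide, by decide, by decide, by decide⟩
    · exact ⟨0, 1, by decide, by decide, by decide, by decide⟩
  obtain ⟨y, z, cov, xy, xz, yz⟩ := key
  have cov' : ∀ j, j = x ∨ j = z ∨ j = y := fun j => by rcases cov j with h | h | h <;> simp [h]
  have hyz : c y ≠ 0 ∨ c z ≠ 0 := by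
    by_contra! h
    refine hc (funext fun j => ?_)
    rcases cov j with rfl | rfl | rfl
    exacts [hx, h.1, h.2]
  by_cases hy : c y = 0
  · have hz := hyz.resolve_left (not_not.mpr hy)
    exact ⟨⟨x, z, y, cov', xz, xy, yz.symm, hx, hz, fun h => absurd hy h⟩⟩
  · rcases le_total (D.w y) (D.w z) with hle | hle
    · exact ⟨⟨x, y, z, cov, xy, xz, yz, hx, hy, fun _ => hle⟩⟩
    · by_cases hz : c z = 0
      · exact ⟨⟨x, y, z, cov, xy, xz, yz, hx, hy, fun h => absurd hz h⟩⟩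
      · exact ⟨⟨x, z, y, cov', xz, xy, yz.symm, hx, hz, fun _ => hle⟩⟩

namespace OrbitCoordinates

variable {D : Deformation 3} {c : Fin 3 → ℂ} (O : OrbitCoordinates D c)

/-- The exponent `p` of `T` in the restriction of `y`. -/
noncomputable def p : ℕ := D.w O.y / isotropyOrder D c

/-- The exponent `q` of `T` in the restriction of `z`. -/
noncomputable def q : ℕ := D.w O.z / isotropyOrder D c

lemma isotropy_mul_p : isotropyOrder D c * O.p = D.w O.y :=
  Nat.mul_div_cancel' (isotropyOrder_dvd O.cy)

lemma isotropy_mul_q (h : c O.z ≠ 0) : isotropyOrder D c * O.q = D.w O.z :=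
  Nat.mul_div_cancel' (isotropyOrder_dvd h)

lemma p_pos : 0 < O.p := by
  have h := O.isotropy_mul_p
  have := D.w_pos O.y
  exact Nat.pos_of_ne_zero fun h0 => by rw [h0] at h; omega

lemma p_le_q (h : c O.z ≠ 0) : O.p ≤ O.q := Nat.div_le_div_right (O.cz h)

lemma orbitMap_x : orbitMap D c (X O.x) = 0 := by simp [orbitMap, O.cx]

lemma orbitMap_y : orbitMap D c (X O.y) = Polynomial.C (c O.y) * Polynomial.X ^ O.p := by
  simp [orbitMap, p]

lemma orbitMap_z : orbitMap D c (X O.z) = Polynomial.C (c O.z) * Polynomial.X ^ O.q := by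
  simp [orbitMap, q]

/-- The matrix of the multiplication by `z` on `ℂ[T]`, as a module over `ℂ[y]` with the basis
`1, T, …, T ^ (p - 1)`. -/
noncomputable def mulZ : Matrix (Fin O.p) (Fin O.p) (MvPolynomial (Fin 3) ℂ) := Matrix.of fun r k =>
  if (k + O.q) % O.p = r then
    C (c O.z * (c O.y)⁻¹ ^ ((k + O.q) / O.p)) * X O.y ^ ((k + O.q) / O.p)
  else 0

/-- The presentation matrix of `ℂ[T]` over `ℂ[y, z]`. -/
noncomputable def pres : Matrix (Fin O.p) (Fin O.p) (MvPolynomial (Fin 3) ℂ) :=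
  (X O.z : MvPolynomial (Fin 3) ℂ) • 1 - O.mulZ

/-- The first differential of the resolution of `ℂ[T]` over `ℂ[x, y, z]`, on which `x` acts by
zero. -/
noncomputable def d₁ : Matrix (Fin O.p) (Fin O.p ⊕ Fin O.p) (MvPolynomial (Fin 3) ℂ) :=
  Matrix.fromCols O.pres ((X O.x : MvPolynomial (Fin 3) ℂ) • 1)

/-- The second differential of the resolution of `ℂ[T]` over `ℂ[x, y, z]`. -/
noncomputable def d₂ : Matrix (Fin O.p ⊕ Fin O.p) (Fin O.p) (MvPolynomial (Fin 3) ℂ) :=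
  Matrix.fromRows (-((X O.x : MvPolynomial (Fin 3) ℂ) • 1)) O.pres

/-- The surjection `v ↦ ∑ v_k T ^ k` from the free module with basis `1, T, …, T ^ (p - 1)`. -/
noncomputable def augment (v : Fin O.p → MvPolynomial (Fin 3) ℂ) : Polynomial ℂ :=
  ∑ k, orbitMap D c (v k) * Polynomial.X ^ (k : ℕ)

lemma augment_add (v v' : Fin O.p → MvPolynomial (Fin 3) ℂ) :
    O.augment (v + v') = O.augment v + O.augment v' := by
  simp [augment, add_mul, Finset.sum_add_distrib]

lemma augment_smul (s : MvPolynomial (Fin 3) ℂ) (v : Fin O.p → MvPolynomial (Fin 3) ℂ) :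
    O.augment (s • v) = orbitMap D c s * O.augment v := by
  simp [augment, Finset.mul_sum, mul_assoc]

lemma augment_single (k : Fin O.p) (s : MvPolynomial (Fin 3) ℂ) :
    O.augment (Pi.single k s) = orbitMap D c s * Polynomial.X ^ (k : ℕ) := by
  rw [augment, Finset.sum_eq_single k] <;> simp +contextual

lemma augment_surjective (g : Polynomial ℂ) : ∃ v, O.augment v = g := by
  induction g using Polynomial.induction_on' with
  | add g g' h h' =>
    obtain ⟨v, rfl⟩ := h
    obtain ⟨v', rfl⟩ := h'
    exact ⟨v + v', O.augment_add v v'⟩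
  | monomial e a =>
    refine ⟨Pi.single ⟨e % O.p, Nat.mod_lt _ O.p_pos⟩
      (C (a * (c O.y)⁻¹ ^ (e / O.p)) * X O.y ^ (e / O.p)), ?_⟩
    have hy := O.cy
    rw [augment_single, map_mul, map_pow, orbitMap_y]
    conv_rhs => rw [← Nat.div_add_mod e O.p]
    rw [← Polynomial.C_mul_X_pow_eq_monomial, pow_add, mul_pow, ← pow_mul]
    simp only [orbitMap, aeval_C, Polynomial.algebraMap_eq, ← Polynomial.C_pow]
    rw [← mul_assoc, ← mul_assoc, ← Polynomial.C_mul, mul_assoc a, ← mul_pow, inv_mul_cancel₀ hy,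
      one_pow, mul_one]

lemma augment_mulZ (v : Fin O.p → MvPolynomial (Fin 3) ℂ) :
    O.augment (O.mulZ.mulVec v) = orbitMap D c (X O.z) * O.augment v := by
  have hy := O.cy
  simp only [augment, Matrix.mulVec, dotProduct, map_sum, Finset.sum_mul, Finset.mul_sum, map_mul]
  rw [Finset.sum_comm]
  refine Finset.sum_congr rfl fun k _ => ?_
  rw [Finset.sum_eq_single ⟨(k + O.q) % O.p, Nat.mod_lt _ O.p_pos⟩]
  · simp only [mulZ, Matrix.of_apply, if_true, map_mul, map_pow, orbitMap_y, orbitMap_z]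
    simp only [orbitMap, aeval_C, Polynomial.algebraMap_eq]
    have h1 : (Polynomial.X : Polynomial ℂ) ^ O.q * Polynomial.X ^ (k : ℕ)
        = (Polynomial.X ^ O.p) ^ ((k + O.q) / O.p) * Polynomial.X ^ ((k + O.q) % O.p) := by
      rw [← pow_mul, ← pow_add, ← pow_add, Nat.div_add_mod, add_comm]
    have h2 : Polynomial.C (c O.z) * Polynomial.C (c O.y)⁻¹ ^ ((k + O.q) / O.p)
        * Polynomial.C (c O.y) ^ ((k + O.q) / O.p) = Polynomial.C (c O.z) := by
      rw [mul_assoc, ← mul_pow, ← Polynomial.C_mul, inv_mul_cancel₀ hy, Polynomial.C_1, one_pow,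
        mul_one]
    rw [mul_pow]
    generalize (aeval fun j => Polynomial.C (c j) *
      Polynomial.X ^ (D.w j / isotropyOrder D c)) (v k) = π
    linear_combination (π * (Polynomial.X ^ O.p) ^ ((k + O.q) / O.p) *
      Polynomial.X ^ ((k + O.q) % O.p)) * h2 - Polynomial.C (c O.z) * π * h1
  · intro r _ hr
    have : ¬ ((k + O.q) % O.p = r) := fun h => hr (Fin.ext h.symm)
    simp [mulZ, this]
  · simp

lemma d₁_mulVec (v : Fin O.p ⊕ Fin O.p → MvPolynomial (Fin 3) ℂ) :
    O.d₁.mulVec v = (X O.z : MvPolynomial (Fin 3) ℂ) • (v ∘ Sum.inl)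
      - O.mulZ.mulVec (v ∘ Sum.inl) + (X O.x : MvPolynomial (Fin 3) ℂ) • (v ∘ Sum.inr) := by
  rw [d₁, Matrix.fromCols_mulVec, pres, Matrix.sub_mulVec, Matrix.smul_mulVec, Matrix.smul_mulVec,
    Matrix.one_mulVec, Matrix.one_mulVec]

lemma augment_d₁ (v : Fin O.p ⊕ Fin O.p → MvPolynomial (Fin 3) ℂ) :
    O.augment (O.d₁.mulVec v) = 0 := by
  have h := O.augment_mulZ (v ∘ Sum.inl)
  have h2 := O.augment_add
    ((X O.z : MvPolynomial (Fin 3) ℂ) • (v ∘ Sum.inl) - O.mulZ.mulVec (v ∘ Sum.inl))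
    (O.mulZ.mulVec (v ∘ Sum.inl))
  rw [sub_add_cancel, augment_smul, h] at h2
  rw [d₁_mulVec, augment_add, augment_smul, orbitMap_x, zero_mul, add_zero]
  simpa using h2

/-- Modulo the image of the first differential, every vector has entries in `ℂ[y]`. -/
lemma exists_reduction (v : Fin O.p → MvPolynomial (Fin 3) ℂ) :
    ∃ (t : Fin O.p ⊕ Fin O.p → MvPolynomial (Fin 3) ℂ) (g : Fin O.p → Polynomial ℂ),
      v = O.d₁.mulVec t + fun k => Polynomial.aeval (X O.y : MvPolynomial (Fin 3) ℂ) (g k) := by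
  let P : (Fin O.p → MvPolynomial (Fin 3) ℂ) → Prop := fun v =>
    ∃ (t : Fin O.p ⊕ Fin O.p → MvPolynomial (Fin 3) ℂ) (g : Fin O.p → Polynomial ℂ),
      v = O.d₁.mulVec t + fun k => Polynomial.aeval (X O.y : MvPolynomial (Fin 3) ℂ) (g k)
  have hadd : ∀ v v', P v → P v' → P (v + v') := by
    rintro _ _ ⟨t, g, rfl⟩ ⟨t', g', rfl⟩
    refine ⟨t + t', g + g', ?_⟩
    rw [Matrix.mulVec_add]
    ext1 k
    simp only [Pi.add_apply, map_add]
    ring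
  have hy : ∀ (s : Polynomial ℂ) v, P v →
      P (Polynomial.aeval (X O.y : MvPolynomial (Fin 3) ℂ) s • v) := by
    rintro s _ ⟨t, g, rfl⟩
    refine ⟨Polynomial.aeval (X O.y : MvPolynomial (Fin 3) ℂ) s • t, s • g, ?_⟩
    rw [Matrix.mulVec_smul, smul_add]
    congr 1
    ext1 k
    simp
  have hx : ∀ v, P ((X O.x : MvPolynomial (Fin 3) ℂ) • v) := by
    intro v
    refine ⟨Sum.elim 0 v, 0, ?_⟩
    rw [d₁_mulVec]
    ext1 k
    simp
  have hz : ∀ v, P v → P ((X O.z : MvPolynomial (Fin 3) ℂ) • v) := by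
    rintro _ ⟨t, g, rfl⟩
    refine ⟨(X O.z : MvPolynomial (Fin 3) ℂ) • t
        + Sum.elim (fun k => Polynomial.aeval (X O.y : MvPolynomial (Fin 3) ℂ) (g k)) 0,
      fun r => ∑ k : Fin O.p, (if ((k : ℕ) + O.q) % O.p = r then
      Polynomial.C (c O.z * (c O.y)⁻¹ ^ (((k : ℕ) + O.q) / O.p)) *
        Polynomial.X ^ (((k : ℕ) + O.q) / O.p) else 0) * g k, ?_⟩
    rw [Matrix.mulVec_add, Matrix.mulVec_smul, smul_add, add_assoc]
    congr 1
    rw [d₁_mulVec]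
    ext1 r
    simp only [Pi.add_apply, Pi.sub_apply, Matrix.mulVec, dotProduct, map_sum, map_mul,
      Function.comp_apply, Sum.elim_inl, Sum.elim_inr, mulZ, Matrix.of_apply, apply_ite
      (Polynomial.aeval (X O.y : MvPolynomial (Fin 3) ℂ)), Polynomial.aeval_C, map_pow,
      Polynomial.aeval_X, map_zero, algebraMap_eq, Pi.smul_apply, Pi.zero_apply, smul_zero]
    ring
  have hmul : ∀ (s : MvPolynomial (Fin 3) ℂ) v, P v → P (s • v) := by
    intro s
    induction s using MvPolynomial.induction_on with
    | C a => intro v hv; simpa using hy (Polynomial.C a) v hv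
    | add s s' h h' => intro v hv; rw [add_smul]; exact hadd _ _ (h v hv) (h' v hv)
    | mul_X s j h =>
      intro v hv
      rw [mul_smul]
      apply h
      rcases O.cover j with rfl | rfl | rfl
      · exact hx v
      · simpa using hy Polynomial.X v hv
      · exact hz v hv
  have hv : v = ∑ k, v k • (Pi.single k 1 : Fin O.p → MvPolynomial (Fin 3) ℂ) := by
    ext1 k; simp [Finset.sum_apply, Pi.single_apply]
  rw [hv]
  apply Finset.sum_induction _ P hadd
  · exact ⟨0, 0, by ext1 k; simp⟩
  · intro k _
    refine hmul _ _ ⟨0, Pi.single k 1, ?_⟩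
    ext1 r
    by_cases h : r = k
    · subst h; simp
    · simp [h]

/-- Exactness at the free module of rank `p`: modulo the image of `d₁` all entries are in `ℂ[y]`,
and `1, T, …, T ^ (p - 1)` are independent over `ℂ[y]`. -/
lemma augment_eq_zero_iff (v : Fin O.p → MvPolynomial (Fin 3) ℂ) :
    O.augment v = 0 ↔ ∃ t, O.d₁.mulVec t = v := by
  constructor
  · intro h
    obtain ⟨t, g, hv⟩ := O.exists_reduction v
    suffices hg : g = 0 by exact ⟨t, by rw [hv, hg]; ext1 k; simp⟩
    rw [hv, augment_add, augment_d₁, zero_add] at h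
    have h2 : ∀ s : Polynomial ℂ, orbitMap D c (Polynomial.aeval (X O.y : MvPolynomial (Fin 3) ℂ) s)
        = Polynomial.expand ℂ O.p (s.comp (Polynomial.C (c O.y) * Polynomial.X)) := by
      intro s
      rw [← Polynomial.aeval_algHom_apply, orbitMap_y, Polynomial.expand_eq_comp_X_pow,
        Polynomial.comp_assoc, Polynomial.aeval_def, Polynomial.comp, Polynomial.algebraMap_eq]
      simp
    ext k n
    have h3 := congrArg (fun g => Polynomial.coeff g (O.p * n + k)) h
    simp only [augment, h2, Polynomial.finsetSum_coeff, Polynomial.coeff_zero] at h3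
    rw [Finset.sum_eq_single k] at h3
    · rw [Polynomial.coeff_mul_X_pow, Polynomial.coeff_expand_mul' O.p_pos,
        Polynomial.comp_C_mul_X_coeff] at h3
      simpa [O.cy] using h3
    · intro r _ hr
      rw [Polynomial.coeff_mul_X_pow']
      split_ifs with hle
      · rw [Polynomial.coeff_expand O.p_pos, if_neg]
        intro hdvd
        apply hr
        have h4 := (Nat.modEq_iff_dvd' hle).mpr hdvd
        unfold Nat.ModEq at h4
        rw [Nat.mul_add_mod, Nat.mod_eq_of_lt r.2, Nat.mod_eq_of_lt k.2] at h4
        exact Fin.ext h4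
      · rfl
    · simp
  · rintro ⟨t, rfl⟩
    exact O.augment_d₁ t

lemma mulZ_apply_eq (r k : Fin O.p) : ∃ (a : ℂ) (n : ℕ), O.mulZ r k = C a * X O.y ^ n ∧
    (a ≠ 0 → c O.z ≠ 0 ∧ (k : ℕ) + O.q = O.p * n + r ∧ 0 < n) := by
  by_cases hz : c O.z = 0
  · exact ⟨0, 0, by simp [mulZ, hz], by simp⟩
  by_cases h : ((k : ℕ) + O.q) % O.p = r
  · refine ⟨_, _, by rw [mulZ, Matrix.of_apply, if_pos h], fun _ => ⟨hz, ?_, ?_⟩⟩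
    · rw [← h, Nat.div_add_mod]
    · exact Nat.div_pos ((O.p_le_q hz).trans (Nat.le_add_left _ _)) O.p_pos
  · exact ⟨0, 0, by simp [mulZ, h], by simp⟩

lemma eval_zero_mulZ (r k : Fin O.p) : eval 0 (O.mulZ r k) = 0 := by
  obtain ⟨a, n, h, ha⟩ := O.mulZ_apply_eq r k
  rw [h]
  by_cases h0 : a = 0
  · simp [h0]
  · simp [(ha h0).2.2.ne']

lemma pderiv_mulZ {j : Fin 3} (hj : j ≠ O.y) (r k : Fin O.p) : pderiv j (O.mulZ r k) = 0 := by
  obtain ⟨a, n, h, -⟩ := O.mulZ_apply_eq r k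
  rw [h]
  simp [pderiv_X_of_ne hj.symm, Derivation.leibniz_pow]

lemma pres_apply (r k : Fin O.p) :
    O.pres r k = (if r = k then X O.z else 0) - O.mulZ r k := by
  simp [pres, Matrix.sub_apply, Matrix.one_apply]

/-- The determinant of the presentation matrix specializes to `T ^ p` at `x = y = 0`, `z = T`. -/
lemma not_dvd_det_pres : ¬ (X O.x : MvPolynomial (Fin 3) ℂ) ∣ O.pres.det := by
  rintro ⟨g, hg⟩
  let ψ : MvPolynomial (Fin 3) ℂ →ₐ[ℂ] Polynomial ℂ :=
    aeval fun j => if j = O.z then Polynomial.X else 0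
  have h1 : ψ O.pres.det = Polynomial.X ^ O.p := by
    have h2 : ψ.mapMatrix O.pres = Matrix.scalar _ (Polynomial.X : Polynomial ℂ) := by
      ext1 r k
      obtain ⟨a, n, h, ha⟩ := O.mulZ_apply_eq r k
      have h3 : ψ (O.mulZ r k) = 0 := by
        rw [h]
        by_cases h0 : a = 0
        · simp [h0]
        · simp [ψ, O.yz, (ha h0).2.2.ne']
      rw [AlgHom.mapMatrix_apply, Matrix.map_apply, pres_apply, map_sub, h3, sub_zero,
        Matrix.scalar_apply, Matrix.diagonal_apply]
      split_ifs <;> simp [ψ]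
    rw [AlgHom.map_det, h2]
    simp
  rw [hg, map_mul] at h1
  have h4 : ψ (X O.x) = 0 := by simp [ψ, O.xz]
  rw [h4, zero_mul] at h1
  exact pow_ne_zero _ Polynomial.X_ne_zero h1.symm

lemma d₁_mulVec' (v : Fin O.p ⊕ Fin O.p → MvPolynomial (Fin 3) ℂ) :
    O.d₁.mulVec v
      = O.pres.mulVec (v ∘ Sum.inl) + (X O.x : MvPolynomial (Fin 3) ℂ) • (v ∘ Sum.inr) := by
  rw [d₁, Matrix.fromCols_mulVec, Matrix.smul_mulVec, Matrix.one_mulVec]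

lemma d₂_mulVec (t : Fin O.p → MvPolynomial (Fin 3) ℂ) :
    O.d₂.mulVec t = Sum.elim (-((X O.x : MvPolynomial (Fin 3) ℂ) • t)) (O.pres.mulVec t) := by
  rw [d₂, Matrix.fromRows_mulVec, Matrix.neg_mulVec, Matrix.smul_mulVec, Matrix.one_mulVec]

lemma d₂_injective : Function.Injective O.d₂.mulVec := by
  intro t t' h
  rw [d₂_mulVec, d₂_mulVec] at h
  ext1 k
  have h1 := congrFun h (Sum.inl k)
  simpa using h1

/-- Exactness in the middle: `d₁` and `d₂` form the Koszul complex of `x` and the presentation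
matrix, and the determinant of the latter is not divisible by `x`. -/
lemma d₁_mulVec_eq_zero_iff (v : Fin O.p ⊕ Fin O.p → MvPolynomial (Fin 3) ℂ) :
    O.d₁.mulVec v = 0 ↔ ∃ t, O.d₂.mulVec t = v := by
  constructor
  · intro h
    rw [d₁_mulVec'] at h
    have hdet := congrArg O.pres.adjugate.mulVec h
    rw [Matrix.mulVec_add, Matrix.mulVec_mulVec, Matrix.adjugate_mul, Matrix.mulVec_zero,
      Matrix.smul_mulVec, Matrix.one_mulVec, Matrix.mulVec_smul] at hdet
    have hdvd : ∀ k, (X O.x : MvPolynomial (Fin 3) ℂ) ∣ v (Sum.inl k) := by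
      intro k
      have h1 := congrFun hdet k
      simp only [Pi.add_apply, Pi.smul_apply, smul_eq_mul, Pi.zero_apply, Function.comp_apply] at h1
      have h2 : (X O.x : MvPolynomial (Fin 3) ℂ) ∣ O.pres.det * v (Sum.inl k) :=
        ⟨-(O.pres.adjugate.mulVec (v ∘ Sum.inr) k), by linear_combination h1⟩
      exact ((X_prime (i := O.x)).dvd_or_dvd h2).resolve_left O.not_dvd_det_pres
    choose s hs using hdvd
    have hv : v ∘ Sum.inl = (X O.x : MvPolynomial (Fin 3) ℂ) • s := by
      ext1 k; simpa using hs k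
    rw [hv, Matrix.mulVec_smul, ← smul_add, smul_eq_zero] at h
    have h3 := h.resolve_left (X_ne_zero _)
    refine ⟨-s, ?_⟩
    rw [d₂_mulVec]
    ext1 (k | k)
    · simp [hs]
    · rw [Sum.elim_inr, Matrix.mulVec_neg, Pi.neg_apply]
      have := congrFun h3 k
      rw [Pi.add_apply, Pi.zero_apply] at this
      exact neg_eq_of_add_eq_zero_right this
  · rintro ⟨t, rfl⟩
    rw [d₂_mulVec, d₁_mulVec', Sum.elim_comp_inl, Sum.elim_comp_inr, Matrix.mulVec_neg,
      Matrix.mulVec_smul, neg_add_cancel]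

lemma eval_zero_d₁ (i : Fin O.p) (j : Fin O.p ⊕ Fin O.p) : eval 0 (O.d₁ i j) = 0 := by
  rcases j with j | j
  · rw [d₁, Matrix.fromCols_apply_inl, pres_apply, map_sub, eval_zero_mulZ]
    split_ifs <;> simp
  · rw [d₁, Matrix.fromCols_apply_inr, Matrix.smul_apply, Matrix.one_apply]
    split_ifs <;> simp

lemma eval_zero_d₂ (i : Fin O.p ⊕ Fin O.p) (j : Fin O.p) : eval 0 (O.d₂ i j) = 0 := by
  rcases i with i | i
  · rw [d₂, Matrix.fromRows_apply_inl, Matrix.neg_apply, Matrix.smul_apply, Matrix.one_apply]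
    split_ifs <;> simp
  · rw [d₂, Matrix.fromRows_apply_inr, pres_apply, map_sub, eval_zero_mulZ]
    split_ifs <;> simp

/-- The linear part of the presentation matrix with respect to `z`, or to `x`. -/
lemma eval_zero_pderiv_pres {j : Fin 3} (hj : j ≠ O.y) (r k : Fin O.p) :
    eval 0 (pderiv j (O.pres r k)) = if r = k ∧ j = O.z then 1 else 0 := by
  rw [pres_apply, map_sub, pderiv_mulZ _ hj, sub_zero]
  by_cases h : r = k
  · by_cases h' : j = O.z
    · subst h'; simp [h]
    · simp [h, h', pderiv_X_of_ne (Ne.symm h')]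
  · simp [h]

/-- Entries of a factorization of a polynomial without linear terms vanish at the origin, if the
linear terms of the other factor are independent. -/
lemma eval_zero_eq_zero_of_mul_d₂ {f : MvPolynomial (Fin 3) ℂ} {κ : Type}
    (hf : ∀ j, eval 0 (pderiv j f) = 0) {h : Matrix κ (Fin O.p ⊕ Fin O.p) (MvPolynomial (Fin 3) ℂ)}
    {B : Matrix κ (Fin O.p) ℂ} (hh : h * O.d₂ = f • B.map C) (i : κ) (j : Fin O.p ⊕ Fin O.p) :
    eval 0 (h i j) = 0 := by
  have key : ∀ (l : Fin 3) (i : κ) (k : Fin O.p),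
      ∑ m, eval 0 (h i m) * eval 0 (pderiv l (O.d₂ m k)) = 0 := by
    intro l i k
    have h1 := congrArg (fun g => eval 0 (pderiv l g)) (congrFun (congrFun hh i) k)
    simp only [Matrix.mul_apply, map_sum, Derivation.leibniz, smul_eq_mul, map_add, map_mul,
      eval_zero_d₂, zero_mul, add_zero, Matrix.smul_apply, Matrix.map_apply, pderiv_C, mul_zero,
      zero_add, hf] at h1
    exact h1
  rcases j with j | j
  · have := key O.x i j
    simp only [Fintype.sum_sum_type, d₂, Matrix.fromRows_apply_inl, Matrix.fromRows_apply_inr,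
      eval_zero_pderiv_pres O O.xy, O.xz, and_false, if_false, mul_zero, Finset.sum_const_zero,
      add_zero] at this
    rw [Finset.sum_eq_single j] at this
    · simpa [Matrix.one_apply] using this
    · intro b _ hb
      simp [hb]
    · simp
  · have := key O.z i j
    simp only [Fintype.sum_sum_type, d₂, Matrix.fromRows_apply_inl, Matrix.fromRows_apply_inr,
      eval_zero_pderiv_pres O O.yz.symm, and_true, mul_ite, mul_one, mul_zero,
      Finset.sum_ite_eq', Finset.mem_univ, if_true] at this
    rw [Finset.sum_eq_zero, zero_add] at this
    · exact this
    · intro b _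
      by_cases hb : b = j <;> simp [hb, pderiv_X_of_ne O.xz]

lemma eval_zero_eq_zero_of_d₁_mul {f : MvPolynomial (Fin 3) ℂ} {κ : Type}
    (hf : ∀ j, eval 0 (pderiv j f) = 0) {h : Matrix (Fin O.p ⊕ Fin O.p) κ (MvPolynomial (Fin 3) ℂ)}
    {B : Matrix (Fin O.p) κ ℂ} (hh : O.d₁ * h = f • B.map C) (j : Fin O.p ⊕ Fin O.p) (i : κ) :
    eval 0 (h j i) = 0 := by
  have key : ∀ (l : Fin 3) (i : κ) (k : Fin O.p),
      ∑ m, eval 0 (h m i) * eval 0 (pderiv l (O.d₁ k m)) = 0 := by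
    intro l i k
    have h1 := congrArg (fun g => eval 0 (pderiv l g)) (congrFun (congrFun hh k) i)
    simp only [Matrix.mul_apply, map_sum, Derivation.leibniz, smul_eq_mul, map_add, map_mul,
      eval_zero_d₁, zero_mul, zero_add, Matrix.smul_apply, Matrix.map_apply, pderiv_C, mul_zero,
      hf] at h1
    exact h1
  rcases j with j | j
  · have := key O.z i j
    simp only [Fintype.sum_sum_type, d₁, Matrix.fromCols_apply_inl, Matrix.fromCols_apply_inr,
      eval_zero_pderiv_pres O O.yz.symm, and_true, mul_ite, mul_one, mul_zero,
      Finset.sum_ite_eq, Finset.mem_univ, if_true] at this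
    rw [add_eq_left.mpr] at this
    · exact this
    · refine Finset.sum_eq_zero fun b _ => ?_
      by_cases hb : j = b <;> simp [hb, pderiv_X_of_ne O.xz]
  · have := key O.x i j
    simp only [Fintype.sum_sum_type, d₁, Matrix.fromCols_apply_inl, Matrix.fromCols_apply_inr,
      eval_zero_pderiv_pres O O.xy, O.xz, and_false, if_false, mul_zero, Finset.sum_const_zero,
      zero_add] at this
    rw [Finset.sum_eq_single j] at this
    · simpa [Matrix.one_apply] using this
    · intro b _ hb
      simp [hb.symm]
    · simp

/-- The stabilization of `ℂ[T]` obtained from the resolution by `d₁` and `d₂` is reduced, because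
`f` has no linear terms. -/
lemma exists_reduced_stabilization (hL : Nonempty (D.L ≃+ ℤ)) (hε : D.epsilon = -1)
    (h : eval c D.poly = 0) :
    ∃ W : GradedMF D (Fin O.p ⊕ Fin O.p) (Fin O.p ⊕ Fin O.p),
      Resolves c (fun k : Fin O.p => Polynomial.X ^ (k : ℕ)) W ∧
      W.q1.toRows₁ = O.d₁ ∧ W.q0.toCols₂ = O.d₂ ∧
      (∀ i j, eval 0 (W.q0 i j) = 0) ∧ (∀ i j, eval 0 (W.q1 i j) = 0) ∧
      (∀ k, D.deg (W.a (Sum.inl k)) = -(isotropyOrder D c * (k : ℕ))) ∧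
      (∀ k, W.a (Sum.inr k) = W.a (Sum.inl k) - D.xvec O.z - D.xvec O.x + D.fvec) ∧
      (∀ k, W.b (Sum.inl k) = W.a (Sum.inl k) - D.xvec O.z + D.fvec) ∧
      ∀ k, W.b (Sum.inr k) = W.a (Sum.inl k) - D.xvec O.x + D.fvec := by
  have hc : c ≠ 0 := fun h0 => O.cy (by simp [h0])
  choose a0 ha0 using fun k : Fin O.p =>
    (Deformation.deg_bijective hL).2 (-(isotropyOrder D c * (k : ℕ) : ℤ))
  have gX : ∀ j, D.IsHomog (X j) (D.xvec j) := fun j => isWeightedHomogeneous_X _ _ _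
  have gsmul : ∀ (j : Fin 3) (r k : Fin O.p),
      D.IsHomog (((X j : MvPolynomial (Fin 3) ℂ) • (1 : Matrix (Fin O.p) (Fin O.p) _)) r k)
        (a0 r - (a0 k - D.xvec j)) := by
    intro j r k
    rw [Matrix.smul_apply, Matrix.one_apply]
    split_ifs with hrk
    · subst hrk; rw [sub_sub_cancel, smul_eq_mul, mul_one]; exact gX j
    · rw [smul_zero]; exact .zero _
  have gpres : ∀ r k, D.IsHomog (O.pres r k) (a0 r - (a0 k - D.xvec O.z)) := by
    intro r k
    refine (gsmul _ r k).sub ?_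
    obtain ⟨a, n, hN, ha⟩ := O.mulZ_apply_eq r k
    rw [hN]
    by_cases h0 : a = 0
    · rw [h0, C_0, zero_mul]; exact .zero _
    · obtain ⟨hz, h1, -⟩ := ha h0
      have h2 : a0 r - (a0 k - D.xvec O.z) = 0 + n • D.xvec O.y := by
        apply (Deformation.deg_bijective hL).1
        rw [map_sub, map_sub, ha0, ha0, map_add, map_zero, map_nsmul, Deformation.deg_xvec,
          Deformation.deg_xvec, ← O.isotropy_mul_p, ← O.isotropy_mul_q hz]
        have h3 : ((k : ℕ) : ℤ) + O.q = O.p * n + (r : ℕ) := by exact_mod_cast h1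
        push_cast
        rw [nsmul_eq_mul]
        linear_combination (isotropyOrder D c : ℤ) * h3
      rw [h2]
      exact (isWeightedHomogeneous_C _ _).mul ((gX O.y).pow n)
  obtain ⟨W, hW, h1, h2, h3, h4⟩ := exists_resolves (κ₁ := Fin O.p ⊕ Fin O.p) (κ₂ := Fin O.p)
    (u := fun k : Fin O.p => Polynomial.X ^ (k : ℕ)) hL hc h
    (a0 := a0) (b1 := Sum.elim (fun k => a0 k - D.xvec O.z) (fun k => a0 k - D.xvec O.x))
    (a2 := fun k => a0 k - D.xvec O.z - D.xvec O.x) (d1 := O.d₁) (d2 := O.d₂)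
    (by
      rintro i (j | j)
      · exact gpres i j
      · exact gsmul O.x i j)
    (by
      rintro (i | i) j
      · refine Deformation.IsHomog.neg ?_
        rw [Sum.elim_inl, sub_right_comm (a0 j), sub_sub_sub_cancel_right]
        exact gsmul O.x i j
      · rw [Sum.elim_inr, sub_sub_sub_cancel_right]
        exact gpres i j)
    (by
      intro k e he
      rw [Polynomial.mem_support_iff, Polynomial.coeff_X_pow] at he
      have : e = k := by by_contra hne; simp [hne] at he
      rw [ha0, neg_neg, this])
    O.augment_surjective O.augment_eq_zero_iff O.d₁_mulVec_eq_zero_iff O.d₂_injective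
  obtain ⟨b1, -, -, b4, -⟩ := block_identities W
  rw [h1] at b1
  rw [h2] at b4
  have r0 := O.eval_zero_eq_zero_of_d₁_mul (B := 1) (eval_zero_pderiv_poly hε)
    (by rw [b1]; congr 1; ext1 i j; simp [Matrix.one_apply, apply_ite C])
  have r1 := O.eval_zero_eq_zero_of_mul_d₂ (B := 1) (eval_zero_pderiv_poly hε)
    (by rw [b4]; congr 1; ext1 i j; simp [Matrix.one_apply, apply_ite C])
  refine ⟨W, hW, h1, h2, ?_, ?_, ?_, ?_, ?_, ?_⟩
  · rintro i (j | j)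
    · exact r0 i j
    · have := O.eval_zero_d₂ i j
      rwa [← h2] at this
  · rintro (i | i) j
    · have := O.eval_zero_d₁ i j
      rwa [← h1] at this
    · exact r1 i j
  · intro k; rw [h3]; exact ha0 k
  · intro k; rw [h3]; rfl
  · intro k; rw [h3, h4]; rfl
  · intro k; rw [h3, h4]; rfl

end OrbitCoordinates

/-- At the origin, a reduced matrix factorization is a retract of every factorization isomorphic to
it; so it has minimal size. -/
lemma exists_retraction_of_reduced {n : ℕ} {D : Deformation n} {ι₀ ι₁ κ₀ κ₁ : Type} [Fintype ι₀]
    [Fintype ι₁] [Fintype κ₀] [Fintype κ₁] [DecidableEq ι₀] [DecidableEq ι₁] [DecidableEq κ₀]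
    [DecidableEq κ₁] {P : GradedMF D ι₀ ι₁} {Q : GradedMF D κ₀ κ₁} (h : P.Iso Q)
    (h0 : ∀ i j, eval 0 (P.q0 i j) = 0) (h1 : ∀ i j, eval 0 (P.q1 i j) = 0) :
    ∃ (φ : GradedMF.Hom P Q) (ψ : GradedMF.Hom Q P),
      ψ.m0.map (eval 0) * φ.m0.map (eval 0) = 1 := by
  obtain ⟨φ, ψ, ⟨s0, s1, -, -, e0, -⟩, -⟩ := h
  refine ⟨φ, ψ, ?_⟩
  have h2 := congrArg (fun M => M.map (eval (0 : Fin n → ℂ))) e0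
  have z0 : P.q0.map (eval (0 : Fin n → ℂ)) = 0 := by ext1 i j; exact h0 i j
  have z1 : P.q1.map (eval (0 : Fin n → ℂ)) = 0 := by ext1 i j; exact h1 i j
  simp only [Matrix.map_sub _ (map_sub (eval (0 : Fin n → ℂ))),
    Matrix.map_add _ (map_add (eval (0 : Fin n → ℂ))), Matrix.map_mul, z0, z1, Matrix.zero_mul,
    Matrix.mul_zero, add_zero, Matrix.map_one _ (map_zero (eval (0 : Fin n → ℂ)))
      (map_one (eval (0 : Fin n → ℂ)))] at h2
  exact sub_eq_zero.mp h2

lemma card_le_card_of_mul_eq_one {ι κ : Type} [Fintype ι] [Fintype κ] [DecidableEq ι]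
    {A : Matrix ι κ ℂ} {B : Matrix κ ι ℂ} (h : A * B = 1) : Fintype.card ι ≤ Fintype.card κ := by
  calc Fintype.card ι = (A * B).rank := by rw [h, Matrix.rank_one]
    _ ≤ A.rank := Matrix.rank_mul_le_left A B
    _ ≤ Fintype.card κ := A.rank_le_card_width

/-! ### Koszul matrix factorizations of rank two -/

lemma Deformation.poly_ne_zero {n : ℕ} (D : Deformation n) (hn : 0 < n) : D.poly ≠ 0 := by
  intro h
  have := D.coeff_poly_E ⟨0, hn.trans_le D.le_N⟩
  rw [h, coeff_zero] at this
  exact D.a_ne_zero _ this.symm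

/-- One factor of a matrix factorization determines the other. -/
lemma mul_eq_scalar_unique {ι κ R : Type*} [Fintype ι] [Fintype κ] [DecidableEq ι] [DecidableEq κ]
    [CommRing R] [IsDomain R] {f : R} (hf : f ≠ 0) {A : Matrix ι κ R} {B B' : Matrix κ ι R}
    (hBA : B * A = Matrix.scalar κ f) (hAB : A * B = Matrix.scalar ι f)
    (hAB' : A * B' = Matrix.scalar ι f) : B = B' := by
  have h : B * (A * B) = B * (A * B') := by rw [hAB, hAB']
  rw [← Matrix.mul_assoc, ← Matrix.mul_assoc, hBA] at h
  ext i j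
  have := congrFun (congrFun h i) j
  simpa [hf] using this

/-- A prime and a polynomial not divisible by it, both vanishing at the origin, form a regular
sequence. -/
lemma isRegular_pair {p q : MvPolynomial (Fin 3) ℂ} (hq : Prime q) (hqp : ¬ q ∣ p)
    (hp0 : eval 0 p = 0) (hq0 : eval 0 q = 0) :
    RingTheory.Sequence.IsRegular (MvPolynomial (Fin 3) ℂ) [p, q] := by
  have hp : p ≠ 0 := by rintro rfl; exact hqp (dvd_zero _)
  rw [RingTheory.Sequence.isRegular_iff]
  constructor
  · rw [RingTheory.Sequence.isWeaklyRegular_cons_iff]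
    refine ⟨(IsRegular.of_ne_zero hp).left.isSMulRegular, ?_⟩
    rw [RingTheory.Sequence.isWeaklyRegular_singleton_iff]
    refine (isSMulRegular_quotient_iff_mem_of_smul_mem _ _).mpr fun g hg => ?_
    rw [Submodule.mem_smul_pointwise_iff_exists] at hg ⊢
    obtain ⟨k, -, hk⟩ := hg
    simp only [smul_eq_mul] at hk
    obtain ⟨k', rfl⟩ := (hq.dvd_or_dvd ⟨g, hk⟩).resolve_left hqp
    refine ⟨k', trivial, mul_left_cancel₀ hq.ne_zero ?_⟩
    rw [← hk, smul_eq_mul]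
    ring
  · intro h
    have h1 : (1 : MvPolynomial (Fin 3) ℂ) ∈ Ideal.ofList [p, q] := by
      have : (1 : MvPolynomial (Fin 3) ℂ) ∈
        (⊤ : Submodule (MvPolynomial (Fin 3) ℂ) (MvPolynomial (Fin 3) ℂ)) := trivial
      rw [h] at this
      simpa using this
    have h2 : Ideal.ofList [p, q] ≤ RingHom.ker (eval (0 : Fin 3 → ℂ)) := by
      rw [Ideal.ofList, Ideal.span_le]
      rintro x hx
      simp only [List.mem_cons, List.not_mem_nil, or_false, Set.mem_ofPred_eq] at hx
      rcases hx with rfl | rfl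
      · exact hp0
      · exact hq0
    simpa using h2 h1

namespace OrbitCoordinates
variable {D : Deformation 3} {c : Fin 3 → ℂ} (O : OrbitCoordinates D c)

lemma not_dvd_pres (k : Fin O.p) : ¬ (X O.x : MvPolynomial (Fin 3) ℂ) ∣ O.pres k k := by
  rintro ⟨g, hg⟩
  have := O.eval_zero_pderiv_pres O.yz.symm k k
  rw [hg] at this
  simp [pderiv_X_of_ne O.xz] at this

end OrbitCoordinates

/-- The outermost object of an arm, if of rank two, is a Koszul matrix factorization: the closure
of the orbit is then a smooth curve, defined by two coordinate functions. -/
lemma exists_koszulData_of_stabilization {D : Deformation 3} (hL : Nonempty (D.L ≃+ ℤ))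
    (hε : D.epsilon = -1) {c : Fin 3 → ℂ} (h : eval c D.poly = 0) (O : OrbitCoordinates D c)
    {V : GradedMF D (Fin 2) (Fin 2)} {k₀ k₁ k₂ : ℕ} {W : GradedMF D (Fin k₀ ⊕ Fin k₂) (Fin k₁)}
    (hW : IsStabilization c W) (hV : W.Iso V) :
    O.p = 1 ∧ ∃ K : KoszulData D, K.mf.Iso V ∧
      (∃ k, K.p₁ = O.pres k k) ∧ K.p₂ = X O.x ∧ K.l₁ = D.xvec O.z ∧ K.l₂ = D.xvec O.x ∧
      (∀ i j, eval 0 (K.mf.q0 i j) = 0) ∧ (∀ i j, eval 0 (K.mf.q1 i j) = 0) := by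
  obtain ⟨R, hR, hd1, hd2, r0, r1, ha, ha', hb, hb'⟩ := O.exists_reduced_stabilization hL hε h
  obtain ⟨u, hu⟩ := isStabilization_iff.mp hW
  have hRV : R.Iso V := (iso_of_resolves hL hR hu).trans hV
  have hp : O.p = 1 := by
    obtain ⟨φ, ψ, h1⟩ := exists_retraction_of_reduced hRV r0 r1
    have := card_le_card_of_mul_eq_one h1
    simp only [Fintype.card_sum, Fintype.card_fin] at this
    have := O.p_pos
    omega
  refine ⟨hp, ?_⟩
  have : Subsingleton (Fin O.p) := by rw [hp]; infer_instance
  let k : Fin O.p := ⟨0, O.p_pos⟩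
  have hk : ∀ r : Fin O.p, r = k := fun r => Subsingleton.elim _ _
  let e : Fin 2 ≃ Fin O.p ⊕ Fin O.p :=
    { toFun := ![Sum.inl k, Sum.inr k]
      invFun := Sum.elim (fun _ => 0) (fun _ => 1)
      left_inv := fun i => by fin_cases i <;> rfl
      right_inv := by rintro (r | r) <;> rw [hk r] <;> rfl }
  have e0 : e 0 = Sum.inl k := rfl
  have e1 : e 1 = Sum.inr k := rfl
  have q00 : R.q1 (Sum.inl k) (Sum.inl k) = O.pres k k := congrFun (congrFun hd1 k) (Sum.inl k)
  have q01 : R.q1 (Sum.inl k) (Sum.inr k) = X O.x := by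
    refine (congrFun (congrFun hd1 k) (Sum.inr k)).trans ?_
    simp [OrbitCoordinates.d₁]
  have d0 : R.q0 (Sum.inl k) (Sum.inr k) = -X O.x := by
    refine (congrFun (congrFun hd2 (Sum.inl k)) k).trans ?_
    simp [OrbitCoordinates.d₂]
  have d1 : R.q0 (Sum.inr k) (Sum.inr k) = O.pres k k := congrFun (congrFun hd2 (Sum.inr k)) k
  have ha0 : R.a (Sum.inl k) = 0 := by
    apply (Deformation.deg_bijective hL).1
    rw [ha, map_zero]; simp [k]
  have hsum := congrFun (congrFun R.q1_mul_q0 (Sum.inl k)) (Sum.inl k)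
  rw [Matrix.mul_apply, ← e.sum_comp, Fin.sum_univ_two, e0, e1, q00, q01] at hsum
  simp only [Matrix.scalar_apply, Matrix.diagonal_apply_eq] at hsum
  have gh1 := R.homog0 (Sum.inl k) (Sum.inl k)
  have gh2 := R.homog0 (Sum.inr k) (Sum.inl k)
  have gp := R.homog1 (Sum.inl k) (Sum.inl k)
  rw [hb, ha0] at gh1 gp
  rw [hb', ha0] at gh2
  rw [q00] at gp
  simp only [zero_sub, sub_zero, zero_add, neg_add_eq_sub] at gh1 gh2 gp
  rw [sub_sub_cancel] at gp
  let K : KoszulData D :=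
    { p₁ := O.pres k k
      p₂ := X O.x
      h₁ := R.q0 (Sum.inl k) (Sum.inl k)
      h₂ := R.q0 (Sum.inr k) (Sum.inl k)
      l₁ := D.xvec O.z
      l₂ := D.xvec O.x
      homog_p₁ := gp
      homog_p₂ := isWeightedHomogeneous_X _ _ _
      homog_h₁ := gh1
      homog_h₂ := gh2
      regular := isRegular_pair X_prime (O.not_dvd_pres k) (O.eval_zero_d₁ k (Sum.inl k)) (by simp)
      eq_poly := hsum }
  have hq0 : K.mf.q0 = R.q0.submatrix e e := by
    ext1 i j
    fin_cases i <;> fin_cases j <;> simp [KoszulData.mf, e0, e1, d0, d1, K]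
  have hq1 : K.mf.q1 = R.q1.submatrix e e := by
    apply mul_eq_scalar_unique (D.poly_ne_zero (by norm_num)) K.mf.q1_mul_q0 K.mf.q0_mul_q1
    rw [hq0, Matrix.submatrix_mul_equiv, R.q0_mul_q1]
    ext1 i j
    simp [Matrix.diagonal_apply]
  refine ⟨K, (GradedMF.iso_of_reindex e e ?_ ?_ ?_ ?_).trans hRV, ⟨k, rfl⟩, rfl, rfl, rfl, ?_, ?_⟩
  · intro i
    fin_cases i
    · exact ha0
    · refine (ha' k).trans ?_
      rw [ha0]
      simp only [KoszulData.mf, K, Fin.mk_one, Matrix.cons_val_one, Matrix.cons_val_fin_one]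
      abel
  · intro i
    fin_cases i
    · refine (hb k).trans ?_
      rw [ha0]
      simp only [KoszulData.mf, K, Fin.zero_eta, Matrix.cons_val_zero]
      abel
    · refine (hb' k).trans ?_
      rw [ha0]
      simp only [KoszulData.mf, K, Fin.mk_one, Matrix.cons_val_one, Matrix.cons_val_fin_one]
      abel
  · intro i j; rw [hq0]; rfl
  · intro i j; rw [hq1]; rfl
  · intro i j; rw [hq0]; exact r0 _ _
  · intro i j; rw [hq1]; exact r1 _ _

section NonNegative

variable {n : ℕ} {w : Fin n → ℕ}

lemma eq_zero_of_degree_neg {p : MvPolynomial (Fin n) ℂ} {m : ℤ}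
    (hp : IsWeightedHomogeneous (fun j => (w j : ℤ)) p m) (hm : m < 0) : p = 0 := by
  ext s
  by_contra h
  have h1 := hp h
  rw [Finsupp.weight_apply, Finsupp.sum_fintype _ _ (by simp)] at h1
  have : 0 ≤ ∑ i, s i • (w i : ℤ) := Finset.sum_nonneg fun i _ => by positivity
  omega

lemma eq_C_of_degree_zero {p : MvPolynomial (Fin n) ℂ}
    (hp : IsWeightedHomogeneous (fun j => (w j : ℤ)) p 0) (hw : ∀ j, 0 < w j) :
    p = C (eval 0 p) := by
  ext s
  rw [coeff_C, MvPolynomial.eval_zero]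
  split_ifs with h0
  · rw [← h0]; rfl
  · by_contra h
    have h1 := hp h
    rw [Finsupp.weight_apply, Finsupp.sum_fintype _ _ (by simp)] at h1
    obtain ⟨j, hj⟩ := DFunLike.ne_iff.mp h0
    have h2 := (Finset.sum_eq_zero_iff_of_nonneg fun i _ => by positivity).mp h1 j
      (Finset.mem_univ j)
    have := hw j
    have h3 : s j ≠ 0 := Ne.symm hj
    simp [h3, this.ne'] at h2

end NonNegative

/-- The weight of the additional variable `w` of `F_Q` and the ideal `(p₁, p₂)` are invariants of
the isomorphism class of a reduced Koszul matrix factorization: degree reasons force isomorphisms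
to respect the summand `S` of `F_0 = S ⊕ S(f - p₁ - p₂)`. -/
lemma KoszulData.eq_of_iso {D : Deformation 3} (hL : Nonempty (D.L ≃+ ℤ)) {K K' : KoszulData D}
    (h : K'.mf.Iso K.mf) (h0 : ∀ i j, eval 0 (K'.mf.q0 i j) = 0)
    (h1 : ∀ i j, eval 0 (K'.mf.q1 i j) = 0) (hpos : 0 < D.deg (D.fvec - K'.l₁ - K'.l₂)) :
    D.deg (D.fvec - K.l₁ - K.l₂) = D.deg (D.fvec - K'.l₁ - K'.l₂) ∧
      Ideal.span {K.p₁, K.p₂} = Ideal.span {K'.p₁, K'.p₂} := by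
  obtain ⟨φ, ψ, hψφ⟩ := exists_retraction_of_reduced h h0 h1
  have gφ := fun i j => (Deformation.isHomog_iff hL _ _).mp (φ.homog0 i j)
  have gψ := fun i j => (Deformation.isHomog_iff hL _ _).mp (ψ.homog0 i j)
  have a0 : ∀ K : KoszulData D, K.mf.a 0 = 0 := fun _ => rfl
  have a1 : ∀ K : KoszulData D, K.mf.a 1 = D.fvec - K.l₁ - K.l₂ := fun _ => rfl
  -- an entry of negative degree; its vanishing makes the morphism triangular
  have φ01 : φ.m0 0 1 = 0 := eq_zero_of_degree_neg (gφ 0 1) (by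
    rw [a0, a1, zero_sub, map_neg]; omega)
  have e11 := congrFun (congrFun hψφ 1) 1
  rw [Matrix.mul_apply, Fin.sum_univ_two, Matrix.map_apply, Matrix.map_apply, Matrix.map_apply,
    Matrix.map_apply, φ01, map_zero, mul_zero, zero_add, Matrix.one_apply_eq] at e11
  have hdeg := degree_eq_of_eval_zero_ne_zero (gφ 1 1) (right_ne_zero_of_mul_eq_one e11)
  rw [a1, a1, map_sub, sub_eq_zero] at hdeg
  refine ⟨hdeg, ?_⟩
  have ψ01 : ψ.m0 0 1 = 0 := eq_zero_of_degree_neg (gψ 0 1) (by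
    rw [a0, a1, zero_sub, map_neg]; omega)
  have e00 := congrFun (congrFun hψφ 0) 0
  rw [Matrix.mul_apply, Fin.sum_univ_two, Matrix.map_apply, Matrix.map_apply, Matrix.map_apply,
    Matrix.map_apply, ψ01, map_zero, zero_mul, add_zero, Matrix.one_apply_eq] at e00
  -- the first row of the matrix `q_1` consists of `p₁` and `p₂`
  have key : ∀ {K K' : KoszulData D} (φ : GradedMF.Hom K'.mf K.mf), φ.m0 0 1 = 0 →
      eval 0 (φ.m0 0 0) ≠ 0 → Ideal.span {K'.p₁, K'.p₂} ≤ Ideal.span {K.p₁, K.p₂} := by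
    intro K K' φ hz hne
    have hC : φ.m0 0 0 = C (eval 0 (φ.m0 0 0)) := by
      apply eq_C_of_degree_zero _ D.w_pos
      simpa [a0] using (Deformation.isHomog_iff hL _ _).mp (φ.homog0 0 0)
    have hrow : ∀ j, C (eval 0 (φ.m0 0 0)) * K'.mf.q1 0 j
        = K.p₁ * φ.m1 0 j + K.p₂ * φ.m1 1 j := by
      intro j
      have := congrFun (congrFun φ.comm1 0) j
      rw [Matrix.mul_apply, Matrix.mul_apply, Fin.sum_univ_two, Fin.sum_univ_two, hz, zero_mul,
        add_zero, hC] at this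
      exact this
    have hmem : ∀ j, K'.mf.q1 0 j ∈ Ideal.span {K.p₁, K.p₂} := by
      intro j
      have h2 : K'.mf.q1 0 j = C (eval 0 (φ.m0 0 0))⁻¹ *
          (C (eval 0 (φ.m0 0 0)) * K'.mf.q1 0 j) := by
        rw [← mul_assoc, ← C_mul, inv_mul_cancel₀ hne, C_1, one_mul]
      rw [h2, hrow]
      exact Ideal.mul_mem_left _ _ (Ideal.add_mem _
        (Ideal.mul_mem_right _ _ (Ideal.subset_span (by simp)))
        (Ideal.mul_mem_right _ _ (Ideal.subset_span (by simp))))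
    rw [Ideal.span_le]
    rintro _ (rfl | rfl)
    · exact hmem 0
    · exact hmem 1
  exact le_antisymm (key ψ ψ01 (left_ne_zero_of_mul_eq_one e00))
    (key φ φ01 (right_ne_zero_of_mul_eq_one e00))

/-! ### Orbit spaces of weighted homogeneous cones -/

section OrbitSpace

variable {n m : ℕ}

lemma zpow_finsetSum {ι G : Type*} [CommGroup G] (s : Finset ι) (t : G) (f : ι → ℤ) :
    t ^ ∑ i ∈ s, f i = ∏ i ∈ s, t ^ f i := by
  classical
  induction s using Finset.induction_on with
  | empty => simp
  | insert a s ha h => rw [Finset.sum_insert ha, Finset.prod_insert ha, zpow_add, h]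

lemma eval_act {v : Fin n → ℤ} {p : MvPolynomial (Fin n) ℂ} {e : ℤ}
    (hp : IsWeightedHomogeneous v p e) (t : ℂˣ) (x : Fin n → ℂ) :
    eval (act v t x) p = ((t ^ e : ℂˣ) : ℂ) * eval x p := by
  rw [eval_eq, eval_eq, Finset.mul_sum]
  refine Finset.sum_congr rfl fun s hs => ?_
  have h := hp (mem_support_iff.mp hs)
  rw [Finsupp.weight_apply, Finsupp.sum_fintype _ _ (by simp)] at h
  have h1 : ∏ i ∈ s.support, act v t x i ^ s i
      = ((t ^ e : ℂˣ) : ℂ) * ∏ i ∈ s.support, x i ^ s i := by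
    simp only [act, mul_pow, Finset.prod_mul_distrib]
    congr 1
    rw [← h, Finset.prod_subset (Finset.subset_univ s.support), zpow_finsetSum, Units.coe_prod]
    · refine Finset.prod_congr rfl fun i _ => ?_
      rw [nsmul_eq_mul, mul_comm, zpow_mul, zpow_natCast, Units.val_pow_eq_pow_val]
    · intro i _ hi
      simp [Finsupp.notMem_support_iff.mp hi]
  rw [h1]; ring

lemma act_mul (v : Fin n → ℤ) (s t : ℂˣ) (x : Fin n → ℂ) :
    act v (s * t) x = act v s (act v t x) := by
  funext j; simp [act, mul_zpow, mul_assoc]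

lemma act_one (v : Fin n → ℤ) (x : Fin n → ℂ) : act v 1 x = x := by
  funext j; simp [act]

lemma act_eq_zero_iff (v : Fin n → ℤ) (t : ℂˣ) (x : Fin n → ℂ) (j : Fin n) :
    act v t x j = 0 ↔ x j = 0 := by
  simp only [act, mul_eq_zero, Units.ne_zero, false_or]

lemma act_ne_zero {v : Fin n → ℤ} {t : ℂˣ} {x : Fin n → ℂ} (hx : x ≠ 0) : act v t x ≠ 0 := by
  obtain ⟨j, hj⟩ := Function.ne_iff.mp hx
  exact fun h => hj ((act_eq_zero_iff v t x j).mp (congrFun h j))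

lemma act_mem_puncturedCone {F : Fin m → MvPolynomial (Fin n) ℂ} {v : Fin n → ℤ} {e : Fin m → ℤ}
    (hF : ∀ k, IsWeightedHomogeneous v (F k) (e k)) (t : ℂˣ) {x : Fin n → ℂ}
    (hx : x ∈ puncturedCone F) : act v t x ∈ puncturedCone F :=
  ⟨act_ne_zero hx.1, fun k => by rw [eval_act (hF k), hx.2 k, mul_zero]⟩

lemma continuous_act (v : Fin n → ℤ) (t : ℂˣ) : Continuous (act v t) := by
  unfold act; fun_prop

/-- With positive weights, every orbit meets the unit sphere. -/
lemma exists_norm_act_eq_one {v : Fin n → ℤ} (hv : ∀ j, 0 < v j) {x : Fin n → ℂ} (hx : x ≠ 0) :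
    ∃ t : ℂˣ, ‖act v t x‖ = 1 := by
  obtain ⟨u, rfl⟩ : ∃ u : Fin n → ℕ, v = fun j => (u j : ℤ) :=
    ⟨fun j => (v j).toNat, funext fun j => (Int.toNat_of_nonneg (hv j).le).symm⟩
  have hu : ∀ j, 0 < u j := fun j => by simpa using hv j
  obtain ⟨j, hj⟩ := Function.ne_iff.mp hx
  let g : ℝ → ℝ := fun s => ‖fun j => (s : ℂ) ^ u j * x j‖
  have hg : Continuous g := by fun_prop
  have h0 : g 0 = 0 := by
    simp only [g, norm_eq_zero]
    funext i
    simp [(hu i).ne']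
  have hj' : 0 < ‖x j‖ := norm_pos_iff.mpr hj
  have h1 : 1 ≤ g (max 1 ‖x j‖⁻¹) := by
    calc (1 : ℝ) = ‖x j‖⁻¹ * ‖x j‖ := (inv_mul_cancel₀ hj'.ne').symm
      _ ≤ max 1 ‖x j‖⁻¹ * ‖x j‖ := by gcongr; exact le_max_right _ _
      _ ≤ (max 1 ‖x j‖⁻¹) ^ u j * ‖x j‖ := by
        gcongr; exact le_self_pow₀ (le_max_left _ _) (hu j).ne'
      _ = ‖((max 1 ‖x j‖⁻¹ : ℝ) : ℂ) ^ u j * x j‖ := by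
        rw [norm_mul, norm_pow, Complex.norm_real, Real.norm_of_nonneg (by positivity)]
      _ ≤ g (max 1 ‖x j‖⁻¹) :=
        norm_le_pi_norm (fun i => ((max 1 ‖x j‖⁻¹ : ℝ) : ℂ) ^ u i * x i) j
  obtain ⟨s, -, hs⟩ := intermediate_value_Icc (by positivity : (0 : ℝ) ≤ max 1 ‖x j‖⁻¹)
    hg.continuousOn ⟨h0.le.trans zero_le_one, h1⟩
  have hs0 : (s : ℂ) ≠ 0 := by
    rintro h
    rw [Complex.ofReal_eq_zero] at h
    rw [h, h0] at hs
    exact zero_ne_one hs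
  refine ⟨Units.mk0 (s : ℂ) hs0, ?_⟩
  rw [← hs]
  show ‖_‖ = ‖_‖
  congr 1

variable {F : Fin m → MvPolynomial (Fin n) ℂ} {v : Fin n → ℤ}

/-- Every orbit meets the unit sphere. -/
lemma compactSpace_orbitSpace (hv : ∀ j, 0 < v j)
    (hF : ∀ k, ∃ e : ℤ, IsWeightedHomogeneous v (F k) e) :
    CompactSpace (Quotient (orbitSetoid v F)) := by
  choose e he using hF
  let B : Set (Fin n → ℂ) := Metric.sphere 0 1 ∩ ⋂ k, {x | eval x (F k) = 0}
  have hB : IsCompact B := (isCompact_sphere 0 1).inter_right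
    (isClosed_iInter fun k => isClosed_eq (F k).continuous_eval continuous_const)
  have := isCompact_iff_compactSpace.mp hB
  let g : B → puncturedCone F := fun x => ⟨x.1, by
    constructor
    · rintro h
      have := x.2.1
      rw [h] at this
      simp at this
    · intro k
      exact Set.mem_iInter.mp x.2.2 k⟩
  have hg : Continuous g := by fun_prop
  have hs : Function.Surjective fun x : B => Quotient.mk (orbitSetoid v F) (g x) := by
    intro q
    obtain ⟨x, rfl⟩ := Quotient.exists_rep q
    obtain ⟨t, ht⟩ := exists_norm_act_eq_one hv x.2.1
    refine ⟨⟨act v t x.1, by simpa using ht, Set.mem_iInter.mpr fun k =>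
      (act_mem_puncturedCone he t x.2).2 k⟩, ?_⟩
    exact (Quotient.sound ⟨t, rfl⟩ : Quotient.mk (orbitSetoid v F) x = _).symm
  exact hs.compactSpace (continuous_quotient_mk'.comp hg)

lemma isOpenQuotientMap_orbitSpace (hF : ∀ k, ∃ e : ℤ, IsWeightedHomogeneous v (F k) e) :
    IsOpenQuotientMap (Quotient.mk (orbitSetoid v F)) := by
  choose e he using hF
  refine ⟨Quotient.mk_surjective, continuous_quotient_mk', fun U hU => ?_⟩
  rw [isOpen_coinduced (f := Quotient.mk (orbitSetoid v F))]
  have : Quotient.mk (orbitSetoid v F) ⁻¹' (Quotient.mk (orbitSetoid v F) '' U)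
      = ⋃ t : ℂˣ, (fun x : puncturedCone F =>
        (⟨act v t x.1, act_mem_puncturedCone he t x.2⟩ : puncturedCone F)) ⁻¹' U := by
    ext x
    simp only [Set.mem_preimage, Set.mem_image, Set.mem_iUnion]
    constructor
    · rintro ⟨y, hy, hxy⟩
      obtain ⟨t, ht⟩ := Quotient.exact hxy.symm
      exact ⟨t, by convert hy⟩
    · rintro ⟨t, ht⟩
      exact ⟨_, ht, (Quotient.sound ⟨t, rfl⟩ : Quotient.mk (orbitSetoid v F) x = _).symm⟩
  rw [this]
  exact isOpen_iUnion fun t => hU.preimage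
    (((continuous_act v t).comp continuous_subtype_val).subtype_mk _)

/-- Elements of `ℂ^*` that carry points near `x ≠ 0` to points near `y` are bounded. -/
lemma eventually_norm_le (hv : ∀ j, 0 < v j) {x y : Fin n → ℂ} (hx : x ≠ 0)
    {a b : ℕ → Fin n → ℂ} {t : ℕ → ℂˣ} (ha : Filter.Tendsto a Filter.atTop (nhds x))
    (hb : Filter.Tendsto b Filter.atTop (nhds y)) (hab : ∀ k, act v (t k) (a k) = b k) :
    ∃ M : ℝ, ∀ᶠ k in Filter.atTop, ‖(t k : ℂ)‖ ≤ M := by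
  obtain ⟨j, hj⟩ := Function.ne_iff.mp hx
  have hj' : 0 < ‖x j‖ := norm_pos_iff.mpr hj
  have ha' := ((tendsto_pi_nhds.mp ha j).norm).eventually (lt_mem_nhds (half_lt_self hj'))
  have hb' := ((tendsto_pi_nhds.mp hb j).norm).eventually (gt_mem_nhds (lt_add_one ‖y j‖))
  refine ⟨max 1 ((‖y j‖ + 1) / (‖x j‖ / 2)), ?_⟩
  filter_upwards [ha', hb'] with k hk hk'
  by_contra! hlt
  obtain ⟨h1, h2⟩ := max_lt_iff.mp hlt
  have h3 := congrArg norm (congrFun (hab k) j)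
  obtain ⟨u, hu⟩ : ∃ u : ℕ, v j = u := ⟨(v j).toNat, (Int.toNat_of_nonneg (hv j).le).symm⟩
  have hu0 : u ≠ 0 := by have := hv j; omega
  simp only [act, hu, zpow_natCast, Units.val_pow_eq_pow_val, norm_mul, norm_pow] at h3
  rw [div_lt_iff₀ (by positivity)] at h2
  have h4 : ‖(t k : ℂ)‖ ≤ ‖(t k : ℂ)‖ ^ u := le_self_pow₀ h1.le hu0
  have h5 : ‖(t k : ℂ)‖ * (‖x j‖ / 2) ≤ ‖(t k : ℂ)‖ ^ u * ‖a k j‖ := by gcongr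
  linarith

/-- The orbit relation is closed: the elements of `ℂ^*` relating two convergent sequences, and their
inverses, are bounded, so a subsequence converges in `ℂ^*`. -/
lemma t2Space_orbitSpace (hv : ∀ j, 0 < v j)
    (hF : ∀ k, ∃ e : ℤ, IsWeightedHomogeneous v (F k) e) :
    T2Space (Quotient (orbitSetoid v F)) := by
  have hq := isOpenQuotientMap_orbitSpace hF
  rw [t2Space_iff_of_isOpenQuotientMap hq]
  apply IsSeqClosed.isClosed
  rintro z ⟨x, y⟩ hz hlim
  have hx : Filter.Tendsto (fun k => (z k).1.1) Filter.atTop (nhds x.1) :=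
    (continuous_subtype_val.comp continuous_fst).continuousAt.tendsto.comp hlim
  have hy : Filter.Tendsto (fun k => (z k).2.1) Filter.atTop (nhds y.1) :=
    (continuous_subtype_val.comp continuous_snd).continuousAt.tendsto.comp hlim
  choose t ht using fun k => (Quotient.exact (hz k) : ∃ t : ℂˣ, act v t (z k).1.1 = (z k).2.1)
  obtain ⟨M, hM⟩ := eventually_norm_le hv x.2.1 hx hy ht
  obtain ⟨M', hM'⟩ := eventually_norm_le hv y.2.1 hy hx (t := fun k => (t k)⁻¹) (fun k => by
    rw [← ht, ← act_mul, inv_mul_cancel, act_one])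
  obtain ⟨s, -, φ, hφ, hs⟩ := tendsto_subseq_of_frequently_bounded
    (Metric.isBounded_closedBall (x := (0 : ℂ)) (r := M)) (x := fun k => (t k : ℂ))
    (hM.mono fun k hk => by simpa using hk).frequently
  have hs0 : s ≠ 0 := by
    rintro rfl
    have h1 : ∀ᶠ k in Filter.atTop, 1 ≤ ‖(t (φ k) : ℂ)‖ * M' := by
      filter_upwards [hφ.tendsto_atTop.eventually hM'] with k hk
      have : ‖(t (φ k) : ℂ)‖ * ‖((t (φ k))⁻¹ : ℂˣ).val‖ = 1 := by
        rw [← norm_mul, ← Units.val_mul, mul_inv_cancel]; simp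
      rw [← this]
      gcongr
    have h2 := (hs.norm.mul_const M')
    have := ge_of_tendsto h2 h1
    simp at this
    linarith
  refine Quotient.sound (s := orbitSetoid v F) ⟨Units.mk0 s hs0, ?_⟩
  refine tendsto_nhds_unique ?_ (hy.comp hφ.tendsto_atTop)
  have hx' := hx.comp hφ.tendsto_atTop
  rw [tendsto_pi_nhds] at hx' ⊢
  intro j
  have h3 : ∀ k, ((fun k => (z k).2.1) ∘ φ) k j
      = ((t (φ k) : ℂ)) ^ v j * (z (φ k)).1.1 j := by
    intro k
    simp only [Function.comp_apply]
    rw [← ht]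
    simp [act]
  simp only [h3]
  have h4 : act v (Units.mk0 s hs0) x.1 j = s ^ v j * x.1 j := by simp [act]
  rw [h4]
  exact (hs.zpow₀ (v j) (Or.inl hs0)).mul (hx' j)

end OrbitSpace

/-- Two compact Hausdorff spaces that are quotients of a compact space by the same equivalence
relation are homeomorphic. -/
lemma nonempty_homeomorph_of_common_cover {X Y Z : Type*} [TopologicalSpace X]
    [TopologicalSpace Y] [TopologicalSpace Z] [CompactSpace X] [T2Space Y] [T2Space Z]
    {f : X → Y} {g : X → Z} (hf : Continuous f) (hg : Continuous g)
    (hf' : Function.Surjective f) (hg' : Function.Surjective g)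
    (h : ∀ a b, f a = f b ↔ g a = g b) : Nonempty (Y ≃ₜ Z) := by
  have qf : Topology.IsQuotientMap f := hf.isClosedMap.isQuotientMap hf hf'
  have qg : Topology.IsQuotientMap g := hg.isClosedMap.isQuotientMap hg hg'
  have hk : Setoid.ker f = Setoid.ker g := by ext a b; exact h a b
  have e1 := Topology.IsQuotientMap.homeomorph (f := ⟨f, hf⟩) qf
  have e2 : Quotient (Setoid.ker g) ≃ₜ Z :=
    Topology.IsQuotientMap.homeomorph (f := ⟨g, hg⟩) qg
  rw [← hk] at e2
  exact ⟨e1.symm.trans e2⟩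

/-- A bijection of compact Hausdorff spaces that is a homeomorphism away from one point is a
homeomorphism. -/
lemma nonempty_homeomorph_of_punctured {X Y : Type*} [TopologicalSpace X]
    [TopologicalSpace Y] [CompactSpace X] [T2Space X] [CompactSpace Y] [T2Space Y] (e : X ≃ Y)
    (x₀ : X) (h : ∀ x, x ≠ x₀ → ContinuousAt e x) (h' : ∀ y, y ≠ e x₀ → ContinuousAt e.symm y) :
    Nonempty (X ≃ₜ Y) := by
  have hcont : Continuous e := by
    rw [continuous_iff_continuousAt]
    intro x
    by_cases hx : x = x₀
    · subst hx
      intro V hV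
      obtain ⟨U, hUV, hU, hxU⟩ := mem_nhds_iff.mp hV
      have hc : IsCompact (e.symm '' Uᶜ) := by
        apply hU.isClosed_compl.isCompact.image_of_continuousOn
        intro y hy
        exact (h' y fun h0 => hy (h0 ▸ hxU)).continuousWithinAt
      have hx : x ∉ e.symm '' Uᶜ := by
        rintro ⟨y, hy, hyx⟩
        apply hy
        rw [← hyx] at hxU
        simpa using hxU
      refine Filter.mem_map.mpr <| Filter.mem_of_superset (hc.isClosed.isOpen_compl.mem_nhds hx) ?_
      intro z hz
      apply hUV
      by_contra hzU
      exact hz ⟨e z, hzU, by simp⟩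
    · exact h x hx
  exact ⟨hcont.homeoOfEquivCompactToT2⟩

/-! ### Monomials and the two tori of a normal form -/

/-- The monomial `∏ j, x_j ^ (u j)` in three quantities `x_j`. -/
def mon {R : Type*} [CommMonoid R] (u : Fin 3 → ℕ) (x : Fin 3 → R) : R := ∏ j, x j ^ u j

section Mon

variable {R S : Type*} [CommMonoid R] [CommMonoid S]

lemma map_mon {F : Type*} [FunLike F R S] [MonoidHomClass F R S] (f : F) (u : Fin 3 → ℕ)
    (x : Fin 3 → R) : f (mon u x) = mon u fun j => f (x j) := by
  simp [mon, map_prod, map_pow]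

lemma mon_mul (u : Fin 3 → ℕ) (x y : Fin 3 → R) :
    mon u (fun j => x j * y j) = mon u x * mon u y := by
  simp [mon, mul_pow, Finset.prod_mul_distrib]

lemma mon_add (u v : Fin 3 → ℕ) (x : Fin 3 → R) :
    mon (fun j => u j + v j) x = mon u x * mon v x := by
  simp [mon, pow_add, Finset.prod_mul_distrib]

lemma mon_nsmul (c : ℕ) (u : Fin 3 → ℕ) (x : Fin 3 → R) :
    mon (fun j => c * u j) x = mon u x ^ c := by
  simp only [mon, ← Finset.prod_pow]
  exact Finset.prod_congr rfl fun j _ => by rw [← pow_mul, mul_comm]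

lemma mon_mon (u : Fin 3 → ℕ) (e : Fin 3 → Fin 3 → ℕ) (x : Fin 3 → R) :
    mon u (fun j => mon (e j) x) = mon (fun k => ∑ j, u j * e j k) x := by
  simp only [mon, ← Finset.prod_pow, ← Finset.prod_pow_eq_pow_sum]
  rw [Finset.prod_comm]
  refine Finset.prod_congr rfl fun k _ => Finset.prod_congr rfl fun j _ => ?_
  rw [← pow_mul, mul_comm]

lemma mon_pow (u w : Fin 3 → ℕ) (t : R) : mon u (fun j => t ^ w j) = t ^ ∑ j, u j * w j := by
  simp only [mon, ← Finset.prod_pow_eq_pow_sum]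
  exact Finset.prod_congr rfl fun j _ => by rw [← pow_mul, mul_comm]

end Mon

lemma mon_eq_zero_iff {u : Fin 3 → ℕ} {x : Fin 3 → ℂ} : mon u x = 0 ↔ ∃ k, x k = 0 ∧ u k ≠ 0 := by
  simp [mon, Finset.prod_eq_zero_iff, pow_eq_zero_iff']

lemma eval_mon (u : Fin 3 → ℕ) (x : Fin 3 → ℂ) :
    eval x (mon u (X : Fin 3 → MvPolynomial (Fin 3) ℂ)) = mon u x := by
  rw [map_mon]; simp

/-- A description of a normal form by exponent vectors:
`f₀ = -M ∏ (U - λ_i V) + N` with monomials `M, U, V, N`, and the embedding sends `x_j` to the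
monomial with exponents `e j` in `X₁, X₂` and `X₃ ⋯ X_{m+2}`, in such a way that `U`, `V`, `N`
become `γ X₂ ^ α₂`, `γ X₁ ^ α₁` and `M γ ^ m (X₃ ⋯ X_{m+2}) ^ α₃` for a monomial `γ`. -/
structure Chart (T : NormalForm) where
  M : Fin 3 → ℕ
  U : Fin 3 → ℕ
  V : Fin 3 → ℕ
  N : Fin 3 → ℕ
  γ : Fin 3 → ℕ
  e : Fin 3 → Fin 3 → ℕ
  poly_eq : T.poly = -(mon M X * ∏ i, (mon U X - C (T.lam i) * mon V X)) + mon N X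
  image_eq : ∀ j, T.image j = mon (e j) ![X 0, X 1, ∏ i : Fin T.m, X i.succ.succ]
  U_e : ∀ k, ∑ j, U j * e j k = γ k + ![0, T.alpha₂, 0] k
  V_e : ∀ k, ∑ j, V j * e j k = γ k + ![T.alpha₁, 0, 0] k
  N_e : ∀ k, ∑ j, N j * e j k = ∑ j, M j * e j k + T.m * γ k + ![0, 0, T.alpha₃] k

/-- The affine cone over the weighted projective line, without its vertex. -/
def wplCone (T : NormalForm) : Set (Fin (T.m + 2) → ℂ) :=
  {b | b ≠ 0 ∧ ∀ k, eval b (T.wplEquation k) = 0}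

/-- The values of `X₁, X₂` and `X₃ ⋯ X_{m+2}` at `b`. -/
def triple {R : Type*} [CommMonoid R] {m : ℕ} (b : Fin (m + 2) → R) : Fin 3 → R :=
  ![b 0, b 1, ∏ i : Fin m, b i.succ.succ]

namespace Chart

variable {T : NormalForm} (Γ : Chart T)

/-- The equations of the quasi-torus of diagonal symmetries of the hypersurface `f₀ = 0`. -/
def Rel (τ : Fin 3 → ℂˣ) : Prop :=
  mon Γ.U τ = mon Γ.V τ ∧ mon Γ.N τ = mon Γ.M τ * mon Γ.U τ ^ T.m

/-- The map of cones given by the embedding of `ℂ[x,y,z]/(f₀)` into `R_{A,λ}`. -/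
def toCone (b : Fin (T.m + 2) → ℂ) : Fin 3 → ℂ := fun j => mon (Γ.e j) (triple b)

lemma eval_image (b : Fin (T.m + 2) → ℂ) (j : Fin 3) :
    eval b (T.image j) = Γ.toCone b j := by
  rw [Γ.image_eq, map_mon, toCone]
  congr 1
  funext k
  fin_cases k <;> simp [triple]

lemma eval_poly (x : Fin 3 → ℂ) : eval x T.poly
    = -(mon Γ.M x * ∏ i, (mon Γ.U x - T.lam i * mon Γ.V x)) + mon Γ.N x := by
  simp [Γ.poly_eq, eval_mon, map_prod]

lemma mon_U_e {R : Type*} [CommMonoid R] (β : Fin 3 → R) :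
    mon Γ.U (fun j => mon (Γ.e j) β) = mon Γ.γ β * β 1 ^ T.alpha₂ := by
  rw [mon_mon, funext Γ.U_e, mon_add]
  simp [mon, Fin.prod_univ_three]

lemma mon_V_e {R : Type*} [CommMonoid R] (β : Fin 3 → R) :
    mon Γ.V (fun j => mon (Γ.e j) β) = mon Γ.γ β * β 0 ^ T.alpha₁ := by
  rw [mon_mon, funext Γ.V_e, mon_add]
  simp [mon, Fin.prod_univ_three]

lemma mon_N_e {R : Type*} [CommMonoid R] (β : Fin 3 → R) :
    mon Γ.N (fun j => mon (Γ.e j) β)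
      = mon Γ.M (fun j => mon (Γ.e j) β) * mon Γ.γ β ^ T.m * β 2 ^ T.alpha₃ := by
  rw [mon_mon, funext Γ.N_e, mon_add, mon_add, mon_nsmul, mon_mon]
  simp [mon, Fin.prod_univ_three]

lemma rel_of_pow_eq {σ : Fin 3 → ℂˣ} {s : ℂˣ} (h0 : σ 0 ^ T.alpha₁ = s) (h1 : σ 1 ^ T.alpha₂ = s)
    (h2 : σ 2 ^ T.alpha₃ = s ^ T.m) : Γ.Rel fun j => mon (Γ.e j) σ := by
  unfold Rel
  rw [Γ.mon_U_e, Γ.mon_V_e, Γ.mon_N_e, h0, h1, h2, mul_pow, mul_assoc]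
  exact ⟨rfl, rfl⟩

lemma eval_scale {τ : Fin 3 → ℂˣ} (h : Γ.Rel τ) (x : Fin 3 → ℂ) :
    eval (fun j => (τ j : ℂ) * x j) T.poly = (mon Γ.N τ : ℂˣ) * eval x T.poly := by
  have hc : ∀ u : Fin 3 → ℕ, mon u (fun j => (τ j : ℂ)) = (mon u τ : ℂˣ) := fun u => by
    simpa using (map_mon (Units.coeHom ℂ) u τ).symm
  have : ∏ i, ((mon Γ.U τ : ℂˣ) * mon Γ.U x - T.lam i * ((mon Γ.U τ : ℂˣ) * mon Γ.V x))
      = ((mon Γ.U τ : ℂˣ) : ℂ) ^ T.m * ∏ i, (mon Γ.U x - T.lam i * mon Γ.V x) := by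
    rw [← Fin.prod_const T.m, ← Finset.prod_mul_distrib]
    exact Finset.prod_congr rfl fun i _ => by ring
  rw [Γ.eval_poly, Γ.eval_poly, mon_mul, mon_mul, mon_mul, mon_mul, hc, hc, hc, hc, ← h.1, this,
    h.2]
  push_cast
  ring

end Chart

/-- Diagonal symmetries of the hypersurface of a deformation with maximal grading `ℤ` belong to
the `ℂ^*`-action. -/
lemma Deformation.exists_unit_of_eval_scale {n : ℕ} {D : Deformation n} (hL : Nonempty (D.L ≃+ ℤ))
    (τ : Fin n → ℂˣ) (χ : ℂˣ)
    (h : ∀ x, eval (fun j => (τ j : ℂ) * x j) D.poly = χ * eval x D.poly) :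
    ∃ t : ℂˣ, ∀ j, τ j = t ^ D.w j := by
  refine D.exists_unit_of_monomials_eq hL τ χ fun k => ?_
  have h1 : (aeval fun j => C (τ j : ℂ) * X j) D.poly = C (χ : ℂ) * D.poly := by
    apply MvPolynomial.funext
    intro x
    rw [map_mul, eval_C, ← h, ← coe_aeval_eq_eval, ← coe_aeval_eq_eval]
    simp only [RingHom.coe_coe]
    rw [← AlgHom.comp_apply]
    congr 1
    ext j
    simp
  have h2 : ∀ s (r : ℂ),
      (aeval fun j => C (τ j : ℂ) * (X j : MvPolynomial (Fin n) ℂ)) (monomial s r)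
      = monomial s (r * ∏ j, (τ j : ℂ) ^ s j) := by
    intro s r
    rw [aeval_monomial, Finsupp.prod_fintype _ _ (by simp)]
    simp only [mul_pow, Finset.prod_mul_distrib, ← C_pow, ← map_prod]
    rw [monomial_eq, Finsupp.prod_fintype _ _ (by simp), C_mul, mul_assoc]
    rfl
  have h3 := congrArg (coeff (D.E k)) h1
  rw [coeff_C_mul, D.coeff_poly_E] at h3
  nth_rw 1 [Deformation.poly] at h3
  rw [map_sum, coeff_sum, Finset.sum_eq_single k] at h3
  · rw [h2, coeff_monomial, if_pos rfl, mul_comm] at h3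
    apply Units.ext
    push_cast
    exact mul_right_cancel₀ (D.a_ne_zero k) h3
  · intro l _ hl
    rw [h2, coeff_monomial, if_neg fun h => hl (D.E_injective h)]
  · simp

/-! ### Weights of normal forms -/

lemma eval_pow_weight {D : Deformation 3} {t : ℂ} (x : Fin 3 → ℂ) (ht : t ≠ 0) :
    eval (fun j => t ^ D.w j * x j) D.poly = t ^ D.d * eval x D.poly := by
  have h : IsWeightedHomogeneous (fun j => (D.w j : ℤ)) D.poly (D.d : ℤ) := by
    intro s hs
    have := D.isWeightedHomogeneous_poly hs
    rw [Finsupp.weight_apply, Finsupp.sum_fintype _ _ (by simp)] at this ⊢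
    rw [← this]
    push_cast
    simp
  have := eval_act h (Units.mk0 t ht) x
  have e : act (fun j => (D.w j : ℤ)) (Units.mk0 t ht) x = fun j => t ^ D.w j * x j := by
    funext j; simp [act]
  rw [e] at this
  simpa using this

lemma eq_of_two_pow_eq {a b : ℕ} (h : (2 : ℂ) ^ a = 2 ^ b) : a = b :=
  Nat.pow_right_injective le_rfl (by exact_mod_cast h)

namespace Chart

variable {T : NormalForm} (Γ : Chart T) {D : Deformation 3}

/-- `U` and `V` have the same weight: otherwise `U - λ_i V` could not vanish for the same `i` along
infinitely many points of an orbit. -/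
lemma weight_U_eq_weight_V (hD : D.poly = T.poly) {j : Fin 3} (hN : Γ.N j ≠ 0) (hM : Γ.M j = 0)
    (hU : Γ.U j = 0) (hV : Γ.V j = 0) :
    ∑ k, Γ.U k * D.w k = ∑ k, Γ.V k * D.w k := by
  classical
  let x : Fin 3 → ℂ := fun k => if k = j then 0 else 1
  have h1 : ∀ u : Fin 3 → ℕ, u j = 0 → mon u x = 1 := by
    intro u hu
    refine Finset.prod_eq_one fun k _ => ?_
    by_cases hk : k = j <;> simp [x, hk, hu]
  have h0 : ∀ τ : Fin 3 → ℂ, mon Γ.N (fun k => τ k * x k) = 0 := fun τ =>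
    mon_eq_zero_iff.mpr ⟨j, by simp [x], hN⟩
  have hx : eval x D.poly = 0 := by
    rw [hD, Γ.eval_poly, h1 _ hM, h1 _ hU, h1 _ hV, Finset.prod_eq_zero (i := ⟨0, T.m_pos⟩)]
    · simpa using h0 1
    · simp
    · rw [T.lam_first]; simp
  have key : ∀ n : ℕ, ∃ i : Fin T.m, ((2 : ℂ) ^ n) ^ ∑ k, Γ.U k * D.w k
      = T.lam i * (2 ^ n) ^ ∑ k, Γ.V k * D.w k := by
    intro n
    have h := eval_pow_weight (D := D) (t := 2 ^ n) x (pow_ne_zero _ two_ne_zero)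
    rw [hx, hD, Γ.eval_poly, h0, mon_mul, mon_mul, mon_mul, mon_pow, mon_pow, mon_pow, h1 _ hM,
      h1 _ hU, h1 _ hV] at h
    simp only [mul_one, mul_zero, add_zero, neg_eq_zero, mul_eq_zero, pow_eq_zero_iff',
      OfNat.ofNat_ne_zero, false_and, false_or, Finset.prod_eq_zero_iff, Finset.mem_univ,
      true_and, sub_eq_zero] at h
    exact h
  choose i hi using key
  obtain ⟨n, n', hn, hni⟩ := Finite.exists_ne_map_eq_of_infinite i
  have e1 := hi n
  have e2 := hi n'
  rw [hni] at e1
  have e3 : (2 : ℂ) ^ (n * ∑ k, Γ.U k * D.w k + n' * ∑ k, Γ.V k * D.w k)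
      = 2 ^ (n' * ∑ k, Γ.U k * D.w k + n * ∑ k, Γ.V k * D.w k) := by
    simp only [pow_add, pow_mul]
    rw [e1, e2]; ring
  have e4 := eq_of_two_pow_eq e3
  generalize ∑ k, Γ.U k * D.w k = p at *
  generalize ∑ k, Γ.V k * D.w k = q at *
  zify at *
  have : ((n : ℤ) - n') * (p - q) = 0 := by linarith
  rcases mul_eq_zero.mp this with h | h
  · exact absurd (by linarith) hn
  · linarith

/-- The weight of `N` is read off from the action of `2` on the point `(1, 1, 1)`, where `U = V` and
the product vanishes, because `λ_3 = 1`. -/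
lemma weight_N_eq_degree (hD : D.poly = T.poly)
    (hw : ∑ k, Γ.U k * D.w k = ∑ k, Γ.V k * D.w k) : ∑ k, Γ.N k * D.w k = D.d := by
  have h0 : ∀ c : ℂ, ∏ i, (c - T.lam i * c) = 0 := fun c =>
    Finset.prod_eq_zero (i := ⟨0, T.m_pos⟩) (Finset.mem_univ _) (by rw [T.lam_first]; simp)
  have h := eval_pow_weight (D := D) (t := 2) (fun _ => 1) two_ne_zero
  have h1 : ∀ u : Fin 3 → ℕ, mon u (fun _ => (1 : ℂ)) = 1 := fun u => by simp [mon]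
  rw [hD, Γ.eval_poly, Γ.eval_poly, mon_mul, mon_mul, mon_mul, mon_mul, mon_pow, mon_pow, mon_pow,
    mon_pow] at h
  simp only [h1, hw, mul_one] at h
  rw [h0] at h
  have h2 := h0 1
  simp only [mul_one] at h2
  rw [h2] at h
  apply eq_of_two_pow_eq
  simpa using h

/-- The weight of `M U ^ m` is read off from the action of `2` on a point where only the first
summand of `f₀` contributes. -/
lemma weight_M_add (hD : D.poly = T.poly)
    (hw : ∑ k, Γ.U k * D.w k = ∑ k, Γ.V k * D.w k)
    {x : Fin 3 → ℂ} (hx : mon Γ.N x = 0)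
    (hx' : mon Γ.M x * ∏ i, (mon Γ.U x - T.lam i * mon Γ.V x) ≠ 0) :
    ∑ k, Γ.M k * D.w k + T.m * ∑ k, Γ.U k * D.w k = D.d := by
  have h := eval_pow_weight (D := D) (t := 2) x two_ne_zero
  rw [hD, Γ.eval_poly, Γ.eval_poly, mon_mul, mon_mul, mon_mul, mon_mul, mon_pow, mon_pow, mon_pow,
    hx, ← hw] at h
  simp only [← mul_sub, mul_left_comm (T.lam _), mul_zero, add_zero] at h
  rw [Finset.prod_mul_distrib, Fin.prod_const, mul_neg, neg_inj] at h
  apply eq_of_two_pow_eq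
  rw [pow_add, mul_comm T.m, pow_mul]
  apply mul_right_cancel₀ hx'
  rw [← h]
  ring

/-- If the monomials of `f₀` have equal weights, the `ℂ^*`-action is by diagonal symmetries. -/
lemma rel_of_weights (hw : ∑ k, Γ.U k * D.w k = ∑ k, Γ.V k * D.w k)
    (hw' : ∑ k, Γ.M k * D.w k + T.m * ∑ k, Γ.U k * D.w k = ∑ k, Γ.N k * D.w k) (t : ℂˣ) :
    Γ.Rel fun j => t ^ D.w j := by
  unfold Rel
  rw [mon_pow, mon_pow, mon_pow, mon_pow, hw, ← hw', hw, pow_add, mul_comm T.m, pow_mul]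
  exact ⟨rfl, rfl⟩

lemma exists_unit_of_rel (hD : D.poly = T.poly) (hL : Nonempty (D.L ≃+ ℤ)) {τ : Fin 3 → ℂˣ}
    (h : Γ.Rel τ) : ∃ t : ℂˣ, ∀ j, τ j = t ^ D.w j :=
  D.exists_unit_of_eval_scale hL τ _ fun x => by rw [hD]; exact Γ.eval_scale h x

end Chart

/-! ### The weighted projective line -/

namespace NormalForm

variable (T : NormalForm)

/-- The linear forms `u`, `v`, `v - λ_i u` whose zeros on the projective line are the exceptional
points; `X_i ^ α_i` is the `i`-th form in `u = X_1 ^ α_1`, `v = X_2 ^ α_2`. -/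
def lin (i : Fin (T.m + 2)) (u v : ℂ) : ℂ :=
  Fin.cases u (fun i => Fin.cases v (fun k => v - T.lam k * u) i) i

@[simp] lemma lin_zero (u v : ℂ) : T.lin 0 u v = u := rfl

@[simp] lemma lin_one (u v : ℂ) : T.lin 1 u v = v := rfl

@[simp] lemma lin_succ_succ (k : Fin T.m) (u v : ℂ) :
    T.lin k.succ.succ u v = v - T.lam k * u := rfl

/-- The block `X_1`, `X_2` or `X_3, …, X_{m+2}` to which an index belongs. -/
def block (i : Fin (T.m + 2)) : Fin 3 := Fin.cases 0 (fun i => Fin.cases 1 (fun _ => 2) i) i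

@[simp] lemma block_zero : T.block 0 = 0 := rfl

@[simp] lemma block_one : T.block 1 = 1 := rfl

@[simp] lemma block_succ_succ (k : Fin T.m) : T.block k.succ.succ = 2 := rfl

@[simp] lemma A_zero : T.A 0 = T.alpha₁ := rfl

@[simp] lemma A_one : T.A 1 = T.alpha₂ := rfl

@[simp] lemma A_succ_succ (k : Fin T.m) : T.A k.succ.succ = T.alpha₃ := rfl

lemma forall_index {P : Fin (T.m + 2) → Prop} (h0 : P 0) (h1 : P 1) (h2 : ∀ k : Fin T.m,
    P k.succ.succ) (i : Fin (T.m + 2)) : P i := by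
  induction i using Fin.cases with
  | zero => exact h0
  | succ i =>
    induction i using Fin.cases with
    | zero => exact h1
    | succ i => exact h2 i

lemma A_eq_block (i : Fin (T.m + 2)) : T.A i = ![T.alpha₁, T.alpha₂, T.alpha₃] (T.block i) :=
  T.forall_index (P := fun i => T.A i = ![T.alpha₁, T.alpha₂, T.alpha₃] (T.block i))
    rfl rfl (fun _ => rfl) i

lemma lin_mul (i : Fin (T.m + 2)) (s u v : ℂ) : T.lin i (s * u) (s * v) = s * T.lin i u v := by
  induction i using T.forall_index with
  | h0 => rfl
  | h1 => rfl
  | h2 k => simp only [lin_succ_succ]; ring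

lemma mul_eq_mul_of_lin_eq_zero {i : Fin (T.m + 2)} {u v u' v' : ℂ} (h : T.lin i u v = 0)
    (h' : T.lin i u' v' = 0) : u * v' = u' * v := by
  induction i using T.forall_index with
  | h0 => simp at h h'; simp [h, h']
  | h1 => simp at h h'; simp [h, h']
  | h2 k =>
    simp only [lin_succ_succ] at h h'
    linear_combination u * h' - u' * h

lemma lin_eq_zero_of_mul_eq_mul {i : Fin (T.m + 2)} {u v u' v' : ℂ} (h : T.lin i u v = 0)
    (hc : u * v' = u' * v) (h0 : u ≠ 0 ∨ v ≠ 0) : T.lin i u' v' = 0 := by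
  induction i using T.forall_index with
  | h0 => simp at h; simp_all
  | h1 => simp at h; simp_all
  | h2 k =>
    simp only [lin_succ_succ] at h ⊢
    have hu : u ≠ 0 := by
      rintro rfl
      simp only [mul_zero, sub_zero] at h
      simp_all
    apply mul_left_cancel₀ hu
    linear_combination hc + u' * h

lemma eq_of_lin_eq_zero {i j : Fin (T.m + 2)} {u v : ℂ} (h : T.lin i u v = 0)
    (h' : T.lin j u v = 0) (h0 : u ≠ 0 ∨ v ≠ 0) : i = j := by
  have hl := T.lam_ne_zero
  induction i using T.forall_index with
  | h0 =>
    induction j using T.forall_index with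
    | h0 => rfl
    | h1 => simp_all
    | h2 k => simp_all
  | h1 =>
    induction j using T.forall_index with
    | h0 => simp_all
    | h1 => rfl
    | h2 k => simp_all
  | h2 k =>
    induction j using T.forall_index with
    | h0 => simp_all
    | h1 => simp_all
    | h2 l =>
      simp only [lin_succ_succ] at h h'
      have hu : u ≠ 0 := by
        rintro rfl
        simp only [mul_zero, sub_zero] at h
        simp_all
      have : T.lam k = T.lam l := by
        apply mul_right_cancel₀ hu
        linear_combination h' - h
      rw [T.lam_injective this]

variable {T}

lemma wplEquation_iff {b : Fin (T.m + 2) → ℂ} : (∀ k, eval b (T.wplEquation k) = 0) ↔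
    ∀ i, b i ^ T.A i = T.lin i (b 0 ^ T.alpha₁) (b 1 ^ T.alpha₂) := by
  constructor
  · intro h i
    induction i using T.forall_index with
    | h0 => rfl
    | h1 => rfl
    | h2 k =>
      have := h k
      simp [wplEquation] at this
      simp only [lin_succ_succ, A_succ_succ]
      linear_combination this
  · intro h k
    have := h k.succ.succ
    simp only [lin_succ_succ, A_succ_succ] at this
    simp [wplEquation]
    linear_combination this

lemma triple_eq_zero_iff {b : Fin (T.m + 2) → ℂ} {k : Fin 3} :
    triple b k = 0 ↔ ∃ i, T.block i = k ∧ b i = 0 := by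
  constructor
  · intro h
    fin_cases k
    · exact ⟨0, rfl, h⟩
    · exact ⟨1, rfl, h⟩
    · obtain ⟨i, -, hi⟩ := Finset.prod_eq_zero_iff.mp
        (show ∏ i : Fin T.m, b i.succ.succ = 0 from h)
      exact ⟨i.succ.succ, rfl, hi⟩
  · rintro ⟨i, rfl, hi⟩
    induction i using T.forall_index with
    | h0 => exact hi
    | h1 => exact hi
    | h2 k => exact Finset.prod_eq_zero (Finset.mem_univ k) hi

/-- All Dolgachev numbers are positive. -/
def AlphaPos (T : NormalForm) : Prop := ∀ i, 0 < T.A i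

lemma exists_wpl_point (hA : T.AlphaPos) {u v : ℂ} (h : u ≠ 0 ∨ v ≠ 0) :
    ∃ b ∈ wplCone T, b 0 ^ T.alpha₁ = u ∧ b 1 ^ T.alpha₂ = v := by
  choose b hb using fun i => IsAlgClosed.exists_pow_nat_eq (T.lin i u v) (hA i)
  have h0 : b 0 ^ T.alpha₁ = u := hb 0
  have h1 : b 1 ^ T.alpha₂ = v := hb 1
  refine ⟨b, ⟨?_, wplEquation_iff.mpr fun i => by rw [h0, h1, hb]⟩, h0, h1⟩
  rintro rfl
  rw [Pi.zero_apply] at h0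
  rw [Pi.zero_apply] at h1
  rw [← A_zero, zero_pow (hA 0).ne'] at h0
  rw [← A_one, zero_pow (hA 1).ne'] at h1
  rcases h with h | h
  · exact h h0.symm
  · exact h h1.symm

lemma pow_ne_zero_or {b : Fin (T.m + 2) → ℂ} (hb : b ∈ wplCone T) :
    b 0 ^ T.alpha₁ ≠ 0 ∨ b 1 ^ T.alpha₂ ≠ 0 := by
  by_contra! h
  apply hb.1
  funext i
  have := wplEquation_iff.mp hb.2 i
  rw [h.1, h.2] at this
  have h0 := T.lin_mul i 0 0 0
  simp only [zero_mul] at h0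
  rw [h0] at this
  exact eq_zero_of_pow_eq_zero this

lemma lin_eq_zero_iff (hA : T.AlphaPos) {b : Fin (T.m + 2) → ℂ} (hb : b ∈ wplCone T)
    (i : Fin (T.m + 2)) : T.lin i (b 0 ^ T.alpha₁) (b 1 ^ T.alpha₂) = 0 ↔ b i = 0 := by
  rw [← wplEquation_iff.mp hb.2 i, pow_eq_zero_iff (hA i).ne']

lemma wpl_index_unique (hA : T.AlphaPos) {b : Fin (T.m + 2) → ℂ} (hb : b ∈ wplCone T)
    {i j : Fin (T.m + 2)} (hi : b i = 0) (hj : b j = 0) : i = j :=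
  T.eq_of_lin_eq_zero ((lin_eq_zero_iff hA hb i).mpr hi) ((lin_eq_zero_iff hA hb j).mpr hj)
    (pow_ne_zero_or hb)

lemma triple_index_unique (hA : T.AlphaPos) {b : Fin (T.m + 2) → ℂ} (hb : b ∈ wplCone T)
    {k l : Fin 3} (hk : triple b k = 0) (hl : triple b l = 0) : k = l := by
  obtain ⟨i, rfl, hi⟩ := triple_eq_zero_iff.mp hk
  obtain ⟨j, rfl, hj⟩ := triple_eq_zero_iff.mp hl
  rw [wpl_index_unique hA hb hi hj]

lemma exists_wpl_scale (hA : T.AlphaPos) {b : Fin (T.m + 2) → ℂ} (hb : b ∈ wplCone T) (s : ℂˣ) :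
    ∃ b' ∈ wplCone T, ∀ i, b' i ^ T.A i = s * b i ^ T.A i := by
  choose b' hb' using fun i => IsAlgClosed.exists_pow_nat_eq ((s : ℂ) * b i ^ T.A i) (hA i)
  refine ⟨b', ⟨?_, wplEquation_iff.mpr fun i => ?_⟩, hb'⟩
  · rintro rfl
    apply hb.1
    funext i
    have := hb' i
    rw [Pi.zero_apply, zero_pow (hA i).ne'] at this
    simpa [(hA i).ne'] using this.symm
  · rw [hb', wplEquation_iff.mp hb.2, ← lin_mul]
    congr 1
    · exact (hb' 0).symm
    · exact (hb' 1).symm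

/-- Two points of the cone with the same image on the projective line differ by the quasi-torus
acting on the cone. -/
lemma exists_scale {b b' : Fin (T.m + 2) → ℂ} (hb : b ∈ wplCone T) (hb' : b' ∈ wplCone T)
    (h : b 0 ^ T.alpha₁ * b' 1 ^ T.alpha₂ = b' 0 ^ T.alpha₁ * b 1 ^ T.alpha₂) :
    ∃ s : ℂˣ, ∀ i, b' i ^ T.A i = s * b i ^ T.A i := by
  have h1 := pow_ne_zero_or hb
  have h2 := pow_ne_zero_or hb'
  have key : ∃ s : ℂ, s ≠ 0 ∧ b' 0 ^ T.alpha₁ = s * b 0 ^ T.alpha₁ ∧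
      b' 1 ^ T.alpha₂ = s * b 1 ^ T.alpha₂ := by
    generalize b 0 ^ T.alpha₁ = u at *
    generalize b 1 ^ T.alpha₂ = v at *
    generalize b' 0 ^ T.alpha₁ = u' at *
    generalize b' 1 ^ T.alpha₂ = v' at *
    by_cases hu : u = 0
    · subst hu
      have hv : v ≠ 0 := by simpa using h1
      have hu' : u' = 0 := by simpa [hv] using h.symm
      subst hu'
      have hv' : v' ≠ 0 := by simpa using h2
      exact ⟨v' / v, div_ne_zero hv' hv, by simp, by field_simp⟩
    · have hv' : v' = u' / u * v := by
        field_simp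
        linear_combination h
      refine ⟨u' / u, div_ne_zero ?_ hu, by field_simp, hv'⟩
      rintro rfl
      simp at hv'
      simp_all
  obtain ⟨s, hs, hu, hv⟩ := key
  refine ⟨Units.mk0 s hs, fun i => ?_⟩
  rw [wplEquation_iff.mp hb.2, wplEquation_iff.mp hb'.2, hu, hv, lin_mul, Units.val_mk0]

end NormalForm

/-! ### The unit sphere bundle of the weighted projective line -/

open OnePoint in
/-- The map `[u : v]` to the projective line, as the one-point compactification of `ℂ` with the
coordinate `v / u`. -/
lemma continuous_projective_coordinate {Y : Type*} [TopologicalSpace Y] {u v : Y → ℂ}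
    (hu : Continuous u) (hv : Continuous v) (h : ∀ y, u y ≠ 0 ∨ v y ≠ 0) [DecidablePred (u · = 0)] :
    Continuous fun y => if u y = 0 then (∞ : OnePoint ℂ) else ((v y / u y : ℂ) : OnePoint ℂ) := by
  rw [continuous_iff_continuousAt]
  intro y
  by_cases hy : u y = 0
  · rw [ContinuousAt, if_pos hy]
    intro s hs
    rw [OnePoint.nhds_infty_eq, Filter.mem_sup, Filter.mem_map, Filter.mem_pure,
      Filter.coclosedCompact_eq_cocompact, ← Metric.cobounded_eq_cocompact] at hs
    obtain ⟨R, -, hR⟩ := (Filter.hasBasis_cobounded_norm (E := ℂ)).mem_iff.mp hs.1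
    have hvy : 0 < ‖v y‖ := norm_pos_iff.mpr ((h y).resolve_left fun h => h hy)
    have h1 : ∀ᶠ x in nhds y, |R| * ‖u x‖ < ‖v x‖ := by
      refine (Continuous.tendsto (by fun_prop : Continuous fun x => |R| * ‖u x‖) y).eventually_lt
        (hv.norm.tendsto y) ?_
      simpa [hy] using hvy
    rw [Filter.mem_map]
    filter_upwards [h1] with x hx
    rw [Set.mem_preimage]
    split_ifs with hx0
    · exact hs.2
    · apply hR
      rw [Set.mem_ofPred_eq, norm_div, le_div_iff₀ (norm_pos_iff.mpr hx0)]
      refine le_trans ?_ hx.le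
      gcongr
      exact le_abs_self R
  · have h1 : ∀ᶠ x in nhds y, u x ≠ 0 := hu.continuousAt.eventually_ne hy
    refine ContinuousAt.congr (f := fun x => ((v x / u x : ℂ) : OnePoint ℂ)) ?_ ?_
    · exact OnePoint.continuous_coe.continuousAt.comp (hv.continuousAt.div hu.continuousAt hy)
    · filter_upwards [h1] with x hx
      rw [if_neg hx]

/-- The points of the cone with `max |X_1 ^ α_1| |X_2 ^ α_2| = 1`: a compact set that surjects onto
the projective line. -/
def wplSphere (T : NormalForm) : Set (Fin (T.m + 2) → ℂ) :=
  {b | (∀ k, eval b (T.wplEquation k) = 0) ∧ ‖(b 0 ^ T.alpha₁, b 1 ^ T.alpha₂)‖ = 1}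

lemma wplSphere_subset {T : NormalForm} (hA : T.AlphaPos) : wplSphere T ⊆ wplCone T := by
  rintro b ⟨hb, h⟩
  refine ⟨?_, hb⟩
  rintro rfl
  have h0 := (hA 0).ne'
  have h1 := (hA 1).ne'
  simp only [NormalForm.A_zero, NormalForm.A_one] at h0 h1
  simp [h0, h1] at h

lemma isCompact_wplSphere {T : NormalForm} (hA : T.AlphaPos) : IsCompact (wplSphere T) := by
  refine Metric.isCompact_of_isClosed_isBounded ?_ ?_
  · have : wplSphere T = (⋂ k, {b | eval b (T.wplEquation k) = 0}) ∩
        {b | ‖(b 0 ^ T.alpha₁, b 1 ^ T.alpha₂)‖ = 1} := by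
      ext b; simp [wplSphere]
    rw [this]
    exact (isClosed_iInter fun k => isClosed_eq (T.wplEquation k).continuous_eval
      continuous_const).inter (isClosed_eq (by fun_prop) continuous_const)
  · have hk : ∀ i, ∃ R : ℝ, 0 ≤ R ∧ ∀ b ∈ wplSphere T, ‖b i‖ ≤ R := by
      intro i
      have h : ∃ R : ℝ, 1 ≤ R ∧ ∀ u v : ℂ, ‖u‖ ≤ 1 → ‖v‖ ≤ 1 → ‖T.lin i u v‖ ≤ R := by
        induction i using T.forall_index with
        | h0 => exact ⟨1, le_rfl, fun u v hu _ => hu⟩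
        | h1 => exact ⟨1, le_rfl, fun u v _ hv => hv⟩
        | h2 k =>
          refine ⟨1 + ‖T.lam k‖, by simp, fun u v hu hv => (norm_sub_le _ _).trans ?_⟩
          rw [norm_mul]
          gcongr
          exact mul_le_of_le_one_right (norm_nonneg _) hu
      obtain ⟨R, hR, h⟩ := h
      refine ⟨R, by linarith, fun b hb => ?_⟩
      have h1 : ‖b 0 ^ T.alpha₁‖ ≤ 1 := (norm_fst_le _).trans hb.2.le
      have h2 : ‖b 1 ^ T.alpha₂‖ ≤ 1 := (norm_snd_le (_, _)).trans hb.2.le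
      have h3 := h _ _ h1 h2
      rw [← NormalForm.wplEquation_iff.mp hb.1 i, norm_pow] at h3
      by_contra! hlt
      have : ‖b i‖ ≤ ‖b i‖ ^ T.A i := le_self_pow₀ (by linarith) (hA i).ne'
      linarith
    choose R hR0 hR using hk
    refine Metric.isBounded_closedBall.subset (s := wplSphere T)
      (t := Metric.closedBall 0 (∑ i, R i)) fun b hb => ?_
    rw [mem_closedBall_zero_iff, pi_norm_le_iff_of_nonneg (Finset.sum_nonneg fun i _ => hR0 i)]
    intro i
    exact (hR i b hb).trans (Finset.single_le_sum (f := R) (fun i _ => hR0 i) (Finset.mem_univ i))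

/-- Every point of the cone is moved into `wplSphere T` by the quasi-torus acting on the cone. -/
lemma exists_mem_wplSphere {T : NormalForm} (hA : T.AlphaPos) {b : Fin (T.m + 2) → ℂ}
    (hb : b ∈ wplCone T) :
    ∃ b' ∈ wplSphere T, ∃ s : ℂˣ, ∀ i, b' i ^ T.A i = s * b i ^ T.A i := by
  have h : ‖(b 0 ^ T.alpha₁, b 1 ^ T.alpha₂)‖ ≠ 0 := by
    rw [norm_ne_zero_iff]
    intro h
    rw [Prod.mk_eq_zero] at h
    rcases NormalForm.pow_ne_zero_or hb with h' | h'
    · exact h' h.1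
    · exact h' h.2
  have hs : ((‖(b 0 ^ T.alpha₁, b 1 ^ T.alpha₂)‖⁻¹ : ℝ) : ℂ) ≠ 0 := by
    simpa using h
  obtain ⟨b', hb', hs'⟩ := NormalForm.exists_wpl_scale hA hb (Units.mk0 _ hs)
  refine ⟨b', ⟨hb'.2, ?_⟩, _, hs'⟩
  have h0 := hs' 0
  have h1 := hs' 1
  simp only [NormalForm.A_zero, NormalForm.A_one, Units.val_mk0] at h0 h1
  rw [h0, h1, ← smul_eq_mul, ← smul_eq_mul, ← Prod.smul_mk, norm_smul, Complex.norm_real,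
    Real.norm_of_nonneg (by positivity), inv_mul_cancel₀ h]

/-! ### The orbits of a normal form -/

/-- The hypersurface `f = 0` with the `ℂ^*`-action of weights `w` is smooth outside `0`, its orbit
space is a sphere, and its non-free orbits are `r` orbits with isotropy groups of orders `A i`
(trivial where `A i = 1`); the points satisfying `P i` lie on the `i`-th of them. -/
structure IsOrbifoldSphere (w : Fin 3 → ℕ) (f : MvPolynomial (Fin 3) ℂ) {r : ℕ} (A : Fin r → ℕ)
    (P : Fin r → (Fin 3 → ℂ) → Prop) : Prop where
  smooth : ∀ x ≠ 0, eval x f = 0 → ∃ j, eval x (pderiv j f) ≠ 0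
  sphere : Nonempty
    (Quotient (orbitSetoid (fun j => (w j : ℤ)) fun _ : Fin 1 => f) ≃ₜ OnePoint ℂ)
  orbits : ∃ O : Fin r → puncturedCone (fun _ : Fin 1 => f),
    (∀ i j (t : ℂˣ), act (fun j => (w j : ℤ)) t (O i) = O j → i = j) ∧
    (∀ i, Nat.card {t : ℂˣ // act (fun j => (w j : ℤ)) t (O i) = O i} = A i) ∧
    (∀ x : puncturedCone (fun _ : Fin 1 => f),
      (∀ i (t : ℂˣ), act (fun j => (w j : ℤ)) t (O i) ≠ x) →
      ∀ t : ℂˣ, act (fun j => (w j : ℤ)) t x = x → t = 1) ∧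
    ∀ i c, P i c → ∃ t : ℂˣ, act (fun j => (w j : ℤ)) t (O i) = c

lemma act_natCast {w : Fin 3 → ℕ} (t : ℂˣ) (x : Fin 3 → ℂ) (j : Fin 3) :
    act (fun j => (w j : ℤ)) t x j = ((t ^ w j : ℂˣ) : ℂ) * x j := by
  simp [act]

namespace Chart

variable {T : NormalForm} (Γ : Chart T)

/-- The properties of the exponent vectors of a normal form that make its `ℂ^*`-orbits correspond
to the points of the weighted projective line. -/
structure IsGood : Prop where
  alphaPos : T.AlphaPos
  /-- The diagonal symmetries fixing a point over `{X_k = 0}` form a cyclic group. -/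
  isotropy : ∀ k, ∃ j₀, Γ.e j₀ k = 1 ∧ ∀ τ : Fin 3 → ℂˣ, Γ.Rel τ → (∀ j, Γ.e j k = 0 → τ j = 1) →
    τ j₀ ^ (![T.alpha₁, T.alpha₂, T.alpha₃] k) = 1 ∧ ∀ j, τ j = τ j₀ ^ Γ.e j k
  /-- No point of the cone is mapped to the origin. -/
  exists_zero : ∀ k, ∃ j, Γ.e j k = 0
  /-- Where `γ` vanishes, the vanishing coordinates determine the point of the line. -/
  separates : ∀ k, Γ.γ k ≠ 0 →
    (k = 2 → T.m = 1) ∧ ∀ l, (∀ j, Γ.e j k = 0 ↔ Γ.e j l = 0) → k = l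
  /-- Up to diagonal symmetries, every point of the hypersurface is in the image of the cone. The
  second alternative covers points of a coordinate axis, which is a single orbit. -/
  surjective : ∀ x : Fin 3 → ℂ, x ≠ 0 → eval x T.poly = 0 → ∃ b ∈ wplCone T,
    (∃ τ, Γ.Rel τ ∧ ∀ j, Γ.toCone b j = τ j * x j) ∨
      ∃ j₀, x j₀ ≠ 0 ∧ Γ.toCone b j₀ ≠ 0 ∧ ∀ j ≠ j₀, x j = 0 ∧ Γ.toCone b j = 0
  smooth : ∀ x : Fin 3 → ℂ, x ≠ 0 → eval x T.poly = 0 → ∃ j, eval x (pderiv j T.poly) ≠ 0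

variable {Γ} {D : Deformation 3}

lemma toCone_eq_zero_iff {b : Fin (T.m + 2) → ℂ} {j : Fin 3} :
    Γ.toCone b j = 0 ↔ ∃ k, triple b k = 0 ∧ Γ.e j k ≠ 0 := mon_eq_zero_iff

lemma toCone_eq_zero_iff_of_zero (hA : T.AlphaPos) {b : Fin (T.m + 2) → ℂ} (hb : b ∈ wplCone T)
    {k : Fin 3} (hk : triple b k = 0) {j : Fin 3} : Γ.toCone b j = 0 ↔ Γ.e j k ≠ 0 := by
  rw [toCone_eq_zero_iff]
  constructor
  · rintro ⟨l, hl, h⟩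
    rwa [NormalForm.triple_index_unique hA hb hk hl]
  · exact fun h => ⟨k, hk, h⟩

lemma eval_toCone {b : Fin (T.m + 2) → ℂ} (hb : ∀ k, eval b (T.wplEquation k) = 0) :
    eval (Γ.toCone b) T.poly = 0 := by
  have h1 : (∏ i : Fin T.m, b i.succ.succ) ^ T.alpha₃
      = ∏ i, (b 1 ^ T.alpha₂ - T.lam i * b 0 ^ T.alpha₁) := by
    rw [← Finset.prod_pow]
    exact Finset.prod_congr rfl fun i _ => NormalForm.wplEquation_iff.mp hb i.succ.succ
  have h2 : ∏ i, (mon Γ.γ (triple b) * b 1 ^ T.alpha₂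
        - T.lam i * (mon Γ.γ (triple b) * b 0 ^ T.alpha₁))
      = mon Γ.γ (triple b) ^ T.m * (∏ i : Fin T.m, b i.succ.succ) ^ T.alpha₃ := by
    rw [h1, ← Fin.prod_const T.m, ← Finset.prod_mul_distrib]
    exact Finset.prod_congr rfl fun i _ => by ring
  rw [Γ.eval_poly]
  unfold toCone
  rw [Γ.mon_N_e, Γ.mon_U_e, Γ.mon_V_e]
  have e0 : triple b 0 = b 0 := rfl
  have e1 : triple b 1 = b 1 := rfl
  have e2 : triple b 2 = ∏ i : Fin T.m, b i.succ.succ := rfl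
  rw [e0, e1, e2, h2]
  ring

lemma IsGood.toCone_mem (h : Γ.IsGood) {b : Fin (T.m + 2) → ℂ} (hb : b ∈ wplCone T) :
    Γ.toCone b ≠ 0 ∧ eval (Γ.toCone b) T.poly = 0 := by
  refine ⟨fun h0 => ?_, eval_toCone hb.2⟩
  have h0 := congrFun h0
  obtain ⟨k, hk, -⟩ := toCone_eq_zero_iff.mp (h0 0)
  obtain ⟨j, hj⟩ := h.exists_zero k
  exact (toCone_eq_zero_iff_of_zero h.alphaPos hb hk).mp (h0 j) hj

/-- The quasi-torus of the cone acts through `ℂ^*`. -/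
lemma exists_act_toCone_eq (hD : D.poly = T.poly) (hL : Nonempty (D.L ≃+ ℤ)) (hA : T.AlphaPos)
    {b b' : Fin (T.m + 2) → ℂ} {s : ℂˣ} (h : ∀ i, b' i ^ T.A i = s * b i ^ T.A i) :
    ∃ t : ℂˣ, act (fun j => (D.w j : ℤ)) t (Γ.toCone b) = Γ.toCone b' := by
  have hσ : ∀ i, ∃ σ : ℂˣ, σ ^ T.A i = s ∧ b' i = σ * b i := by
    intro i
    by_cases hi : b i = 0
    · obtain ⟨σ, hσ⟩ := IsAlgClosed.exists_pow_nat_eq (s : ℂ) (hA i)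
      have h0 : σ ≠ 0 := by
        rintro rfl
        rw [zero_pow (hA i).ne'] at hσ
        exact s.ne_zero hσ.symm
      refine ⟨Units.mk0 σ h0, Units.ext (by simpa using hσ), ?_⟩
      have := h i
      rw [hi, zero_pow (hA i).ne', mul_zero] at this
      rw [hi, mul_zero, eq_zero_of_pow_eq_zero this]
    · have h0 : b' i ≠ 0 := by
        intro h0
        have := h i
        rw [h0, zero_pow (hA i).ne'] at this
        simp [hi] at this
      refine ⟨Units.mk0 (b' i / b i) (div_ne_zero h0 hi), Units.ext ?_, ?_⟩
      · rw [Units.val_pow_eq_pow_val, Units.val_mk0, div_pow, h i,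
          mul_div_cancel_right₀ _ (pow_ne_zero _ hi)]
      · rw [Units.val_mk0, div_mul_cancel₀ _ hi]
  choose σ hσ hb' using hσ
  have hrel : Γ.Rel fun j => mon (Γ.e j) (triple σ) := by
    refine Γ.rel_of_pow_eq (s := s) (hσ 0) (hσ 1) ?_
    show (∏ i : Fin T.m, σ i.succ.succ) ^ T.alpha₃ = s ^ T.m
    rw [← Finset.prod_pow, ← Fin.prod_const T.m]
    exact Finset.prod_congr rfl fun i _ => hσ i.succ.succ
  obtain ⟨t, ht⟩ := Γ.exists_unit_of_rel hD hL hrel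
  refine ⟨t, funext fun j => ?_⟩
  rw [act_natCast, ← ht, toCone, toCone]
  have h1 : triple b' = fun k => ((triple σ k : ℂˣ) : ℂ) * triple b k := by
    funext k
    fin_cases k
    · exact hb' 0
    · exact hb' 1
    · simp [triple, hb', Finset.prod_mul_distrib]
  rw [h1, mon_mul]
  congr 1

/-- Points of the cone whose images are in the same orbit have the same image on the projective
line. -/
lemma IsGood.mul_eq_mul (h : Γ.IsGood) (hw : ∀ t : ℂˣ, Γ.Rel fun j => t ^ D.w j)
    {b b' : Fin (T.m + 2) → ℂ} (hb : b ∈ wplCone T) (hb' : b' ∈ wplCone T) {t : ℂˣ}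
    (ht : act (fun j => (D.w j : ℤ)) t (Γ.toCone b) = Γ.toCone b') :
    b 0 ^ T.alpha₁ * b' 1 ^ T.alpha₂ = b' 0 ^ T.alpha₁ * b 1 ^ T.alpha₂ := by
  -- where `γ` vanishes, the vanishing coordinates determine the point
  have key : ∀ {b b' : Fin (T.m + 2) → ℂ}, b ∈ wplCone T → b' ∈ wplCone T →
      (∀ j, Γ.toCone b j = 0 ↔ Γ.toCone b' j = 0) → mon Γ.γ (triple b) = 0 →
      b 0 ^ T.alpha₁ * b' 1 ^ T.alpha₂ = b' 0 ^ T.alpha₁ * b 1 ^ T.alpha₂ := by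
    intro b b' hb hb' hz hγ
    obtain ⟨k, hk, hγk⟩ := mon_eq_zero_iff.mp hγ
    obtain ⟨j₀, hj₀, -⟩ := h.isotropy k
    have h1 : Γ.toCone b j₀ = 0 :=
      (toCone_eq_zero_iff_of_zero h.alphaPos hb hk).mpr (by rw [hj₀]; exact one_ne_zero)
    obtain ⟨l, hl, -⟩ := toCone_eq_zero_iff.mp ((hz j₀).mp h1)
    obtain ⟨hm, hkl⟩ := h.separates k hγk
    obtain rfl := hkl l fun j => not_iff_not.mp
      (((toCone_eq_zero_iff_of_zero h.alphaPos hb hk).symm.trans (hz j)).trans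
        (toCone_eq_zero_iff_of_zero h.alphaPos hb' hl))
    obtain ⟨i, rfl, hi⟩ := NormalForm.triple_eq_zero_iff.mp hk
    obtain ⟨i', hii', hi'⟩ := NormalForm.triple_eq_zero_iff.mp hl
    have : i' = i := by
      induction i using T.forall_index with
      | h0 =>
        induction i' using T.forall_index with
        | h0 => rfl
        | h1 => simp at hii'
        | h2 k => simp at hii'
      | h1 =>
        induction i' using T.forall_index with
        | h0 => simp at hii'
        | h1 => rfl
        | h2 k => simp at hii'
      | h2 k =>
        induction i' using T.forall_index with
        | h0 => simp at hii'
        | h1 => simp at hii'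
        | h2 l =>
          have := hm rfl
          congr 2
          apply Fin.ext
          omega
    subst this
    exact T.mul_eq_mul_of_lin_eq_zero
      ((NormalForm.lin_eq_zero_iff h.alphaPos hb i').mpr hi)
      ((NormalForm.lin_eq_zero_iff h.alphaPos hb' i').mpr hi')
  have hz : ∀ j, Γ.toCone b j = 0 ↔ Γ.toCone b' j = 0 := fun j => by
    rw [← ht, act_eq_zero_iff]
  by_cases hγ : mon Γ.γ (triple b) = 0
  · exact key hb hb' hz hγ
  by_cases hγ' : mon Γ.γ (triple b') = 0
  · exact (key hb' hb (fun j => (hz j).symm) hγ').symm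
  -- elsewhere `[U : V]` is the point of the line, and the action preserves it
  have hact : Γ.toCone b' = fun j => ((t ^ D.w j : ℂˣ) : ℂ) * Γ.toCone b j := by
    funext j
    rw [← ht, act_natCast]
  have hc : ∀ u : Fin 3 → ℕ, mon u (fun j => ((t ^ D.w j : ℂˣ) : ℂ))
      = (mon u (fun j => t ^ D.w j) : ℂˣ) := fun u => by
    simpa using (map_mon (Units.coeHom ℂ) u fun j => t ^ D.w j).symm
  have hU : mon Γ.U (Γ.toCone b') = (mon Γ.U (fun j => t ^ D.w j) : ℂˣ) * mon Γ.U (Γ.toCone b) := by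
    rw [hact, mon_mul, hc]
  have hV : mon Γ.V (Γ.toCone b') = (mon Γ.U (fun j => t ^ D.w j) : ℂˣ) * mon Γ.V (Γ.toCone b) := by
    rw [hact, mon_mul, hc, (hw t).1]
  unfold toCone at hU hV
  rw [Γ.mon_U_e, Γ.mon_U_e] at hU
  rw [Γ.mon_V_e, Γ.mon_V_e] at hV
  generalize ((mon Γ.U fun j => t ^ D.w j : ℂˣ) : ℂ) = χ at *
  change _ * b' 1 ^ T.alpha₂ = χ * (_ * b 1 ^ T.alpha₂) at hU
  change _ * b' 0 ^ T.alpha₁ = χ * (_ * b 0 ^ T.alpha₁) at hV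
  apply mul_left_cancel₀ (mul_ne_zero hγ hγ')
  linear_combination (mon Γ.γ (triple b) * b 0 ^ T.alpha₁) * hU
    - (mon Γ.γ (triple b) * b 1 ^ T.alpha₂) * hV

/-- Every orbit of the hypersurface meets the image of the cone. -/
lemma IsGood.exists_act_eq (h : Γ.IsGood) (hD : D.poly = T.poly) (hL : Nonempty (D.L ≃+ ℤ))
    {x : Fin 3 → ℂ} (hx : x ≠ 0) (hx' : eval x T.poly = 0) :
    ∃ b ∈ wplCone T, ∃ t : ℂˣ, act (fun j => (D.w j : ℤ)) t x = Γ.toCone b := by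
  obtain ⟨b, hb, ⟨τ, hτ, hτx⟩ | ⟨j₀, h1, h2, h3⟩⟩ := h.surjective x hx hx'
  · obtain ⟨t, ht⟩ := Γ.exists_unit_of_rel hD hL hτ
    exact ⟨b, hb, t, funext fun j => by rw [act_natCast, ← ht, hτx]⟩
  · obtain ⟨t, ht⟩ := IsAlgClosed.exists_pow_nat_eq (Γ.toCone b j₀ / x j₀) (D.w_pos j₀)
    have ht0 : t ≠ 0 := by
      rintro rfl
      rw [zero_pow (D.w_pos j₀).ne'] at ht
      exact div_ne_zero h2 h1 ht.symm
    refine ⟨b, hb, Units.mk0 t ht0, funext fun j => ?_⟩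
    rw [act_natCast]
    by_cases hj : j = j₀
    · subst hj
      rw [Units.val_pow_eq_pow_val, Units.val_mk0, ht, div_mul_cancel₀ _ h1]
    · rw [(h3 j hj).1, (h3 j hj).2, mul_zero]

/-- The isotropy groups over `{X_i = 0}`. -/
lemma IsGood.card_isotropy (h : Γ.IsGood) (hD : D.poly = T.poly) (hL : Nonempty (D.L ≃+ ℤ))
    (hw : ∀ t : ℂˣ, Γ.Rel fun j => t ^ D.w j) {b : Fin (T.m + 2) → ℂ} (hb : b ∈ wplCone T)
    {i : Fin (T.m + 2)} (hi : b i = 0) :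
    Nat.card {t : ℂˣ // act (fun j => (D.w j : ℤ)) t (Γ.toCone b) = Γ.toCone b} = T.A i := by
  have hk : triple b (T.block i) = 0 := NormalForm.triple_eq_zero_iff.mpr ⟨i, rfl, hi⟩
  have hz : ∀ j, Γ.toCone b j = 0 ↔ Γ.e j (T.block i) ≠ 0 := fun j =>
    toCone_eq_zero_iff_of_zero h.alphaPos hb hk
  have hfix : ∀ t : ℂˣ, act (fun j => (D.w j : ℤ)) t (Γ.toCone b) = Γ.toCone b ↔
      ∀ j, Γ.e j (T.block i) = 0 → t ^ D.w j = 1 := by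
    intro t
    rw [funext_iff]
    refine forall_congr' fun j => ?_
    rw [act_natCast]
    by_cases hj : Γ.e j (T.block i) = 0
    · have : Γ.toCone b j ≠ 0 := fun h => (hz j).mp h hj
      rw [mul_eq_right₀ this, Units.val_eq_one]
      simp [hj]
    · simp [(hz j).mpr hj, hj]
  obtain ⟨j₀, hj₀, hiso⟩ := h.isotropy (T.block i)
  rw [← T.A_eq_block] at hiso
  have : NeZero (T.A i) := ⟨(h.alphaPos i).ne'⟩
  rw [← Complex.card_rootsOfUnity (T.A i)]
  refine Nat.card_eq_of_bijective
    (fun t => ⟨t.1 ^ D.w j₀, (mem_rootsOfUnity _ _).mpr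
      (hiso _ (hw t.1) ((hfix t.1).mp t.2)).1⟩) ⟨?_, ?_⟩
  · rintro ⟨t, ht⟩ ⟨s, hs⟩ hts
    rw [Subtype.mk.injEq] at hts
    have h1 := (hiso _ (hw t) ((hfix t).mp ht)).2
    have h2 := (hiso _ (hw s) ((hfix s).mp hs)).2
    have h3 : ∀ j, (t * s⁻¹) ^ D.w j = 1 := by
      intro j
      have e1 : t ^ D.w j = s ^ D.w j := (h1 j).trans ((congrArg (· ^ _) hts).trans (h2 j).symm)
      rw [mul_pow, inv_pow, e1, mul_inv_cancel]
    exact Subtype.ext (mul_inv_eq_one.mp (D.unit_eq_one (by norm_num) _ h3))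
  · rintro ⟨s, hs⟩
    rw [mem_rootsOfUnity] at hs
    have hrel : Γ.Rel fun j => mon (Γ.e j) (Pi.mulSingle (T.block i) s) := by
      have h1 : ∀ k, (Pi.mulSingle (T.block i) s : Fin 3 → ℂˣ) k
          ^ (![T.alpha₁, T.alpha₂, T.alpha₃] k) = 1 := by
        intro k
        by_cases hk : k = T.block i
        · subst hk
          rw [Pi.mulSingle_eq_same, ← T.A_eq_block, hs]
        · rw [Pi.mulSingle_eq_of_ne hk, one_pow]
      exact Γ.rel_of_pow_eq (h1 0) (h1 1) ((h1 2).trans (one_pow _).symm)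
    have hmon : ∀ j, mon (Γ.e j) (Pi.mulSingle (T.block i) s) = s ^ Γ.e j (T.block i) := by
      intro j
      rw [mon, Finset.prod_eq_single (T.block i)]
      · rw [Pi.mulSingle_eq_same]
      · intro k _ hk
        rw [Pi.mulSingle_eq_of_ne hk, one_pow]
      · simp
    obtain ⟨t, ht⟩ := Γ.exists_unit_of_rel hD hL hrel
    refine ⟨⟨t, (hfix t).mpr fun j hj => ?_⟩, Subtype.ext ?_⟩
    · rw [← ht, hmon, hj, pow_zero]
    · show t ^ D.w j₀ = s
      rw [← ht, hmon, hj₀, pow_one]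

/-- The orbits of a normal form correspond to the points of the weighted projective line. -/
lemma IsGood.isOrbifoldSphere (h : Γ.IsGood) (hD : D.poly = T.poly) (hL : Nonempty (D.L ≃+ ℤ))
    (hw : ∀ t : ℂˣ, Γ.Rel fun j => t ^ D.w j) :
    IsOrbifoldSphere D.w D.poly T.A fun i c =>
      ∃ b : Fin (T.m + 2) → ℂ, b ≠ 0 ∧ (∀ k, eval b (T.wplEquation k) = 0) ∧ b i = 0 ∧
        ∀ j, c j = eval b (T.image j) := by
  classical
  have hA := h.alphaPos
  have hsame : ∀ {b b' : Fin (T.m + 2) → ℂ}, b ∈ wplCone T → b' ∈ wplCone T →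
      b 0 ^ T.alpha₁ * b' 1 ^ T.alpha₂ = b' 0 ^ T.alpha₁ * b 1 ^ T.alpha₂ →
      ∃ t : ℂˣ, act (fun j => (D.w j : ℤ)) t (Γ.toCone b) = Γ.toCone b' := by
    intro b b' hb hb' hc
    obtain ⟨s, hs⟩ := NormalForm.exists_scale hb hb' hc
    exact exists_act_toCone_eq hD hL hA hs
  have hlin : ∀ {b b' : Fin (T.m + 2) → ℂ}, b ∈ wplCone T → b' ∈ wplCone T → ∀ {i}, b i = 0 →
      b' i = 0 → b 0 ^ T.alpha₁ * b' 1 ^ T.alpha₂ = b' 0 ^ T.alpha₁ * b 1 ^ T.alpha₂ := by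
    intro b b' hb hb' i hi hi'
    exact T.mul_eq_mul_of_lin_eq_zero ((NormalForm.lin_eq_zero_iff hA hb i).mpr hi)
      ((NormalForm.lin_eq_zero_iff hA hb' i).mpr hi')
  have hmem : ∀ {b : Fin (T.m + 2) → ℂ}, b ∈ wplCone T →
      Γ.toCone b ∈ puncturedCone (fun _ : Fin 1 => D.poly) := fun hb =>
    ⟨(h.toCone_mem hb).1, fun _ => by rw [hD]; exact (h.toCone_mem hb).2⟩
  have hhom : ∀ k : Fin 1, ∃ e : ℤ,
      IsWeightedHomogeneous (fun j => (D.w j : ℤ)) ((fun _ => D.poly) k) e := by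
    intro _
    refine ⟨D.deg D.fvec, (D.isHomog_iff hL _ _).mp D.isHomog_poly⟩
  have hv : ∀ j, (0 : ℤ) < D.w j := fun j => by exact_mod_cast D.w_pos j
  have hpt : ∀ i : Fin (T.m + 2), ∃ b ∈ wplCone T, b i = 0 := by
    intro i
    obtain ⟨u, v, huv, h0⟩ : ∃ u v : ℂ, (u ≠ 0 ∨ v ≠ 0) ∧ T.lin i u v = 0 := by
      induction i using T.forall_index with
      | h0 => exact ⟨0, 1, by simp, rfl⟩
      | h1 => exact ⟨1, 0, by simp, rfl⟩
      | h2 k => exact ⟨1, T.lam k, by simp, by simp⟩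
    obtain ⟨b, hb, hu, hv⟩ := NormalForm.exists_wpl_point hA huv
    exact ⟨b, hb, (NormalForm.lin_eq_zero_iff hA hb i).mp (by rw [hu, hv, h0])⟩
  choose p hp hp0 using hpt
  refine ⟨fun x hx hx' => ?_, ?_, fun i => ⟨_, hmem (hp i)⟩, ?_, ?_, ?_, ?_⟩
  · rw [hD] at hx' ⊢
    exact h.smooth x hx hx'
  · -- both spaces are quotients of the compact `wplSphere T`
    have := isCompact_iff_compactSpace.mp (isCompact_wplSphere hA)
    have := t2Space_orbitSpace hv hhom
    have hsub := wplSphere_subset hA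
    let g : wplSphere T → Quotient (orbitSetoid (fun j => (D.w j : ℤ)) fun _ : Fin 1 => D.poly) :=
      fun b => Quotient.mk _ ⟨Γ.toCone b.1, hmem (hsub b.2)⟩
    let f : wplSphere T → OnePoint ℂ := fun b => if b.1 0 ^ T.alpha₁ = 0 then OnePoint.infty
      else ((b.1 1 ^ T.alpha₂ / b.1 0 ^ T.alpha₁ : ℂ) : OnePoint ℂ)
    have hg : Continuous g := by
      refine continuous_quotient_mk'.comp (Continuous.subtype_mk (continuous_pi fun j => ?_) _)
      simp only [← Γ.eval_image]
      exact (T.image j).continuous_eval.comp continuous_subtype_val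
    have hf : Continuous f := continuous_projective_coordinate
      (u := fun b : wplSphere T => b.1 0 ^ T.alpha₁) (v := fun b : wplSphere T => b.1 1 ^ T.alpha₂)
      (((continuous_apply 0).comp continuous_subtype_val).pow _)
      (((continuous_apply 1).comp continuous_subtype_val).pow _)
      fun b => NormalForm.pow_ne_zero_or (hsub b.2)
    refine nonempty_homeomorph_of_common_cover hg hf ?_ ?_ ?_
    · intro q
      obtain ⟨x, rfl⟩ := Quotient.exists_rep q
      obtain ⟨b, hb, t, ht⟩ := h.exists_act_eq hD hL x.2.1 (by rw [← hD]; exact x.2.2 0)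
      obtain ⟨b', hb', s, hs⟩ := exists_mem_wplSphere hA hb
      obtain ⟨t', ht'⟩ := exists_act_toCone_eq (Γ := Γ) hD hL hA hs
      exact ⟨⟨b', hb'⟩, (Quotient.sound (s := orbitSetoid _ _)
        ⟨t' * t, by rw [act_mul, ht, ht']⟩ : Quotient.mk (orbitSetoid _ _) x = _).symm⟩
    · intro q
      obtain ⟨u, v, huv, hq⟩ : ∃ u v : ℂ, (u ≠ 0 ∨ v ≠ 0) ∧
          (if u = 0 then OnePoint.infty else ((v / u : ℂ) : OnePoint ℂ)) = q := by
        induction q using OnePoint.rec with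
        | infty => exact ⟨0, 1, by simp, by simp⟩
        | coe z => exact ⟨1, z, by simp, by simp⟩
      obtain ⟨b, hb, hu, hv⟩ := NormalForm.exists_wpl_point hA huv
      obtain ⟨b', hb', s, hs⟩ := exists_mem_wplSphere hA hb
      refine ⟨⟨b', hb'⟩, ?_⟩
      have h0 : b' 0 ^ T.alpha₁ = s * u := hu ▸ hs 0
      have h1 : b' 1 ^ T.alpha₂ = s * v := hv ▸ hs 1
      simp only [f, h0, h1, mul_eq_zero, Units.ne_zero, false_or,
        mul_div_mul_left _ _ s.ne_zero, hq]
    · rintro ⟨b, hb⟩ ⟨b', hb'⟩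
      have e1 : g ⟨b, hb⟩ = g ⟨b', hb'⟩ ↔
          b 0 ^ T.alpha₁ * b' 1 ^ T.alpha₂ = b' 0 ^ T.alpha₁ * b 1 ^ T.alpha₂ := by
        constructor
        · intro hgb
          obtain ⟨t, ht⟩ := Quotient.exact hgb
          exact h.mul_eq_mul hw (hsub hb) (hsub hb') ht
        · intro hc
          obtain ⟨t, ht⟩ := hsame (hsub hb) (hsub hb') hc
          exact Quotient.sound ⟨t, ht⟩
      rw [e1]
      have h1 := NormalForm.pow_ne_zero_or (hsub hb)
      have h2 := NormalForm.pow_ne_zero_or (hsub hb')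
      simp only [f]
      generalize b 0 ^ T.alpha₁ = u at *
      generalize b 1 ^ T.alpha₂ = v at *
      generalize b' 0 ^ T.alpha₁ = u' at *
      generalize b' 1 ^ T.alpha₂ = v' at *
      by_cases hu : u = 0
      · by_cases hu' : u' = 0
        · simp [hu, hu']
        · simp_all
      · by_cases hu' : u' = 0
        · simp_all
        · simp only [hu, hu', if_false, OnePoint.coe_eq_coe]
          rw [div_eq_div_iff hu hu']
          constructor <;> intro h <;> linear_combination -h
  · intro i j t ht
    have hc := h.mul_eq_mul hw (hp i) (hp j) ht
    have := T.lin_eq_zero_of_mul_eq_mul ((NormalForm.lin_eq_zero_iff hA (hp i) i).mpr (hp0 i)) hc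
      (NormalForm.pow_ne_zero_or (hp i))
    exact NormalForm.wpl_index_unique hA (hp j) ((NormalForm.lin_eq_zero_iff hA (hp j) i).mp this)
      (hp0 j)
  · intro i
    exact h.card_isotropy hD hL hw (hp i) (hp0 i)
  · intro x hx s hs
    obtain ⟨b, hb, t, ht⟩ := h.exists_act_eq hD hL x.2.1 (by rw [← hD]; exact x.2.2 0)
    have hb0 : ∀ i, b i ≠ 0 := by
      intro i hi
      obtain ⟨t', ht'⟩ := hsame (hp i) hb (hlin (hp i) hb (hp0 i) hi)
      refine hx i (t⁻¹ * t') ?_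
      rw [act_mul, ht', ← ht, ← act_mul, inv_mul_cancel, act_one]
    refine D.unit_eq_one (by norm_num) s fun j => ?_
    have hxj : x.1 j ≠ 0 := by
      intro h0
      rw [← act_eq_zero_iff (fun j => (D.w j : ℤ)) t, ht] at h0
      obtain ⟨k, hk, -⟩ := toCone_eq_zero_iff.mp h0
      obtain ⟨i, -, hi⟩ := NormalForm.triple_eq_zero_iff.mp hk
      exact hb0 i hi
    have := congrFun hs j
    rw [act_natCast, mul_eq_right₀ hxj] at this
    exact Units.ext this
  · rintro i c ⟨b, hb0, hb, hi, hc⟩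
    obtain rfl : c = Γ.toCone b := funext fun j => by rw [hc, Γ.eval_image]
    exact hsame (hp i) ⟨hb0, hb⟩ (hlin (hp i) ⟨hb0, hb⟩ (hp0 i) hi)

end Chart

/-! ### Partial derivatives of normal forms -/

lemma eval_pderiv_mon (u : Fin 3 → ℕ) (j : Fin 3) (x : Fin 3 → ℂ) :
    eval x (pderiv j (mon u (X : Fin 3 → MvPolynomial (Fin 3) ℂ)))
      = u j * mon (u - Pi.single j 1) x := by
  have h1 : mon u (X : Fin 3 → MvPolynomial (Fin 3) ℂ)
      = monomial (Finsupp.equivFunOnFinite.symm u) 1 := by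
    rw [monomial_eq, Finsupp.prod_fintype _ _ (by simp)]
    simp [mon]
  rw [h1, pderiv_monomial, eval_monomial, Finsupp.prod_fintype _ _ (by simp), one_mul, mon]
  congr 1
  refine Finset.prod_congr rfl fun k _ => ?_
  by_cases hk : k = j
  · subst hk; simp
  · simp [hk]

lemma eval_pderiv_mon_ne_zero {u : Fin 3 → ℕ} {j : Fin 3} {x : Fin 3 → ℂ} (hu : u j ≠ 0)
    (hx : mon u x ≠ 0) : eval x (pderiv j (mon u (X : Fin 3 → MvPolynomial (Fin 3) ℂ))) ≠ 0 := by
  rw [eval_pderiv_mon]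
  refine mul_ne_zero (by exact_mod_cast hu) fun h => hx ?_
  obtain ⟨k, hk, hk'⟩ := mon_eq_zero_iff.mp h
  exact mon_eq_zero_iff.mpr ⟨k, hk, fun h0 => hk' (by simp [h0])⟩

lemma eval_pderiv_mon_eq_zero {u : Fin 3 → ℕ} {j : Fin 3} {x : Fin 3 → ℂ}
    (h : u j = 0 ∨ ∃ k ≠ j, x k = 0 ∧ u k ≠ 0) :
    eval x (pderiv j (mon u (X : Fin 3 → MvPolynomial (Fin 3) ℂ))) = 0 := by
  rw [eval_pderiv_mon]
  rcases h with h | ⟨k, hkj, hk, hu⟩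
  · simp [h]
  · rw [mon_eq_zero_iff.mpr ⟨k, hk, by simpa [hkj] using hu⟩, mul_zero]

lemma eval_pderiv_prod_eq_zero {ι : Type*} (s : Finset ι) {g : ι → MvPolynomial (Fin 3) ℂ}
    {j : Fin 3} {x : Fin 3 → ℂ} (h : ∀ i ∈ s, eval x (pderiv j (g i)) = 0) :
    eval x (pderiv j (∏ i ∈ s, g i)) = 0 := by
  classical
  induction s using Finset.induction_on with
  | empty => simp
  | insert a s ha ih =>
    rw [Finset.prod_insert ha, pderiv_mul, map_add, map_mul, map_mul,
      h a (Finset.mem_insert_self a s), ih fun i hi => h i (Finset.mem_insert_of_mem hi)]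
    simp

lemma exists_eq_of_prod_eq_zero {m : ℕ} {l : Fin m → ℂ} {u v : ℂ}
    (h : ∏ i, (u - l i * v) = 0) : ∃ i, u = l i * v := by
  obtain ⟨i, -, hi⟩ := Finset.prod_eq_zero_iff.mp h
  exact ⟨i, sub_eq_zero.mp hi⟩

lemma exists_root_of_unity {q z : ℂ} {p : ℕ} (hp : p ≠ 0) (h : q ^ p = z ^ p) :
    ∃ ζ : ℂˣ, ζ ^ p = 1 ∧ q = ζ * z := by
  by_cases hz : z = 0
  · rw [hz, zero_pow hp] at h
    exact ⟨1, one_pow _, by rw [hz, mul_zero, eq_zero_of_pow_eq_zero h]⟩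
  · have hq : q ≠ 0 := by
      rintro rfl
      rw [zero_pow hp] at h
      exact pow_ne_zero _ hz h.symm
    refine ⟨Units.mk0 (q / z) (div_ne_zero hq hz), Units.ext ?_, by simp [hz]⟩
    simp [div_pow, h, hz]

/-- Points of the cone with prescribed `X₁` and `X₂`; the product of the other coordinates is then
determined up to an `α₃`-th root of unity. -/
lemma exists_wpl_of_two {T : NormalForm} (hA : T.AlphaPos) {u v : ℂ} (h : u ≠ 0 ∨ v ≠ 0) :
    ∃ b ∈ wplCone T, b 0 = u ∧ b 1 = v ∧ (∏ i : Fin T.m, b i.succ.succ) ^ T.alpha₃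
      = ∏ i, (v ^ T.alpha₂ - T.lam i * u ^ T.alpha₁) := by
  choose r hr using fun k : Fin T.m =>
    IsAlgClosed.exists_pow_nat_eq (v ^ T.alpha₂ - T.lam k * u ^ T.alpha₁) (hA k.succ.succ)
  refine ⟨Fin.cons u (Fin.cons v r), ⟨?_, NormalForm.wplEquation_iff.mpr fun i => ?_⟩, rfl, rfl, ?_⟩
  · intro h0
    have h1 : u = 0 := congrFun h0 0
    have h2 : v = 0 := congrFun h0 1
    simp_all
  · induction i using T.forall_index with
    | h0 => rfl
    | h1 => rfl
    | h2 k => exact hr k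
  · rw [← Finset.prod_pow]
    exact Finset.prod_congr rfl fun k _ => hr k

namespace Chart

variable {T : NormalForm} (Γ : Chart T)

lemma eval_pderiv_poly (j : Fin 3) (x : Fin 3 → ℂ) : eval x (pderiv j T.poly)
    = -(mon Γ.M x * eval x (pderiv j (∏ i, (mon Γ.U X - C (T.lam i) * mon Γ.V X)))
      + eval x (pderiv j (mon Γ.M X)) * ∏ i, (mon Γ.U x - T.lam i * mon Γ.V x))
      + eval x (pderiv j (mon Γ.N X)) := by
  simp [Γ.poly_eq, eval_mon, map_prod]
  ring

/-- At a point where a single factor `U - λ_i V` vanishes. -/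
lemma pderiv_ne_zero_of_factor {x : Fin 3 → ℂ} {i : Fin T.m} {j : Fin 3}
    (hi : mon Γ.U x = T.lam i * mon Γ.V x) (hM : mon Γ.M x ≠ 0) (hU : mon Γ.U x ≠ 0)
    (hUj : Γ.U j ≠ 0) (hVj : Γ.V j = 0) (hN : eval x (pderiv j (mon Γ.N X)) = 0) :
    eval x (pderiv j T.poly) ≠ 0 := by
  have h0 : ∏ i, (mon Γ.U x - T.lam i * mon Γ.V x) = 0 :=
    Finset.prod_eq_zero (Finset.mem_univ i) (by rw [hi, sub_self])
  have hV : mon Γ.V x ≠ 0 := by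
    intro h
    rw [h, mul_zero] at hi
    exact hU hi
  rw [Γ.eval_pderiv_poly, hN, h0, ← Finset.mul_prod_erase Finset.univ _ (Finset.mem_univ i),
    pderiv_mul]
  simp only [map_add, map_mul, map_sub, eval_C, eval_mon, map_prod, hi, sub_self, zero_mul,
    add_zero, mul_zero, pderiv_mul, pderiv_C, zero_add, eval_pderiv_mon_eq_zero (Or.inl hVj),
    sub_zero, neg_ne_zero]
  refine mul_ne_zero hM (mul_ne_zero (eval_pderiv_mon_ne_zero hUj hU) ?_)
  rw [Finset.prod_ne_zero_iff]
  intro k hk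
  rw [← sub_mul]
  refine mul_ne_zero (sub_ne_zero.mpr fun h => ?_) hV
  exact (Finset.ne_of_mem_erase hk) (T.lam_injective h).symm

/-- At a point where the last monomial does not vanish. -/
lemma pderiv_ne_zero_of_N {x : Fin 3 → ℂ} {j : Fin 3} (hNj : Γ.N j ≠ 0) (hM : Γ.M j = 0)
    (hU : Γ.U j = 0) (hV : Γ.V j = 0) (hN : mon Γ.N x ≠ 0) : eval x (pderiv j T.poly) ≠ 0 := by
  rw [Γ.eval_pderiv_poly, eval_pderiv_mon_eq_zero (Or.inl hM), eval_pderiv_prod_eq_zero]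
  · simpa using eval_pderiv_mon_ne_zero hNj hN
  · intro i _
    simp [eval_pderiv_mon_eq_zero (Or.inl hU), eval_pderiv_mon_eq_zero (Or.inl hV)]

/-- At a point on a coordinate hyperplane `M = 0`. -/
lemma pderiv_ne_zero_of_M {x : Fin 3 → ℂ} {j : Fin 3} (hx : x j = 0) (hMj : Γ.M j = 1)
    (hM : mon (Γ.M - Pi.single j 1) x ≠ 0) (hV : mon Γ.V x = 0 ∨ mon Γ.U x = 0)
    (hUV : mon Γ.U x ≠ 0 ∨ mon Γ.V x ≠ 0) (hN : eval x (pderiv j (mon Γ.N X)) = 0) :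
    eval x (pderiv j T.poly) ≠ 0 := by
  rw [Γ.eval_pderiv_poly, hN, eval_pderiv_mon, hMj, Nat.cast_one, one_mul,
    mon_eq_zero_iff.mpr ⟨j, hx, by rw [hMj]; exact one_ne_zero⟩]
  simp only [zero_mul, zero_add, add_zero, neg_ne_zero]
  refine mul_ne_zero hM fun h => ?_
  obtain ⟨i, hi⟩ := exists_eq_of_prod_eq_zero h
  have := T.lam_ne_zero i
  rcases hV with hV | hV <;> simp_all

end Chart

lemma NormalForm.m_ne_zero (T : NormalForm) : T.m ≠ 0 := Nat.pos_iff_ne_zero.mp T.m_pos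

/-! ### The normal form of type I -/

section TypeI

variable {T : NormalForm} {a b p : ℕ}

/-- The exponent vectors of the normal forms of type I. -/
def chartI (hpoly : T.poly = -(∏ i, (X 1 ^ b - C (T.lam i) * X 0 ^ a)) + X 2 ^ p)
    (himage : T.image = ![X 0, X 1, ∏ i : Fin T.m, X i.succ.succ])
    (h1 : T.alpha₁ = a) (h2 : T.alpha₂ = b) (h3 : T.alpha₃ = p) : Chart T where
  M := ![0, 0, 0]
  U := ![0, b, 0]
  V := ![a, 0, 0]
  N := ![0, 0, p]
  γ := ![0, 0, 0]
  e := ![![1, 0, 0], ![0, 1, 0], ![0, 0, 1]]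
  poly_eq := by simp [hpoly, mon, Fin.prod_univ_three]
  image_eq j := by fin_cases j <;> simp [himage, mon, Fin.prod_univ_three]
  U_e k := by fin_cases k <;> simp [h2, Fin.sum_univ_three]
  V_e k := by fin_cases k <;> simp [h1, Fin.sum_univ_three]
  N_e k := by fin_cases k <;> simp [h3, Fin.sum_univ_three]

lemma exists_chart_I {D : Deformation 3} (hD : D.poly = T.poly) (ha : a ≠ 0) (hb : b ≠ 0)
    (hp : p ≠ 0) (hpoly : T.poly = -(∏ i, (X 1 ^ b - C (T.lam i) * X 0 ^ a)) + X 2 ^ p)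
    (himage : T.image = ![X 0, X 1, ∏ i : Fin T.m, X i.succ.succ])
    (h1 : T.alpha₁ = a) (h2 : T.alpha₂ = b) (h3 : T.alpha₃ = p) :
    ∃ Γ : Chart T, Γ.IsGood ∧ ∀ t : ℂˣ, Γ.Rel fun j => t ^ D.w j := by
  set Γ := chartI hpoly himage h1 h2 h3 with hΓ
  have hA : T.AlphaPos := by
    intro i
    rw [T.A_eq_block]
    generalize T.block i = k
    fin_cases k <;> simp [h1, h2, h3] <;> omega
  have hUV := Γ.weight_U_eq_weight_V hD (j := 2) (by simp [hΓ, chartI, hp])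
    (by simp [hΓ, chartI]) (by simp [hΓ, chartI]) (by simp [hΓ, chartI])
  have hN := Γ.weight_N_eq_degree hD hUV
  have hM := Γ.weight_M_add hD hUV (x := ![0, 1, 0])
    (by simp [hΓ, chartI, mon, Fin.prod_univ_three, hp])
    (by simp [hΓ, chartI, mon, Fin.prod_univ_three, ha])
  refine ⟨Γ, ⟨hA, ?_, ?_, ?_, ?_, ?_⟩, Γ.rel_of_weights hUV (hM.trans hN.symm)⟩
  · intro k
    fin_cases k
    · refine ⟨0, rfl, fun τ hτ hj => ?_⟩
      have e1 := hj 1 rfl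
      have e2 := hj 2 rfl
      simp [Chart.Rel, hΓ, chartI, mon, Fin.prod_univ_three, e1, e2] at hτ
      refine ⟨by simpa [h1] using hτ.symm, fun j => ?_⟩
      fin_cases j <;> simp [hΓ, chartI, e1, e2]
    · refine ⟨1, rfl, fun τ hτ hj => ?_⟩
      have e1 := hj 0 rfl
      have e2 := hj 2 rfl
      simp [Chart.Rel, hΓ, chartI, mon, Fin.prod_univ_three, e1, e2] at hτ
      refine ⟨by simpa [h2] using hτ.1, fun j => ?_⟩
      fin_cases j <;> simp [hΓ, chartI, e1, e2]
    · refine ⟨2, rfl, fun τ hτ hj => ?_⟩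
      have e1 := hj 0 rfl
      have e2 := hj 1 rfl
      simp [Chart.Rel, hΓ, chartI, mon, Fin.prod_univ_three, e1, e2] at hτ
      refine ⟨by simpa [h3] using hτ, fun j => ?_⟩
      fin_cases j <;> simp [hΓ, chartI, e1, e2]
  · intro k
    fin_cases k
    · exact ⟨1, rfl⟩
    · exact ⟨0, rfl⟩
    · exact ⟨0, rfl⟩
  · intro k hk
    fin_cases k <;> simp [hΓ, chartI] at hk
  all_goals
    intro x hx hf
    rw [Γ.eval_poly] at hf
    simp [hΓ, chartI, mon, Fin.prod_univ_three] at hf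
  · have hxy : x 0 ≠ 0 ∨ x 1 ≠ 0 := by
      by_contra! h0
      simp [h0.1, h0.2, ha, hb, hp, T.m_ne_zero] at hf
      apply hx
      funext j
      fin_cases j <;> simp [h0, hf]
    obtain ⟨b, hb, e0, e1, e2⟩ := exists_wpl_of_two hA hxy
    rw [h1, h2, h3] at e2
    obtain ⟨ζ, hζ, hz⟩ := exists_root_of_unity (z := x 2) hp (e2.trans
      (by linear_combination - hf))
    refine ⟨b, hb, Or.inl ⟨![1, 1, ζ], ?_, fun j => ?_⟩⟩
    · simp [Chart.Rel, hΓ, chartI, mon, Fin.prod_univ_three, hζ]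
    · fin_cases j <;> simp [Chart.toCone, triple, hΓ, chartI, mon, Fin.prod_univ_three, e0, e1, hz]
  · by_cases hz : x 2 = 0
    · rw [hz, zero_pow hp, add_zero, neg_eq_zero] at hf
      obtain ⟨i, hi⟩ := exists_eq_of_prod_eq_zero hf
      have hy : x 1 ≠ 0 := by
        intro hy
        rw [hy, zero_pow hb] at hi
        apply hx
        have : x 0 = 0 := by simpa [T.lam_ne_zero, ha] using hi.symm
        funext j
        fin_cases j <;> simp [hy, hz, this]
      refine ⟨1, Γ.pderiv_ne_zero_of_factor (i := i)
        (by simpa [hΓ, chartI, mon, Fin.prod_univ_three] using hi) ?_ ?_ ?_ ?_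
        (eval_pderiv_mon_eq_zero (Or.inl ?_))⟩ <;>
        simp [hΓ, chartI, mon, Fin.prod_univ_three, hy, hb]
    · refine ⟨2, Γ.pderiv_ne_zero_of_N ?_ ?_ ?_ ?_ ?_⟩ <;>
        simp [hΓ, chartI, mon, Fin.prod_univ_three, hz, hp]

end TypeI

/-! ### The normal form of type II₁ -/

section TypeIIOne

variable {T : NormalForm} {a b p : ℕ}

/-- The exponent vectors of the normal forms of type II₁. -/
def chartIIOne (hpoly : T.poly = -(X 0 * ∏ i, (X 1 ^ b - C (T.lam i) * X 0 ^ a)) + X 2 ^ p)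
    (himage : T.image = ![X 0 ^ p, X 1, X 0 * ∏ i : Fin T.m, X i.succ.succ])
    (h1 : T.alpha₁ = p * a) (h2 : T.alpha₂ = b) (h3 : T.alpha₃ = p) : Chart T where
  M := ![1, 0, 0]
  U := ![0, b, 0]
  V := ![a, 0, 0]
  N := ![0, 0, p]
  γ := ![0, 0, 0]
  e := ![![p, 0, 0], ![0, 1, 0], ![1, 0, 1]]
  poly_eq := by simp [hpoly, mon, Fin.prod_univ_three]
  image_eq j := by fin_cases j <;> simp [himage, mon, Fin.prod_univ_three]
  U_e k := by fin_cases k <;> simp [h2, Fin.sum_univ_three]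
  V_e k := by fin_cases k <;> simp [h1, Fin.sum_univ_three, mul_comm]
  N_e k := by fin_cases k <;> simp [h3, Fin.sum_univ_three]

lemma exists_chart_IIOne {D : Deformation 3} (hD : D.poly = T.poly) (hb : b ≠ 0)
    (hp : p ≠ 0) (hpoly : T.poly = -(X 0 * ∏ i, (X 1 ^ b - C (T.lam i) * X 0 ^ a)) + X 2 ^ p)
    (himage : T.image = ![X 0 ^ p, X 1, X 0 * ∏ i : Fin T.m, X i.succ.succ])
    (h1 : T.alpha₁ = p * a) (h2 : T.alpha₂ = b) (h3 : T.alpha₃ = p) :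
    ∃ Γ : Chart T, Γ.IsGood ∧ ∀ t : ℂˣ, Γ.Rel fun j => t ^ D.w j := by
  set Γ := chartIIOne hpoly himage h1 h2 h3 with hΓ
  have hUV := Γ.weight_U_eq_weight_V hD (j := 2) (by simp [hΓ, chartIIOne, hp])
    (by simp [hΓ, chartIIOne]) (by simp [hΓ, chartIIOne]) (by simp [hΓ, chartIIOne])
  have ha : a ≠ 0 := by
    rintro rfl
    simp [hΓ, chartIIOne, Fin.sum_univ_three, hb, (D.w_pos 1).ne'] at hUV
  have hN := Γ.weight_N_eq_degree hD hUV
  have hM := Γ.weight_M_add hD hUV (x := ![1, 0, 0])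
    (by simp [hΓ, chartIIOne, mon, Fin.prod_univ_three, hp])
    (by simp [hΓ, chartIIOne, mon, Fin.prod_univ_three, hb, Finset.prod_ne_zero_iff,
      T.lam_ne_zero])
  have hA : T.AlphaPos := by
    intro i
    rw [T.A_eq_block]
    generalize T.block i = k
    fin_cases k <;> simp [h1, h2, h3] <;> omega
  refine ⟨Γ, ⟨hA, ?_, ?_, ?_, ?_, ?_⟩, Γ.rel_of_weights hUV (hM.trans hN.symm)⟩
  · intro k
    fin_cases k
    · refine ⟨2, rfl, fun τ hτ hj => ?_⟩
      have e1 := hj 1 rfl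
      simp [Chart.Rel, hΓ, chartIIOne, mon, Fin.prod_univ_three, e1] at hτ
      refine ⟨by simp [h1, pow_mul, hτ.2, ← hτ.1], fun j => ?_⟩
      fin_cases j <;> simp [hΓ, chartIIOne, e1, hτ.2]
    · refine ⟨1, rfl, fun τ hτ hj => ?_⟩
      have e1 := hj 0 rfl
      have e2 := hj 2 rfl
      simp [Chart.Rel, hΓ, chartIIOne, mon, Fin.prod_univ_three, e1, e2] at hτ
      refine ⟨by simpa [h2] using hτ.1, fun j => ?_⟩
      fin_cases j <;> simp [hΓ, chartIIOne, e1, e2]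
    · refine ⟨2, rfl, fun τ hτ hj => ?_⟩
      have e1 := hj 0 rfl
      have e2 := hj 1 rfl
      simp [Chart.Rel, hΓ, chartIIOne, mon, Fin.prod_univ_three, e1, e2] at hτ
      refine ⟨by simpa [h3] using hτ, fun j => ?_⟩
      fin_cases j <;> simp [hΓ, chartIIOne, e1, e2]
  · intro k
    fin_cases k
    · exact ⟨1, rfl⟩
    · exact ⟨0, rfl⟩
    · exact ⟨0, rfl⟩
  · intro k hk
    fin_cases k <;> simp [hΓ, chartIIOne] at hk
  all_goals
    intro x hx hf
    rw [Γ.eval_poly] at hf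
    simp [hΓ, chartIIOne, mon, Fin.prod_univ_three] at hf
    have hxy : x 0 = 0 → x 1 ≠ 0 := by
      intro h0 h1
      simp [h0, hp] at hf
      apply hx
      funext j
      fin_cases j <;> simp [h0, h1, hf]
  · obtain ⟨c, hc⟩ := IsAlgClosed.exists_pow_nat_eq (x 0) (Nat.pos_of_ne_zero hp)
    have hc0 : c ≠ 0 ∨ x 1 ≠ 0 := by
      by_contra! h0
      exact hxy (by rw [← hc, h0.1, zero_pow hp]) h0.2
    obtain ⟨b, hb, e0, e1, e2⟩ := exists_wpl_of_two hA hc0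
    rw [h1, h2, h3] at e2
    simp only [pow_mul, hc] at e2
    obtain ⟨ζ, hζ, hz⟩ := exists_root_of_unity (z := x 2)
      (q := c * ∏ i : Fin T.m, b i.succ.succ) hp
      (by rw [mul_pow, e2, hc]; linear_combination - hf)
    refine ⟨b, hb, Or.inl ⟨![1, 1, ζ], ?_, fun j => ?_⟩⟩
    · simp [Chart.Rel, hΓ, chartIIOne, mon, Fin.prod_univ_three, hζ]
    · fin_cases j <;>
        simp [Chart.toCone, triple, hΓ, chartIIOne, mon, Fin.prod_univ_three, e0, e1, hz, hc]
  · by_cases hz : x 2 = 0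
    · rw [hz, zero_pow hp, add_zero, neg_eq_zero, mul_eq_zero] at hf
      by_cases h0 : x 0 = 0
      · have hy := hxy h0
        refine ⟨0, Γ.pderiv_ne_zero_of_M h0 ?_ ?_ (Or.inl ?_) (Or.inl ?_)
          (eval_pderiv_mon_eq_zero (Or.inl ?_))⟩ <;>
          simp [hΓ, chartIIOne, mon, Fin.prod_univ_three, h0, hy, ha]
      obtain ⟨i, hi⟩ := exists_eq_of_prod_eq_zero (hf.resolve_left h0)
      have hy : x 1 ≠ 0 := by
        intro hy
        rw [hy, zero_pow hb] at hi
        exact h0 (by simpa [T.lam_ne_zero, ha] using hi.symm)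
      refine ⟨1, Γ.pderiv_ne_zero_of_factor (i := i)
        (by simpa [hΓ, chartIIOne, mon, Fin.prod_univ_three] using hi) ?_ ?_ ?_ ?_
        (eval_pderiv_mon_eq_zero (Or.inl ?_))⟩ <;>
        simp [hΓ, chartIIOne, mon, Fin.prod_univ_three, hy, hb, h0]
    · refine ⟨2, Γ.pderiv_ne_zero_of_N ?_ ?_ ?_ ?_ ?_⟩ <;>
        simp [hΓ, chartIIOne, mon, Fin.prod_univ_three, hz, hp]

end TypeIIOne

/-! ### The normal form of type III -/

section TypeIII

variable {T : NormalForm} {a b p : ℕ}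

/-- The exponent vectors of the normal forms of type III. -/
def chartIII
    (hpoly : T.poly = -(X 0 * X 1 * ∏ i, (X 1 ^ b - C (T.lam i) * X 0 ^ a)) + X 2 ^ p)
    (himage : T.image = ![X 0 ^ p, X 1 ^ p, X 0 * X 1 * ∏ i : Fin T.m, X i.succ.succ])
    (h1 : T.alpha₁ = p * a) (h2 : T.alpha₂ = p * b) (h3 : T.alpha₃ = p) : Chart T where
  M := ![1, 1, 0]
  U := ![0, b, 0]
  V := ![a, 0, 0]
  N := ![0, 0, p]
  γ := ![0, 0, 0]
  e := ![![p, 0, 0], ![0, p, 0], ![1, 1, 1]]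
  poly_eq := by simp [hpoly, mon, Fin.prod_univ_three]
  image_eq j := by fin_cases j <;> simp [himage, mon, Fin.prod_univ_three]
  U_e k := by fin_cases k <;> simp [h2, Fin.sum_univ_three, mul_comm]
  V_e k := by fin_cases k <;> simp [h1, Fin.sum_univ_three, mul_comm]
  N_e k := by fin_cases k <;> simp [h3, Fin.sum_univ_three]

lemma exists_chart_III {D : Deformation 3} (hD : D.poly = T.poly)
    (hp : p ≠ 0)
    (hpoly : T.poly = -(X 0 * X 1 * ∏ i, (X 1 ^ b - C (T.lam i) * X 0 ^ a)) + X 2 ^ p)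
    (himage : T.image = ![X 0 ^ p, X 1 ^ p, X 0 * X 1 * ∏ i : Fin T.m, X i.succ.succ])
    (h1 : T.alpha₁ = p * a) (h2 : T.alpha₂ = p * b) (h3 : T.alpha₃ = p) :
    ∃ Γ : Chart T, Γ.IsGood ∧ ∀ t : ℂˣ, Γ.Rel fun j => t ^ D.w j := by
  set Γ := chartIII hpoly himage h1 h2 h3 with hΓ
  have hUV := Γ.weight_U_eq_weight_V hD (j := 2) (by simp [hΓ, chartIII, hp])
    (by simp [hΓ, chartIII]) (by simp [hΓ, chartIII]) (by simp [hΓ, chartIII])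
  have hab : a = 0 ↔ b = 0 := by
    simp [hΓ, chartIII, Fin.sum_univ_three] at hUV
    constructor
    · rintro rfl
      simpa [(D.w_pos 1).ne'] using hUV
    · rintro rfl
      simpa [(D.w_pos 0).ne'] using hUV
  have hb : b ≠ 0 := by
    -- otherwise a factor `1 - λ_i` is zero, and a single monomial remains
    intro hb
    have ha := hab.mpr hb
    subst ha hb
    have h0 : ∏ i, ((1 : MvPolynomial (Fin 3) ℂ) - C (T.lam i)) = 0 :=
      Finset.prod_eq_zero (Finset.mem_univ ⟨0, T.m_pos⟩) (by rw [T.lam_first]; simp)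
    simp only [pow_zero, mul_one, h0, mul_zero, neg_zero, zero_add] at hpoly
    have hE : ∀ k, D.E k = Finsupp.single 2 p := by
      intro k
      have := D.coeff_poly_E k
      rw [hD, hpoly, coeff_X_pow] at this
      by_contra h
      rw [if_neg (Ne.symm h)] at this
      exact D.a_ne_zero k this.symm
    have h3 := D.le_N
    have := D.E_injective ((hE ⟨0, by omega⟩).trans (hE ⟨1, by omega⟩).symm)
    simp at this
  have ha : a ≠ 0 := fun h => hb (hab.mp h)
  have hN := Γ.weight_N_eq_degree hD hUV
  have hM : ∑ k, Γ.M k * D.w k + T.m * ∑ k, Γ.U k * D.w k = D.d := by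
    obtain ⟨c, hc⟩ := ((Set.finite_range T.lam).insert 0).exists_notMem
    obtain ⟨y, hy⟩ := IsAlgClosed.exists_pow_nat_eq c (Nat.pos_of_ne_zero hb)
    have hy0 : y ≠ 0 := by
      rintro rfl
      rw [zero_pow hb] at hy
      exact hc (by simp [← hy])
    refine Γ.weight_M_add hD hUV (x := ![1, y, 0]) ?_ ?_
    · simp [hΓ, chartIII, mon, Fin.prod_univ_three, hp]
    · simp [hΓ, chartIII, mon, Fin.prod_univ_three, Finset.prod_eq_zero_iff, hy, hy0,
        sub_eq_zero]
      rintro i rfl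
      exact hc (by simp)
  have hA : T.AlphaPos := by
    intro i
    rw [T.A_eq_block]
    generalize T.block i = k
    fin_cases k <;> simp [h1, h2, h3] <;> omega
  refine ⟨Γ, ⟨hA, ?_, ?_, ?_, ?_, ?_⟩, Γ.rel_of_weights hUV (hM.trans hN.symm)⟩
  · intro k
    fin_cases k
    · refine ⟨2, rfl, fun τ hτ hj => ?_⟩
      have e1 := hj 1 rfl
      simp [Chart.Rel, hΓ, chartIII, mon, Fin.prod_univ_three, e1] at hτ
      refine ⟨by simp [h1, pow_mul, hτ.2, ← hτ.1], fun j => ?_⟩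
      fin_cases j <;> simp [hΓ, chartIII, e1, hτ.2]
    · refine ⟨2, rfl, fun τ hτ hj => ?_⟩
      have e1 := hj 0 rfl
      simp [Chart.Rel, hΓ, chartIII, mon, Fin.prod_univ_three, e1] at hτ
      refine ⟨by simp [h2, pow_mul, hτ.2, hτ.1], fun j => ?_⟩
      fin_cases j <;> simp [hΓ, chartIII, e1, hτ.2, hτ.1]
    · refine ⟨2, rfl, fun τ hτ hj => ?_⟩
      have e1 := hj 0 (by simp [hΓ, chartIII])
      have e2 := hj 1 (by simp [hΓ, chartIII])
      simp [Chart.Rel, hΓ, chartIII, mon, Fin.prod_univ_three, e1, e2] at hτ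
      refine ⟨by simpa [h3] using hτ, fun j => ?_⟩
      fin_cases j <;> simp [hΓ, chartIII, e1, e2]
  · intro k
    fin_cases k
    · exact ⟨1, rfl⟩
    · exact ⟨0, rfl⟩
    · exact ⟨0, rfl⟩
  · intro k hk
    fin_cases k <;> simp [hΓ, chartIII] at hk
  all_goals
    intro x hx hf
    rw [Γ.eval_poly] at hf
    simp [hΓ, chartIII, mon, Fin.prod_univ_three] at hf
    have hxy : x 0 = 0 → x 1 ≠ 0 := by
      intro h0 h1
      simp [h0, hp] at hf
      apply hx
      funext j
      fin_cases j <;> simp [h0, h1, hf]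
  · obtain ⟨c, hc⟩ := IsAlgClosed.exists_pow_nat_eq (x 0) (Nat.pos_of_ne_zero hp)
    obtain ⟨c', hc'⟩ := IsAlgClosed.exists_pow_nat_eq (x 1) (Nat.pos_of_ne_zero hp)
    have hc0 : c ≠ 0 ∨ c' ≠ 0 := by
      by_contra! h0
      exact hxy (by rw [← hc, h0.1, zero_pow hp]) (by rw [← hc', h0.2, zero_pow hp])
    obtain ⟨b, hb, e0, e1, e2⟩ := exists_wpl_of_two hA hc0
    rw [h1, h2, h3] at e2
    simp only [pow_mul, hc, hc'] at e2
    obtain ⟨ζ, hζ, hz⟩ := exists_root_of_unity (z := x 2)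
      (q := c * c' * ∏ i : Fin T.m, b i.succ.succ) hp
      (by rw [mul_pow, mul_pow, e2, hc, hc']; linear_combination - hf)
    refine ⟨b, hb, Or.inl ⟨![1, 1, ζ], ?_, fun j => ?_⟩⟩
    · simp [Chart.Rel, hΓ, chartIII, mon, Fin.prod_univ_three, hζ]
    · fin_cases j <;>
        simp [Chart.toCone, triple, hΓ, chartIII, mon, Fin.prod_univ_three, e0, e1, hz, hc, hc']
  · by_cases hz : x 2 = 0
    · rw [hz, zero_pow hp, add_zero, neg_eq_zero, mul_eq_zero, mul_eq_zero] at hf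
      by_cases h0 : x 0 = 0
      · have hy := hxy h0
        refine ⟨0, Γ.pderiv_ne_zero_of_M h0 ?_ ?_ (Or.inl ?_) (Or.inl ?_)
          (eval_pderiv_mon_eq_zero (Or.inl ?_))⟩ <;>
          simp [hΓ, chartIII, mon, Fin.prod_univ_three, h0, hy, ha]
      by_cases hy : x 1 = 0
      · refine ⟨1, Γ.pderiv_ne_zero_of_M hy ?_ ?_ (Or.inr ?_) (Or.inr ?_)
          (eval_pderiv_mon_eq_zero (Or.inl ?_))⟩ <;>
          simp [hΓ, chartIII, mon, Fin.prod_univ_three, h0, hy, hb]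
      obtain ⟨i, hi⟩ := exists_eq_of_prod_eq_zero (hf.resolve_left (by simp [h0, hy]))
      refine ⟨1, Γ.pderiv_ne_zero_of_factor (i := i)
        (by simpa [hΓ, chartIII, mon, Fin.prod_univ_three] using hi) ?_ ?_ ?_ ?_
        (eval_pderiv_mon_eq_zero (Or.inl ?_))⟩ <;>
        simp [hΓ, chartIII, mon, Fin.prod_univ_three, hy, hb, h0]
    · refine ⟨2, Γ.pderiv_ne_zero_of_N ?_ ?_ ?_ ?_ ?_⟩ <;>
        simp [hΓ, chartIII, mon, Fin.prod_univ_three, hz, hp]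

end TypeIII

/-! ### The normal form of type II₂ -/

section TypeIITwo

variable {T : NormalForm} {a b p : ℕ}

/-- The exponent vectors of the normal forms of type II₂. -/
def chartIITwo (hpoly : T.poly = -(∏ i, (X 2 ^ b - C (T.lam i) * X 0 ^ a)) + X 0 * X 1 ^ p)
    (himage : T.image = ![X 0 ^ (b * T.m), ∏ i : Fin T.m, X i.succ.succ, X 0 * X 1])
    (h1 : T.alpha₁ + b = b * (a * T.m)) (h2 : T.alpha₂ = b) (h3 : T.alpha₃ = p) : Chart T where
  M := ![0, 0, 0]
  U := ![0, 0, b]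
  V := ![a, 0, 0]
  N := ![1, p, 0]
  γ := ![b, 0, 0]
  e := ![![b * T.m, 0, 0], ![0, 0, 1], ![1, 1, 0]]
  poly_eq := by simp [hpoly, mon, Fin.prod_univ_three]
  image_eq j := by fin_cases j <;> simp [himage, mon, Fin.prod_univ_three]
  U_e k := by fin_cases k <;> simp [h2, Fin.sum_univ_three]
  V_e k := by
    fin_cases k
    · simp [Fin.sum_univ_three]
      rw [add_comm, h1]; ring
    all_goals simp [Fin.sum_univ_three]
  N_e k := by fin_cases k <;> simp [h3, Fin.sum_univ_three, mul_comm]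

lemma exists_chart_IITwo {D : Deformation 3} (hD : D.poly = T.poly) (ha : a ≠ 0) (hb : b ≠ 0)
    (hp : p ≠ 0) (hpoly : T.poly = -(∏ i, (X 2 ^ b - C (T.lam i) * X 0 ^ a)) + X 0 * X 1 ^ p)
    (himage : T.image = ![X 0 ^ (b * T.m), ∏ i : Fin T.m, X i.succ.succ, X 0 * X 1])
    (h1 : T.alpha₁ + b = b * (a * T.m)) (h2 : T.alpha₂ = b) (h3 : T.alpha₃ = p) :
    ∃ Γ : Chart T, Γ.IsGood ∧ ∀ t : ℂˣ, Γ.Rel fun j => t ^ D.w j := by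
  set Γ := chartIITwo hpoly himage h1 h2 h3 with hΓ
  have hm := T.m_ne_zero
  have hUV := Γ.weight_U_eq_weight_V hD (j := 1) (by simp [hΓ, chartIITwo, hp])
    (by simp [hΓ, chartIITwo]) (by simp [hΓ, chartIITwo]) (by simp [hΓ, chartIITwo])
  have hN := Γ.weight_N_eq_degree hD hUV
  have hM := Γ.weight_M_add hD hUV (x := ![0, 0, 1])
    (by simp [hΓ, chartIITwo, mon, Fin.prod_univ_three])
    (by simp [hΓ, chartIITwo, mon, Fin.prod_univ_three, ha])
  have ham : 1 < a * T.m := by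
    have h := hM.trans hN.symm
    rw [hUV] at h
    simp [hΓ, chartIITwo, Fin.sum_univ_three] at h
    by_contra! hle
    have h1 := Nat.mul_le_mul_right (D.w 0) hle
    have h2 : 0 < p * D.w 1 := Nat.mul_pos (Nat.pos_of_ne_zero hp) (D.w_pos 1)
    rw [mul_comm a, mul_assoc] at h1
    omega
  have hα : 0 < T.alpha₁ := by
    by_contra! h
    have h0 : b < b * (a * T.m) := lt_mul_of_one_lt_right (Nat.pos_of_ne_zero hb) ham
    omega
  have hA : T.AlphaPos := by
    intro i
    rw [T.A_eq_block]
    generalize T.block i = k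
    fin_cases k <;> simp [hα, h2, h3] <;> omega
  refine ⟨Γ, ⟨hA, ?_, ?_, ?_, ?_, ?_⟩, Γ.rel_of_weights hUV (hM.trans hN.symm)⟩
  · intro k
    fin_cases k
    · refine ⟨2, rfl, fun τ hτ hj => ?_⟩
      have e1 := hj 1 rfl
      simp [Chart.Rel, hΓ, chartIITwo, mon, Fin.prod_univ_three, e1] at hτ
      have e2 : τ 2 ^ T.alpha₁ * τ 2 ^ b = 1 * τ 2 ^ b := by
        rw [← pow_add, h1, one_mul, hτ.1, hτ.2, ← pow_mul, ← pow_mul]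
        congr 1
        ring
      refine ⟨mul_right_cancel e2, fun j => ?_⟩
      fin_cases j
      · simp [hΓ, chartIITwo, hτ.2, pow_mul]
      all_goals simp [hΓ, chartIITwo, e1]
    · refine ⟨2, rfl, fun τ hτ hj => ?_⟩
      have e1 := hj 0 rfl
      have e2 := hj 1 rfl
      simp [Chart.Rel, hΓ, chartIITwo, mon, Fin.prod_univ_three, e1, e2] at hτ
      refine ⟨by simpa [h2] using hτ.1, fun j => ?_⟩
      fin_cases j <;> simp [hΓ, chartIITwo, e1, e2]
    · refine ⟨1, rfl, fun τ hτ hj => ?_⟩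
      have e1 := hj 0 rfl
      have e2 := hj 2 rfl
      simp [Chart.Rel, hΓ, chartIITwo, mon, Fin.prod_univ_three, e1, e2] at hτ
      refine ⟨by simpa [h3] using hτ, fun j => ?_⟩
      fin_cases j <;> simp [hΓ, chartIITwo, e1, e2]
  · intro k
    fin_cases k
    · exact ⟨1, rfl⟩
    · exact ⟨0, rfl⟩
    · exact ⟨0, rfl⟩
  · intro k hk
    have hbm : b * T.m ≠ 0 := mul_ne_zero hb hm
    fin_cases k
    · refine ⟨by simp, fun l hl => ?_⟩
      have := hl 0
      fin_cases l <;> simp_all [chartIITwo]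
    all_goals simp [hΓ, chartIITwo] at hk
  all_goals
    intro x hx hf
    rw [Γ.eval_poly] at hf
    simp [hΓ, chartIITwo, mon, Fin.prod_univ_three] at hf
    have hxz : x 0 = 0 → x 2 = 0 ∧ x 1 ≠ 0 := by
      intro h0
      have hz : x 2 = 0 := by simpa [h0, ha, hb, hm] using hf
      refine ⟨hz, fun hy => hx ?_⟩
      funext j
      fin_cases j <;> simp [h0, hz, hy]
  · by_cases h0 : x 0 = 0
    · obtain ⟨hz, hy⟩ := hxz h0
      obtain ⟨c, hc, e0, e1, e2⟩ := exists_wpl_of_two hA (u := 0) (v := 1) (by simp)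
      have hP : ∏ i : Fin T.m, c i.succ.succ ≠ 0 := by
        intro h
        rw [h, h3, zero_pow hp, zero_pow hα.ne'] at e2
        simp at e2
      refine ⟨c, hc, Or.inr ⟨1, hy, ?_, fun j hj => ?_⟩⟩
      · simpa [Chart.toCone, triple, hΓ, chartIITwo, mon, Fin.prod_univ_three] using hP
      · fin_cases j
        · simp [Chart.toCone, triple, hΓ, chartIITwo, mon, Fin.prod_univ_three, e0, h0, hb, hm]
        · simp at hj
        · simp [Chart.toCone, triple, hΓ, chartIITwo, mon, Fin.prod_univ_three, e0, hz]
    · obtain ⟨c, hc⟩ := IsAlgClosed.exists_pow_nat_eq (x 0)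
        (Nat.pos_of_ne_zero (mul_ne_zero hb hm))
      have hc0 : c ≠ 0 := by
        rintro rfl
        rw [zero_pow (mul_ne_zero hb hm)] at hc
        exact h0 hc.symm
      obtain ⟨q, hq, e0, e1, e2⟩ := exists_wpl_of_two hA (u := c) (v := x 2 / c) (Or.inl hc0)
      rw [h2, h3] at e2
      have e3 : x 0 * ∏ i, ((x 2 / c) ^ b - T.lam i * c ^ T.alpha₁)
          = ∏ i, (x 2 ^ b - T.lam i * x 0 ^ a) := by
        rw [← hc, pow_mul, ← Fin.prod_const T.m, ← Finset.prod_mul_distrib]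
        refine Finset.prod_congr rfl fun i _ => ?_
        rw [Fin.prod_const, ← pow_mul, ← pow_mul, mul_sub, ← mul_pow, mul_div_cancel₀ _ hc0,
          show b * (T.m * a) = T.alpha₁ + b by rw [h1]; ring, pow_add]
        ring
      obtain ⟨ζ, hζ, hy⟩ := exists_root_of_unity (z := x 1) (q := ∏ i : Fin T.m, q i.succ.succ) hp
        (by
          rw [e2]
          apply mul_left_cancel₀ h0
          rw [e3]
          linear_combination - hf)
      refine ⟨q, hq, Or.inl ⟨![1, ζ, 1], ?_, fun j => ?_⟩⟩
      · simp [Chart.Rel, hΓ, chartIITwo, mon, Fin.prod_univ_three, hζ]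
      · fin_cases j
        · simp [Chart.toCone, triple, hΓ, chartIITwo, mon, Fin.prod_univ_three, e0, hc]
        · simp [Chart.toCone, triple, hΓ, chartIITwo, mon, Fin.prod_univ_three, hy]
        · simp [Chart.toCone, triple, hΓ, chartIITwo, mon, Fin.prod_univ_three, e0, e1,
            mul_div_cancel₀ _ hc0]
  · by_cases h0 : x 0 = 0
    · obtain ⟨hz, hy⟩ := hxz h0
      refine ⟨0, ?_⟩
      -- the product has no linear term in `x`, as `a m > 1`
      have hprod : eval x (pderiv 0 (∏ i, (mon Γ.U X - C (T.lam i) * mon Γ.V X))) = 0 := by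
        rcases Nat.lt_or_ge 1 a with ha1 | ha1
        · refine eval_pderiv_prod_eq_zero _ fun i _ => ?_
          simp [hΓ, chartIITwo, mon, Fin.prod_univ_three, h0]
          omega
        · have ha2 : a = 1 := by omega
          have h1m : 1 < T.m := by simpa [ha2] using ham
          have hne : (⟨1, h1m⟩ : Fin T.m) ∈ Finset.univ.erase ⟨0, T.m_pos⟩ := by
            simp [Fin.ext_iff]
          rw [← Finset.mul_prod_erase Finset.univ _ (Finset.mem_univ ⟨0, T.m_pos⟩),
            ← Finset.mul_prod_erase _ _ hne]
          have hU : mon Γ.U x = 0 := by simp [hΓ, chartIITwo, mon, Fin.prod_univ_three, hz, hb]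
          have hV : mon Γ.V x = 0 := by simp [hΓ, chartIITwo, mon, Fin.prod_univ_three, h0, ha]
          simp [eval_mon, hU, hV]
      rw [Γ.eval_pderiv_poly, hprod, eval_pderiv_mon, eval_pderiv_mon]
      simp [hΓ, chartIITwo, mon, Fin.prod_univ_three, hy]
    · by_cases hy : x 1 = 0
      · rw [hy, zero_pow hp, mul_zero, add_zero, neg_eq_zero] at hf
        obtain ⟨i, hi⟩ := exists_eq_of_prod_eq_zero hf
        have hz : x 2 ≠ 0 := by
          intro hz
          rw [hz, zero_pow hb] at hi
          exact h0 (by simpa [T.lam_ne_zero, ha] using hi.symm)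
        refine ⟨2, Γ.pderiv_ne_zero_of_factor (i := i)
          (by simpa [hΓ, chartIITwo, mon, Fin.prod_univ_three] using hi) ?_ ?_ ?_ ?_
          (eval_pderiv_mon_eq_zero (Or.inl ?_))⟩ <;>
          simp [hΓ, chartIITwo, mon, Fin.prod_univ_three, hz, hb]
      · refine ⟨1, Γ.pderiv_ne_zero_of_N ?_ ?_ ?_ ?_ ?_⟩ <;>
          simp [hΓ, chartIITwo, mon, Fin.prod_univ_three, h0, hy, hp]

end TypeIITwo

/-! ### The normal form of type IV -/

section TypeIV

variable {T : NormalForm} {a b p : ℕ}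

/-- The exponent vectors of the normal forms of type IV. -/
def chartIV
    (hpoly : T.poly = -(X 0 * ∏ i, (X 1 ^ b - C (T.lam i) * X 0 ^ a)) + X 1 * X 2 ^ p)
    (himage : T.image = ![X 0 ^ p * X 1, X 1 ^ (a * T.m + 1), X 0 * ∏ i : Fin T.m, X i.succ.succ])
    (h1 : T.alpha₁ = p * a) (h2 : T.alpha₂ + a = (a * T.m + 1) * b) (h3 : T.alpha₃ = p) :
    Chart T where
  M := ![1, 0, 0]
  U := ![0, b, 0]
  V := ![a, 0, 0]
  N := ![0, 1, p]
  γ := ![0, a, 0]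
  e := ![![p, 1, 0], ![0, a * T.m + 1, 0], ![1, 0, 1]]
  poly_eq := by simp [hpoly, mon, Fin.prod_univ_three]
  image_eq j := by fin_cases j <;> simp [himage, mon, Fin.prod_univ_three]
  U_e k := by
    fin_cases k
    · simp [Fin.sum_univ_three]
    · simp [Fin.sum_univ_three]
      rw [add_comm a, h2]; ring
    · simp [Fin.sum_univ_three]
  V_e k := by fin_cases k <;> simp [h1, Fin.sum_univ_three, mul_comm]
  N_e k := by
    fin_cases k
    · simp [Fin.sum_univ_three]
    · simp [Fin.sum_univ_three]; ring
    · simp [h3, Fin.sum_univ_three]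

lemma exists_chart_IV {D : Deformation 3} (hD : D.poly = T.poly) (hb : b ≠ 0) (hp : p ≠ 0)
    (hpoly : T.poly = -(X 0 * ∏ i, (X 1 ^ b - C (T.lam i) * X 0 ^ a)) + X 1 * X 2 ^ p)
    (himage : T.image = ![X 0 ^ p * X 1, X 1 ^ (a * T.m + 1), X 0 * ∏ i : Fin T.m, X i.succ.succ])
    (h1 : T.alpha₁ = p * a) (h2 : T.alpha₂ + a = (a * T.m + 1) * b) (h3 : T.alpha₃ = p) :
    ∃ Γ : Chart T, Γ.IsGood ∧ ∀ t : ℂˣ, Γ.Rel fun j => t ^ D.w j := by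
  set Γ := chartIV hpoly himage h1 h2 h3 with hΓ
  have hm := T.m_ne_zero
  have hUV := Γ.weight_U_eq_weight_V hD (j := 2) (by simp [hΓ, chartIV, hp])
    (by simp [hΓ, chartIV]) (by simp [hΓ, chartIV]) (by simp [hΓ, chartIV])
  have ha : a ≠ 0 := by
    rintro rfl
    simp [hΓ, chartIV, Fin.sum_univ_three, hb, (D.w_pos 1).ne'] at hUV
  have hN := Γ.weight_N_eq_degree hD hUV
  have hM := Γ.weight_M_add hD hUV (x := ![1, 0, 0])
    (by simp [hΓ, chartIV, mon, Fin.prod_univ_three])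
    (by simp [hΓ, chartIV, mon, Fin.prod_univ_three, hb, Finset.prod_ne_zero_iff, T.lam_ne_zero])
  have hα : 0 < T.alpha₂ := by
    have h0 : a * T.m + 1 ≤ (a * T.m + 1) * b :=
      Nat.le_mul_of_pos_right _ (Nat.pos_of_ne_zero hb)
    have : a ≤ a * T.m := Nat.le_mul_of_pos_right _ T.m_pos
    omega
  have hA : T.AlphaPos := by
    intro i
    rw [T.A_eq_block]
    generalize T.block i = k
    fin_cases k <;> simp [h1, hα, h3] <;> omega
  refine ⟨Γ, ⟨hA, ?_, ?_, ?_, ?_, ?_⟩, Γ.rel_of_weights hUV (hM.trans hN.symm)⟩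
  · intro k
    fin_cases k
    · refine ⟨2, rfl, fun τ hτ hj => ?_⟩
      have e1 := hj 1 rfl
      simp [Chart.Rel, hΓ, chartIV, mon, Fin.prod_univ_three, e1] at hτ
      refine ⟨by simp [h1, pow_mul, hτ.2, ← hτ.1], fun j => ?_⟩
      fin_cases j <;> simp [hΓ, chartIV, e1, hτ.2]
    · refine ⟨0, rfl, fun τ hτ hj => ?_⟩
      have e1 := hj 2 rfl
      simp [Chart.Rel, hΓ, chartIV, mon, Fin.prod_univ_three, e1] at hτ
      have e2 : τ 1 = τ 0 ^ (a * T.m + 1) := by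
        rw [hτ.2, hτ.1, ← pow_mul, pow_succ']
      have e3 : τ 0 ^ T.alpha₂ * τ 0 ^ a = 1 * τ 0 ^ a := by
        rw [← pow_add, h2, pow_mul, ← e2, hτ.1, one_mul]
      refine ⟨mul_right_cancel e3, fun j => ?_⟩
      fin_cases j
      · simp [hΓ, chartIV]
      · exact e2
      · simp [hΓ, chartIV, e1]
    · refine ⟨2, rfl, fun τ hτ hj => ?_⟩
      have e1 := hj 0 rfl
      have e2 := hj 1 rfl
      simp [Chart.Rel, hΓ, chartIV, mon, Fin.prod_univ_three, e1, e2] at hτ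
      refine ⟨by simpa [h3] using hτ, fun j => ?_⟩
      fin_cases j <;> simp [hΓ, chartIV, e1, e2]
  · intro k
    fin_cases k
    · exact ⟨1, rfl⟩
    · exact ⟨2, rfl⟩
    · exact ⟨0, rfl⟩
  · intro k hk
    fin_cases k
    · simp [hΓ, chartIV] at hk
    · refine ⟨by simp, fun l hl => ?_⟩
      have h0 := hl 0
      have h1 := hl 1
      fin_cases l <;> simp_all [chartIV]
    · simp [hΓ, chartIV] at hk
  all_goals
    intro x hx hf
    rw [Γ.eval_poly] at hf
    simp [hΓ, chartIV, mon, Fin.prod_univ_three] at hf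
    have hxz : x 1 = 0 → x 0 = 0 ∧ x 2 ≠ 0 := by
      intro hy
      have h0 : x 0 = 0 := by
        simp [hy, hb] at hf
        rcases hf with hf | hf
        · exact hf
        · obtain ⟨i, -, hi⟩ := Finset.prod_eq_zero_iff.mp hf
          simpa [T.lam_ne_zero, ha] using hi
      refine ⟨h0, fun hz => hx ?_⟩
      funext j
      fin_cases j <;> simp [h0, hz, hy]
  · by_cases hy : x 1 = 0
    · obtain ⟨h0, hz⟩ := hxz hy
      obtain ⟨c, hc, e0, e1, e2⟩ := exists_wpl_of_two hA (u := 1) (v := 0) (by simp)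
      have hP : ∏ i : Fin T.m, c i.succ.succ ≠ 0 := by
        intro h
        rw [h, h3, zero_pow hp, zero_pow hα.ne'] at e2
        obtain ⟨i, hi⟩ := exists_eq_of_prod_eq_zero e2.symm
        simp at hi
        exact T.lam_ne_zero i hi.symm
      refine ⟨c, hc, Or.inr ⟨2, hz, ?_, fun j hj => ?_⟩⟩
      · simpa [Chart.toCone, triple, hΓ, chartIV, mon, Fin.prod_univ_three, e0] using hP
      · fin_cases j
        · simp [Chart.toCone, triple, hΓ, chartIV, mon, Fin.prod_univ_three, e1, h0]
        · simp [Chart.toCone, triple, hΓ, chartIV, mon, Fin.prod_univ_three, e1, hy]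
        · simp at hj
    · obtain ⟨d, hd⟩ := IsAlgClosed.exists_pow_nat_eq (x 1) (Nat.succ_pos (a * T.m))
      have hd0 : d ≠ 0 := by
        rintro rfl
        rw [zero_pow (Nat.succ_ne_zero _)] at hd
        exact hy hd.symm
      obtain ⟨c, hc⟩ := IsAlgClosed.exists_pow_nat_eq (x 0 / d) (Nat.pos_of_ne_zero hp)
      have hcd : c ^ p * d = x 0 := by rw [hc, div_mul_cancel₀ _ hd0]
      obtain ⟨q, hq, e0, e1, e2⟩ := exists_wpl_of_two hA (u := c) (v := d) (Or.inr hd0)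
      rw [h1, h3] at e2
      have e3 : d ^ (a * T.m) * ∏ i, (d ^ T.alpha₂ - T.lam i * c ^ (p * a))
          = ∏ i, (x 1 ^ b - T.lam i * x 0 ^ a) := by
        rw [pow_mul, ← Fin.prod_const T.m, ← Finset.prod_mul_distrib]
        refine Finset.prod_congr rfl fun i _ => ?_
        rw [← hd, ← hcd, ← pow_mul, Nat.succ_eq_add_one, ← h2, mul_pow, pow_add, pow_mul]
        ring
      obtain ⟨ζ, hζ, hz⟩ := exists_root_of_unity (z := x 2)
        (q := c * ∏ i : Fin T.m, q i.succ.succ) hp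
        (by
          rw [mul_pow, e2]
          apply mul_left_cancel₀ hy
          rw [← e3] at hf
          nth_rw 1 [← hd]
          rw [pow_succ]
          linear_combination - hf +
            (d ^ (a * T.m) * ∏ i, (d ^ T.alpha₂ - T.lam i * c ^ (p * a))) * hcd)
      refine ⟨q, hq, Or.inl ⟨![1, 1, ζ], ?_, fun j => ?_⟩⟩
      · simp [Chart.Rel, hΓ, chartIV, mon, Fin.prod_univ_three, hζ]
      · fin_cases j
        · simp [Chart.toCone, triple, hΓ, chartIV, mon, Fin.prod_univ_three, e0, e1, hcd]
        · simpa [Chart.toCone, triple, hΓ, chartIV, mon, Fin.prod_univ_three, e1] using hd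
        · simp [Chart.toCone, triple, hΓ, chartIV, mon, Fin.prod_univ_three, e0, hz]
  · by_cases hy : x 1 = 0
    · obtain ⟨h0, hz⟩ := hxz hy
      refine ⟨1, ?_⟩
      have hM0 : mon Γ.M x = 0 := by simp [hΓ, chartIV, mon, Fin.prod_univ_three, h0]
      rw [Γ.eval_pderiv_poly, hM0, eval_pderiv_mon, eval_pderiv_mon]
      simp [hΓ, chartIV, mon, Fin.prod_univ_three, hz]
    · by_cases hz : x 2 = 0
      · rw [hz, zero_pow hp, mul_zero, add_zero, neg_eq_zero, mul_eq_zero] at hf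
        by_cases h0 : x 0 = 0
        · refine ⟨0, Γ.pderiv_ne_zero_of_M h0 ?_ ?_ (Or.inl ?_) (Or.inl ?_)
            (eval_pderiv_mon_eq_zero (Or.inl ?_))⟩ <;>
            simp [hΓ, chartIV, mon, Fin.prod_univ_three, h0, hy, ha]
        · obtain ⟨i, hi⟩ := exists_eq_of_prod_eq_zero (hf.resolve_left h0)
          refine ⟨1, Γ.pderiv_ne_zero_of_factor (i := i)
            (by simpa [hΓ, chartIV, mon, Fin.prod_univ_three] using hi) ?_ ?_ ?_ ?_
            (eval_pderiv_mon_eq_zero (Or.inr ⟨2, by decide, hz, ?_⟩))⟩ <;>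
            simp [hΓ, chartIV, mon, Fin.prod_univ_three, h0, hy, hb, hp]
      · refine ⟨2, Γ.pderiv_ne_zero_of_N ?_ ?_ ?_ ?_ ?_⟩ <;>
          simp [hΓ, chartIV, mon, Fin.prod_univ_three, hz, hy, hp]

end TypeIV

/-! ### The normal form of type V -/

section TypeV

variable {T : NormalForm} {p q r : ℕ}

lemma NormalForm.prod_fin_m {R : Type*} [CommMonoid R] (hm : T.m = 1) (g : Fin T.m → R) :
    ∏ i, g i = g ⟨0, T.m_pos⟩ := by
  refine Fintype.prod_eq_single _ fun i hi => absurd (Fin.ext ?_) hi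
  have := i.2
  simp
  omega

/-- The exponent vectors of the normal forms of type V. -/
def chartV (hm : T.m = 1)
    (hpoly : T.poly = -(X 0 * X 2 ^ r - X 1 ^ q * X 2) + X 0 ^ p * X 1)
    (himage : T.image = ![X 1 * (∏ i : Fin T.m, X i.succ.succ) ^ q,
      X 0 ^ r * ∏ i : Fin T.m, X i.succ.succ, X 0 * X 1 ^ p])
    (h1 : T.alpha₁ + r = q * r + 1) (h2 : T.alpha₂ + p = p * r + 1)
    (h3 : T.alpha₃ + q = p * q + 1) : Chart T where
  M := ![0, 0, 0]
  U := ![1, 0, r]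
  V := ![0, q, 1]
  N := ![p, 1, 0]
  γ := ![r, p, q]
  e := ![![0, 1, q], ![r, 0, 1], ![1, p, 0]]
  poly_eq := by
    rw [NormalForm.prod_fin_m hm, T.lam_first]
    simp [hpoly, mon, Fin.prod_univ_three]
  image_eq j := by fin_cases j <;> simp [himage, mon, Fin.prod_univ_three]
  U_e k := by
    fin_cases k
    · simp [Fin.sum_univ_three]
    · simp [Fin.sum_univ_three]; rw [add_comm p, h2]; ring
    · simp [Fin.sum_univ_three]
  V_e k := by
    fin_cases k
    · simp [Fin.sum_univ_three]; rw [add_comm r, h1]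
    · simp [Fin.sum_univ_three]
    · simp [Fin.sum_univ_three]
  N_e k := by
    fin_cases k
    · simp [Fin.sum_univ_three, hm]
    · simp [Fin.sum_univ_three, hm]
    · simp [Fin.sum_univ_three, hm]; rw [add_comm q, h3]

lemma exists_chart_V {D : Deformation 3} (hD : D.poly = T.poly) (hp : p ≠ 0) (hq : q ≠ 0)
    (hr : r ≠ 0) (hm : T.m = 1)
    (hpoly : T.poly = -(X 0 * X 2 ^ r - X 1 ^ q * X 2) + X 0 ^ p * X 1)
    (himage : T.image = ![X 1 * (∏ i : Fin T.m, X i.succ.succ) ^ q,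
      X 0 ^ r * ∏ i : Fin T.m, X i.succ.succ, X 0 * X 1 ^ p])
    (h1 : T.alpha₁ + r = q * r + 1) (h2 : T.alpha₂ + p = p * r + 1)
    (h3 : T.alpha₃ + q = p * q + 1) :
    ∃ Γ : Chart T, Γ.IsGood ∧ ∀ t : ℂˣ, Γ.Rel fun j => t ^ D.w j := by
  set Γ := chartV hm hpoly himage h1 h2 h3 with hΓ
  have hα1 : 0 < T.alpha₁ := by
    have : r ≤ q * r := Nat.le_mul_of_pos_left _ (Nat.pos_of_ne_zero hq)
    omega
  have hα2 : 0 < T.alpha₂ := by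
    have : p ≤ p * r := Nat.le_mul_of_pos_right _ (Nat.pos_of_ne_zero hr)
    omega
  have hα3 : 0 < T.alpha₃ := by
    have : q ≤ p * q := Nat.le_mul_of_pos_left _ (Nat.pos_of_ne_zero hp)
    omega
  have hA : T.AlphaPos := by
    intro i
    rw [T.A_eq_block]
    generalize T.block i = k
    fin_cases k <;> simpa
  have heval : ∀ x, eval x T.poly = -(x 0 * x 2 ^ r - x 1 ^ q * x 2) + x 0 ^ p * x 1 := by
    intro x; simp [hpoly]
  have hweight : ∀ x : Fin 3 → ℂ, eval (fun j => 2 ^ D.w j * x j) T.poly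
      = 2 ^ D.d * eval x T.poly := fun x => by
    rw [← hD]; exact eval_pow_weight x two_ne_zero
  simp only [heval] at hweight
  have hwU : D.w 0 + r * D.w 2 = D.d := by
    have := hweight ![1, 0, 1]
    simp [hq] at this
    apply eq_of_two_pow_eq
    rw [← this, pow_add, mul_comm r, pow_mul]
  have hwV : q * D.w 1 + D.w 2 = D.d := by
    have := hweight ![0, 1, 1]
    simp [hp] at this
    apply eq_of_two_pow_eq
    rw [← this, pow_add, mul_comm q, pow_mul]
  have hwN : p * D.w 0 + D.w 1 = D.d := by
    have := hweight ![1, 1, 0]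
    simp [hr] at this
    apply eq_of_two_pow_eq
    rw [← this, pow_add, mul_comm p, pow_mul]
  have hrel : ∀ t : ℂˣ, Γ.Rel fun j => t ^ D.w j := by
    refine Γ.rel_of_weights ?_ ?_
    · simp [hΓ, chartV, Fin.sum_univ_three, hwU, hwV]
    · simp [hΓ, chartV, Fin.sum_univ_three, hwU, hwN, hm]
  refine ⟨Γ, ⟨hA, ?_, ?_, ?_, ?_, ?_⟩, hrel⟩
  · intro k
    fin_cases k
    · refine ⟨2, rfl, fun τ hτ hj => ?_⟩
      have e1 := hj 0 rfl
      simp [Chart.Rel, hΓ, chartV, mon, Fin.prod_univ_three, e1, hm] at hτ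
      have e3 : τ 2 ^ T.alpha₁ * τ 2 ^ r = 1 * τ 2 ^ r := by
        rw [← pow_add, h1, one_mul, hτ.1, pow_succ, mul_comm q, pow_mul, hτ.2]
      refine ⟨mul_right_cancel e3, fun j => ?_⟩
      fin_cases j <;> simp [hΓ, chartV, e1, hτ.2]
    · refine ⟨0, rfl, fun τ hτ hj => ?_⟩
      have e1 := hj 1 rfl
      simp [Chart.Rel, hΓ, chartV, mon, Fin.prod_univ_three, e1, hm] at hτ
      have e2 : τ 2 = τ 0 ^ p := by rw [hτ.2, hτ.1]
      have e3 : τ 0 ^ T.alpha₂ * τ 0 ^ p = 1 * τ 0 ^ p := by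
        rw [← pow_add, h2, one_mul, hτ.2, pow_succ', pow_mul, ← e2]
      refine ⟨mul_right_cancel e3, fun j => ?_⟩
      fin_cases j <;> simp [hΓ, chartV, e1, e2]
    · refine ⟨1, rfl, fun τ hτ hj => ?_⟩
      have e1 := hj 2 rfl
      simp [Chart.Rel, hΓ, chartV, mon, Fin.prod_univ_three, e1, hm] at hτ
      have e3 : τ 1 ^ T.alpha₃ * τ 1 ^ q = 1 * τ 1 ^ q := by
        rw [← pow_add, h3, one_mul, ← hτ.1, pow_succ, mul_comm p, pow_mul, ← hτ.1, hτ.2]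
      refine ⟨mul_right_cancel e3, fun j => ?_⟩
      fin_cases j <;> simp [hΓ, chartV, e1, hτ.1]
  · intro k
    fin_cases k
    · exact ⟨0, rfl⟩
    · exact ⟨1, rfl⟩
    · exact ⟨2, rfl⟩
  · intro k _
    refine ⟨fun _ => hm, fun l hl => ?_⟩
    have e0 := hl 0
    have e1 := hl 1
    have e2 := hl 2
    fin_cases k <;> fin_cases l <;> simp_all [chartV]
  all_goals
    intro x hx hf
    rw [heval] at hf
    -- a point on a coordinate hyperplane lies on a coordinate axis
    have hax : (∃ j, x j = 0) → ∃ j₀, ∀ j, j ≠ j₀ → x j = 0 := by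
      rintro ⟨j, hj⟩
      fin_cases j
      · simp at hj
        simp [hj, hp, hq] at hf
        rcases hf with hf | hf
        · refine ⟨2, fun j hj' => ?_⟩
          fin_cases j <;> simp_all
        · refine ⟨1, fun j hj' => ?_⟩
          fin_cases j <;> simp_all
      · simp at hj
        simp [hj, hr, hq] at hf
        rcases hf with hf | hf
        · refine ⟨2, fun j hj' => ?_⟩
          fin_cases j <;> simp_all
        · refine ⟨0, fun j hj' => ?_⟩
          fin_cases j <;> simp_all
      · simp at hj
        simp [hj, hp, hr] at hf
        rcases hf with hf | hf
        · refine ⟨1, fun j hj' => ?_⟩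
          fin_cases j <;> simp_all
        · refine ⟨0, fun j hj' => ?_⟩
          fin_cases j <;> simp_all
    have hne : ∀ j₀, (∀ j, j ≠ j₀ → x j = 0) → x j₀ ≠ 0 := by
      intro j₀ h h0
      apply hx
      funext j
      by_cases hj : j = j₀
      · rw [hj, h0]; rfl
      · exact h j hj
  · by_cases h0 : ∃ j, x j = 0
    · obtain ⟨j₀, hj₀⟩ := hax h0
      have hb : ∃ b ∈ wplCone T, triple b j₀ = 0 := by
        have key : ∀ i : Fin (T.m + 2), ∀ u v : ℂ, (u ≠ 0 ∨ v ≠ 0) → T.lin i u v = 0 →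
            ∃ b ∈ wplCone T, triple b (T.block i) = 0 := by
          intro i u v huv hl
          obtain ⟨b, hb, hu, hv⟩ := NormalForm.exists_wpl_point hA huv
          refine ⟨b, hb, NormalForm.triple_eq_zero_iff.mpr ⟨i, rfl, ?_⟩⟩
          rw [← NormalForm.lin_eq_zero_iff hA hb, hu, hv, hl]
        fin_cases j₀
        · exact key 0 0 1 (by simp) rfl
        · exact key 1 1 0 (by simp) rfl
        · refine key (⟨0, T.m_pos⟩ : Fin T.m).succ.succ 1 1 (by simp) ?_
          rw [NormalForm.lin_succ_succ, T.lam_first]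
          ring
      obtain ⟨b, hb, hbj⟩ := hb
      have hz : ∀ j, Γ.toCone b j = 0 ↔ j ≠ j₀ := by
        intro j
        rw [Chart.toCone_eq_zero_iff_of_zero hA hb hbj]
        fin_cases j <;> fin_cases j₀ <;> simp [hΓ, chartV, hp, hq, hr]
      exact ⟨b, hb, Or.inr ⟨j₀, hne j₀ hj₀, fun h => (hz j₀).mp h rfl,
        fun j hj => ⟨hj₀ j hj, (hz j).mpr hj⟩⟩⟩
    · push Not at h0
      have hU : mon Γ.U x = x 0 * x 2 ^ r := by simp [hΓ, chartV, mon, Fin.prod_univ_three]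
      have hV : mon Γ.V x = x 1 ^ q * x 2 := by simp [hΓ, chartV, mon, Fin.prod_univ_three]
      have hN : mon Γ.N x = x 0 ^ p * x 1 := by simp [hΓ, chartV, mon, Fin.prod_univ_three]
      have hx0 : ∀ u : Fin 3 → ℕ, mon u x ≠ 0 := fun u h => by
        obtain ⟨k, hk, -⟩ := mon_eq_zero_iff.mp h
        exact h0 k hk
      obtain ⟨b, hb, hu, hv⟩ := NormalForm.exists_wpl_point hA (Or.inl (hx0 Γ.V) :
        mon Γ.V x ≠ 0 ∨ mon Γ.U x ≠ 0)
      have hw : (∏ i : Fin T.m, b i.succ.succ) ^ T.alpha₃ = mon Γ.N x := by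
        have := NormalForm.wplEquation_iff.mp hb.2 (⟨0, T.m_pos⟩ : Fin T.m).succ.succ
        rw [NormalForm.prod_fin_m hm, ← T.A_succ_succ ⟨0, T.m_pos⟩, this, hu, hv,
          NormalForm.lin_succ_succ, T.lam_first, hU, hV, hN]
        linear_combination - hf
      have ht : ∀ k, triple b k ≠ 0 := by
        intro k hk
        fin_cases k
        · have : b 0 = 0 := hk
          rw [this, zero_pow hα1.ne'] at hu
          exact hx0 _ hu.symm
        · have : b 1 = 0 := hk
          rw [this, zero_pow hα2.ne'] at hv
          exact hx0 _ hv.symm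
        · have : ∏ i : Fin T.m, b i.succ.succ = 0 := hk
          rw [this, zero_pow hα3.ne'] at hw
          exact hx0 _ hw.symm
      have hb0 : ∀ j, Γ.toCone b j ≠ 0 := fun j h => by
        obtain ⟨k, hk, -⟩ := Chart.toCone_eq_zero_iff.mp h
        exact ht k hk
      have hγ : mon Γ.γ (triple b) ≠ 0 := fun h => by
        obtain ⟨k, hk, -⟩ := mon_eq_zero_iff.mp h
        exact ht k hk
      let τ : Fin 3 → ℂˣ := fun j => Units.mk0 (Γ.toCone b j / x j) (div_ne_zero (hb0 j) (h0 j))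
      have hτ : ∀ j, Γ.toCone b j = τ j * x j := fun j => by
        simp [τ, div_mul_cancel₀ _ (h0 j)]
      have hc : ∀ u : Fin 3 → ℕ, ((mon u τ : ℂˣ) : ℂ) * mon u x = mon u (Γ.toCone b) := by
        intro u
        rw [funext hτ, mon_mul]
        congr 1
      have eU : ((mon Γ.U τ : ℂˣ) : ℂ) = mon Γ.γ (triple b) := by
        apply mul_right_cancel₀ (hx0 Γ.U)
        rw [hc]
        unfold Chart.toCone
        rw [Γ.mon_U_e, ← hv]
        rfl
      have eV : ((mon Γ.V τ : ℂˣ) : ℂ) = mon Γ.γ (triple b) := by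
        apply mul_right_cancel₀ (hx0 Γ.V)
        rw [hc]
        unfold Chart.toCone
        rw [Γ.mon_V_e, ← hu]
        rfl
      have hM1 : ∀ {R : Type} [CommMonoid R] (y : Fin 3 → R), mon Γ.M y = 1 := by
        intro R _ y
        simp [hΓ, chartV, mon, Fin.prod_univ_three]
      have eN : ((mon Γ.N τ : ℂˣ) : ℂ) = mon Γ.γ (triple b) := by
        apply mul_right_cancel₀ (hx0 Γ.N)
        rw [hc]
        unfold Chart.toCone
        have hpow : ∀ g : ℂ, g ^ T.m = g := fun g => by rw [hm, pow_one]
        rw [Γ.mon_N_e, hM1, one_mul, hpow, ← hw]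
        rfl
      refine ⟨b, hb, Or.inl ⟨τ, ⟨Units.ext (eU.trans eV.symm), Units.ext ?_⟩, hτ⟩⟩
      rw [hM1, one_mul, hm, pow_one, eN, eU]
  · have hd : ∀ j, eval x (pderiv j T.poly) = -eval x (pderiv j (mon Γ.U X))
        + eval x (pderiv j (mon Γ.V X)) + eval x (pderiv j (mon Γ.N X)) := by
      intro j
      have : T.poly = -(mon Γ.U X) + mon Γ.V X + mon Γ.N X := by
        rw [hpoly]
        simp [hΓ, chartV, mon, Fin.prod_univ_three]
        ring
      simp [this]
    by_cases h0 : ∃ j, x j = 0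
    · obtain ⟨j₀, hj₀⟩ := hax h0
      have h1 := hne j₀ hj₀
      fin_cases j₀
      · refine ⟨1, ?_⟩
        have e1 : x 1 = 0 := hj₀ 1 (by decide)
        have e2 : x 2 = 0 := hj₀ 2 (by decide)
        rw [hd, eval_pderiv_mon_eq_zero (u := Γ.U) (Or.inl rfl),
          eval_pderiv_mon_eq_zero (u := Γ.V) (Or.inr ⟨2, by decide, e2, one_ne_zero⟩),
          eval_pderiv_mon]
        simpa [hΓ, chartV, mon, Fin.prod_univ_three] using fun h => absurd h h1
      · refine ⟨2, ?_⟩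
        have e1 : x 0 = 0 := hj₀ 0 (by decide)
        rw [hd, eval_pderiv_mon_eq_zero (u := Γ.U) (Or.inr ⟨0, by decide, e1, one_ne_zero⟩),
          eval_pderiv_mon_eq_zero (u := Γ.N) (Or.inl rfl), eval_pderiv_mon]
        simpa [hΓ, chartV, mon, Fin.prod_univ_three] using fun h => absurd h h1
      · refine ⟨0, ?_⟩
        have e1 : x 1 = 0 := hj₀ 1 (by decide)
        rw [hd, eval_pderiv_mon_eq_zero (u := Γ.V) (Or.inl rfl),
          eval_pderiv_mon_eq_zero (u := Γ.N) (Or.inr ⟨1, by decide, e1, one_ne_zero⟩),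
          eval_pderiv_mon]
        simpa [hΓ, chartV, mon, Fin.prod_univ_three] using fun h => absurd h h1
    · push Not at h0
      by_contra! hcon
      -- the three Euler relations force `U = - p q r U`
      have e0 := hcon 0
      have e1 := hcon 1
      have e2 := hcon 2
      rw [hd, eval_pderiv_mon, eval_pderiv_mon, eval_pderiv_mon] at e0 e1 e2
      obtain ⟨p, rfl⟩ := Nat.exists_eq_succ_of_ne_zero hp
      obtain ⟨q, rfl⟩ := Nat.exists_eq_succ_of_ne_zero hq
      obtain ⟨r, rfl⟩ := Nat.exists_eq_succ_of_ne_zero hr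
      simp [hΓ, chartV, mon, Fin.prod_univ_three] at e0 e1 e2
      have hU : x 0 * x 2 ^ (r + 1) ≠ 0 := mul_ne_zero (h0 0) (pow_ne_zero _ (h0 2))
      have f0 : x 0 * x 2 ^ (r + 1) = (p + 1) * (x 0 ^ (p + 1) * x 1) := by
        rw [pow_succ (x 0)]
        linear_combination - x 0 * e0
      have f1 : x 0 ^ (p + 1) * x 1 = - (q + 1) * (x 1 ^ (q + 1) * x 2) := by
        rw [pow_succ (x 1)]
        linear_combination x 1 * e1
      have f2 : x 1 ^ (q + 1) * x 2 = (r + 1) * (x 0 * x 2 ^ (r + 1)) := by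
        rw [pow_succ (x 2)]
        linear_combination x 2 * e2
      have f3 : ((1 + (p + 1) * (q + 1) * (r + 1) : ℕ) : ℂ) * (x 0 * x 2 ^ (r + 1)) = 0 := by
        push_cast
        linear_combination f0 + (p + 1) * f1 - (p + 1) * (q + 1) * f2
      rcases mul_eq_zero.mp f3 with h | h
      · exact absurd (Nat.cast_eq_zero.mp h) (by omega)
      · exact hU h

end TypeV

/-! ### The orbits of an arbitrary normal form -/

/-- Every normal form has a good chart, and its weights make the `ℂ^*`-action one by diagonal
symmetries. The exponents that are quotients by `m` are replaced by independent numbers `a` and `b`,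
so that all identities between them become polynomial. -/
lemma exists_chart {T : NormalForm} {D : Deformation 3} (hD : D.poly = T.poly) :
    ∃ Γ : Chart T, Γ.IsGood ∧ ∀ t : ℂˣ, Γ.Rel fun j => t ^ D.w j := by
  have hdiv := T.divisibility
  have hm := T.m_pos
  have h1 := T.p₁_pos
  have h2 := T.p₂_pos
  have h3 := T.p₃_pos
  cases h : T.type
  · simp only [h] at hdiv
    exact exists_chart_I (a := T.p₁ / T.m) (b := T.p₂ / T.m) (p := T.p₃) hD
      (Nat.div_pos (Nat.le_of_dvd h1 hdiv.1) hm).ne' (Nat.div_pos (Nat.le_of_dvd h2 hdiv.2) hm).ne'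
      (by omega) (by simp [NormalForm.poly, h]) (by simp [NormalForm.image, h])
      (by simp [NormalForm.alpha₁, h]) (by simp [NormalForm.alpha₂, h])
      (by simp [NormalForm.alpha₃, h])
  · simp only [h] at hdiv
    exact exists_chart_IIOne (a := (T.p₁ - 1) / T.m) (b := T.p₂ / T.m) (p := T.p₃) hD
      (Nat.div_pos (Nat.le_of_dvd h2 hdiv.2) hm).ne'
      (by omega) (by simp [NormalForm.poly, h]) (by simp [NormalForm.image, h])
      (by simp [NormalForm.alpha₁, h]) (by simp [NormalForm.alpha₂, h])
      (by simp [NormalForm.alpha₃, h])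
  · simp only [h] at hdiv
    have e1 := Nat.div_mul_cancel hdiv.1
    have e3 := Nat.div_mul_cancel hdiv.2
    refine exists_chart_IITwo (a := T.p₁ / T.m) (b := T.p₃ / T.m) (p := T.p₂) hD
      (Nat.div_pos (Nat.le_of_dvd h1 hdiv.1) hm).ne' (Nat.div_pos (Nat.le_of_dvd h3 hdiv.2) hm).ne'
      (by omega) (by simp [NormalForm.poly, h]) (by simp [NormalForm.image, h, e3])
      ?_ (by simp [NormalForm.alpha₂, h]) (by simp [NormalForm.alpha₃, h])
    simp only [NormalForm.alpha₁, h, e1]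
    conv_rhs => rw [← Nat.sub_add_cancel h1]
    rw [mul_add, mul_one]
  · simp only [h] at hdiv
    exact exists_chart_III (a := (T.p₁ - 1) / T.m) (b := (T.p₂ - 1) / T.m) (p := T.p₃) hD
      (by omega) (by simp [NormalForm.poly, h]) (by simp [NormalForm.image, h])
      (by simp [NormalForm.alpha₁, h]) (by simp [NormalForm.alpha₂, h])
      (by simp [NormalForm.alpha₃, h])
  · simp only [h] at hdiv
    obtain ⟨a, ha⟩ := hdiv.1
    obtain ⟨b, hb⟩ := hdiv.2
    have hp1 : T.p₁ = a * T.m + 1 := by rw [mul_comm a]; omega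
    have ha' : (T.p₁ - 1) / T.m = a := by rw [ha, Nat.mul_div_cancel_left _ hm]
    have hb' : T.p₂ / T.m = b := by rw [hb, Nat.mul_div_cancel_left _ hm]
    have hb0 : b ≠ 0 := by
      rintro rfl
      omega
    refine exists_chart_IV (a := a) (b := b) (p := T.p₃) hD hb0
      (by omega) (by simp [NormalForm.poly, h, ha', hb']) (by simp [NormalForm.image, h, hp1])
      (by simp [NormalForm.alpha₁, h, ha']) ?_ (by simp [NormalForm.alpha₃, h])
    -- `p₁ p₂ - p₁ + 1 = m (p₁ b - a)`
    have hle : a ≤ T.p₁ * b := by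
      have h4 : a ≤ a * T.m := Nat.le_mul_of_pos_right _ hm
      have h5 : T.p₁ ≤ T.p₁ * b := Nat.le_mul_of_pos_right _ (Nat.pos_of_ne_zero hb0)
      omega
    have hα : T.p₁ * T.p₂ - T.p₁ + 1 = T.m * (T.p₁ * b - a) := by
      have h4 : T.p₁ ≤ T.p₁ * T.p₂ := Nat.le_mul_of_pos_right _ h2
      zify [h4, hle]
      rw [hb, hp1]
      push_cast
      ring
    simp only [NormalForm.alpha₂, h]
    rw [hα, Nat.mul_div_cancel_left _ hm, Nat.sub_add_cancel hle, hp1]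
  · simp only [h] at hdiv
    have h4 : T.p₃ ≤ T.p₂ * T.p₃ := Nat.le_mul_of_pos_left _ h2
    have h5 : T.p₁ ≤ T.p₁ * T.p₃ := Nat.le_mul_of_pos_right _ h3
    have h6 : T.p₂ ≤ T.p₁ * T.p₂ := Nat.le_mul_of_pos_left _ h1
    refine exists_chart_V (p := T.p₁) (q := T.p₂) (r := T.p₃) hD (by omega) (by omega) (by omega)
      hdiv ?_ (by simp [NormalForm.image, h]) ?_ ?_ ?_
    · simp only [NormalForm.poly, h]
      obtain ⟨r, hr⟩ := Nat.exists_eq_succ_of_ne_zero (show T.p₃ ≠ 0 by omega)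
      rw [hr, Nat.succ_sub_one, pow_succ]
      ring
    · simp only [NormalForm.alpha₁, h]
      omega
    · simp only [NormalForm.alpha₂, h]
      omega
    · simp only [NormalForm.alpha₃, h]
      omega

/-! ### Coordinate changes -/

/-- The chain rule. -/
lemma pderiv_algHom {n : ℕ} (ψ : MvPolynomial (Fin n) ℂ →ₐ[ℂ] MvPolynomial (Fin n) ℂ)
    (p : MvPolynomial (Fin n) ℂ) (j : Fin n) :
    pderiv j (ψ p) = ∑ k, ψ (pderiv k p) * pderiv j (ψ (X k)) := by
  induction p using MvPolynomial.induction_on with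
  | C a => simp [← algebraMap_eq]
  | add p q hp hq => simp only [map_add, hp, hq, add_mul, Finset.sum_add_distrib]
  | mul_X p i hp =>
    have h1 : ∀ k, ψ (pderiv k (p * X i)) * pderiv j (ψ (X k))
        = ψ (pderiv k p) * pderiv j (ψ (X k)) * ψ (X i)
          + if k = i then ψ p * pderiv j (ψ (X k)) else 0 := by
      intro k
      rw [pderiv_mul, map_add, map_mul, map_mul]
      by_cases hk : k = i
      · subst hk
        rw [pderiv_X_self, if_pos rfl, map_one]
        ring
      · rw [pderiv_X_of_ne (Ne.symm hk), if_neg hk, map_zero]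
        ring
    rw [Finset.sum_congr rfl fun k _ => h1 k, Finset.sum_add_distrib, ← Finset.sum_mul, ← hp,
      Finset.sum_ite_eq' Finset.univ i, if_pos (Finset.mem_univ i), map_mul, pderiv_mul]

/-- The structure of the orbits is invariant under weighted homogeneous changes of coordinates. -/
lemma IsOrbifoldSphere.of_algEquiv {w w₀ : Fin 3 → ℕ} {f f₀ : MvPolynomial (Fin 3) ℂ} {r : ℕ}
    {A : Fin r → ℕ} {P : Fin r → (Fin 3 → ℂ) → Prop} (h : IsOrbifoldSphere w₀ f₀ A P)
    (φ : MvPolynomial (Fin 3) ℂ ≃ₐ[ℂ] MvPolynomial (Fin 3) ℂ)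
    (hφ : ∀ j, IsWeightedHomogeneous w (φ (X j)) (w₀ j)) (hw₀ : ∀ j, 0 < w₀ j) (hf : φ f₀ = f) :
    IsOrbifoldSphere w f A fun i c => P i fun j => eval c (φ (X j)) := by
  let Φ : (Fin 3 → ℂ) → Fin 3 → ℂ := fun c j => eval c (φ (X j))
  let Ψ : (Fin 3 → ℂ) → Fin 3 → ℂ := fun c j => eval c (φ.symm (X j))
  have hev : ∀ (ψ : MvPolynomial (Fin 3) ℂ ≃ₐ[ℂ] MvPolynomial (Fin 3) ℂ) (c : Fin 3 → ℂ) p,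
      eval (fun j => eval c (ψ (X j))) p = eval c (ψ p) := by
    intro ψ c p
    induction p using MvPolynomial.induction_on with
    | C a => rw [eval_C, ← algebraMap_eq, ψ.commutes, algebraMap_eq, eval_C]
    | add p q hp hq => simp only [map_add, hp, hq]
    | mul_X p i hp => simp only [map_mul, hp, eval_X]
  have hΦ : ∀ c p, eval (Φ c) p = eval c (φ p) := hev φ
  have hΨ : ∀ c p, eval (Ψ c) p = eval c (φ.symm p) := hev φ.symm
  have hΦΨ : ∀ c, Φ (Ψ c) = c := fun c => funext fun j => by
    simp only [Φ]
    rw [hΨ, φ.symm_apply_apply, eval_X]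
  have hΨΦ : ∀ c, Ψ (Φ c) = c := fun c => funext fun j => by
    simp only [Ψ]
    rw [hΦ, φ.apply_symm_apply, eval_X]
  have hcont : Continuous Φ := continuous_pi fun j => (φ (X j)).continuous_eval
  have hcont' : Continuous Ψ := continuous_pi fun j => (φ.symm (X j)).continuous_eval
  have hact : ∀ t c, Φ (act (fun j => (w j : ℤ)) t c) = act (fun j => (w₀ j : ℤ)) t (Φ c) := by
    intro t c
    funext j
    have hj : IsWeightedHomogeneous (fun j => (w j : ℤ)) (φ (X j)) (w₀ j : ℤ) := by
      intro s hs
      rw [← hφ j hs, Finsupp.weight_apply, Finsupp.weight_apply,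
        Finsupp.sum_fintype _ _ (by simp), Finsupp.sum_fintype _ _ (by simp)]
      push_cast
      simp
    exact eval_act hj t c
  have hact' : ∀ t c, Ψ (act (fun j => (w₀ j : ℤ)) t c) = act (fun j => (w j : ℤ)) t (Ψ c) := by
    intro t c
    rw [← hΦΨ c, ← hact, hΨΦ, hΨΦ]
  have hΦ0 : Φ 0 = 0 := by
    funext j
    by_contra hne
    exact (hw₀ j).ne' (degree_eq_of_eval_zero_ne_zero (hφ j) hne)
  have hΨ0 : Ψ 0 = 0 := by rw [← hΦ0, hΨΦ, hΦ0]
  have hmem : ∀ c ∈ puncturedCone (fun _ : Fin 1 => f), Φ c ∈ puncturedCone (fun _ : Fin 1 => f₀) :=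
    fun c hc => ⟨fun h0 => hc.1 (by rw [← hΨΦ c, h0, hΨ0]), fun k => by
      rw [hΦ, hf]; exact hc.2 k⟩
  have hmem' : ∀ c ∈ puncturedCone (fun _ : Fin 1 => f₀),
      Ψ c ∈ puncturedCone (fun _ : Fin 1 => f) :=
    fun c hc => ⟨fun h0 => hc.1 (by rw [← hΦΨ c, h0, hΦ0]), fun k => by
      rw [hΨ, ← hf, φ.symm_apply_apply]; exact hc.2 k⟩
  refine ⟨fun x hx hx' => ?_, ?_, ?_⟩
  · obtain ⟨k, hk⟩ := h.smooth (Φ x) (fun h0 => hx (by rw [← hΨΦ x, h0, hΨ0]))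
      (by rw [hΦ, hf, hx'])
    by_contra! hcon
    apply hk
    have e : f₀ = φ.symm f := by rw [← hf, φ.symm_apply_apply]
    have := pderiv_algHom (φ.symm : MvPolynomial (Fin 3) ℂ →ₐ[ℂ] MvPolynomial (Fin 3) ℂ) f k
    rw [e]
    refine (congrArg (eval (Φ x)) this).trans ?_
    rw [map_sum]
    refine Finset.sum_eq_zero fun j _ => ?_
    rw [map_mul]
    have h1 : eval (Φ x) (φ.symm (pderiv j f)) = 0 := by
      rw [hΦ, φ.apply_symm_apply, hcon]
    exact mul_eq_zero_of_left h1 _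
  · obtain ⟨e⟩ := h.sphere
    let g : Quotient (orbitSetoid (fun j => (w j : ℤ)) fun _ : Fin 1 => f) →
        Quotient (orbitSetoid (fun j => (w₀ j : ℤ)) fun _ : Fin 1 => f₀) :=
      Quotient.map (fun x => ⟨Φ x.1, hmem _ x.2⟩) fun x y ⟨t, ht⟩ =>
        ⟨t, (hact t x.1).symm.trans (congrArg Φ ht)⟩
    let g' : Quotient (orbitSetoid (fun j => (w₀ j : ℤ)) fun _ : Fin 1 => f₀) →
        Quotient (orbitSetoid (fun j => (w j : ℤ)) fun _ : Fin 1 => f) :=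
      Quotient.map (fun x => ⟨Ψ x.1, hmem' _ x.2⟩) fun x y ⟨t, ht⟩ =>
        ⟨t, (hact' t x.1).symm.trans (congrArg Ψ ht)⟩
    refine ⟨Homeomorph.trans ⟨⟨g, g', ?_, ?_⟩, ?_, ?_⟩ e⟩
    · intro q
      induction q using Quotient.inductionOn with
      | h x => exact congrArg (Quotient.mk _) (Subtype.ext (hΨΦ x.1))
    · intro q
      induction q using Quotient.inductionOn with
      | h x => exact congrArg (Quotient.mk _) (Subtype.ext (hΦΨ x.1))
    · exact Continuous.quotient_map' (s := orbitSetoid _ _) (t := orbitSetoid _ _)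
        ((hcont.comp continuous_subtype_val).subtype_mk _)
        fun x y ⟨t, ht⟩ => ⟨t, (hact t x.1).symm.trans (congrArg Φ ht)⟩
    · exact Continuous.quotient_map' (s := orbitSetoid _ _) (t := orbitSetoid _ _)
        ((hcont'.comp continuous_subtype_val).subtype_mk _)
        fun x y ⟨t, ht⟩ => ⟨t, (hact' t x.1).symm.trans (congrArg Ψ ht)⟩
  · obtain ⟨O, h1, h2, h3, h4⟩ := h.orbits
    refine ⟨fun i => ⟨Ψ (O i), hmem' _ (O i).2⟩, ?_, ?_, ?_, ?_⟩
    · intro i j t ht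
      apply h1 i j t
      have := congrArg Φ ht
      rwa [hact, hΦΨ, hΦΨ] at this
    · intro i
      rw [← h2 i]
      refine Nat.card_congr (Equiv.subtypeEquivRight fun t => ?_)
      show act _ t (Ψ (O i)) = Ψ (O i) ↔ _
      rw [← hact']
      exact ⟨fun h => by rw [← hΦΨ (act _ _ _), h, hΦΨ], fun h => by rw [h]⟩
    · intro x hx t ht
      refine h3 ⟨Φ x, hmem _ x.2⟩ (fun i s hs => hx i s ?_) t ?_
      · show act _ s (Ψ (O i)) = x
        rw [← hact', hs, hΨΦ]
      · show act _ t (Φ x) = Φ x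
        rw [← hact, ht]
    · intro i c hc
      obtain ⟨t, ht⟩ := h4 i _ hc
      refine ⟨t, ?_⟩
      show act _ t (Ψ (O i)) = c
      rw [← hact', ht]
      exact hΨΦ c

/-- The orbits of a polynomial with given Dolgachev numbers. -/
theorem DolgachevData.isOrbifoldSphere {D : Deformation 3} (T : DolgachevData D) :
    IsOrbifoldSphere D.w D.poly T.form.A T.OnExceptionalOrbit := by
  obtain ⟨Γ, hΓ, hw⟩ := exists_chart T.poly_eq
  have h := hΓ.isOrbifoldSphere T.poly_eq T.grading hw
  rw [T.poly_eq] at h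
  exact h.of_algEquiv T.change T.change_homog T.D₀.w_pos T.change_poly

/-! ### The complete intersection attached to a Koszul matrix factorization -/

/-- The components of the gradients at the origin of weighted homogeneous polynomials: if `P₁, P₂`
are independent and `a H₁ + b H₂ = w (a P₂ - b P₁)` where the weights of `H₁, H₂` exceed those of
`P₂, P₁` by the same positive amount, then `a = b = 0`. -/
lemma eq_zero_of_weighted_relation {u : Fin 3 → ℤ} {l₁ l₂ e : ℤ} (he : 0 < e)
    {P₁ P₂ H₁ H₂ : Fin 3 → ℂ} (hP₁ : ∀ j, P₁ j ≠ 0 → u j = l₁) (hP₂ : ∀ j, P₂ j ≠ 0 → u j = l₂)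
    (hH₁ : ∀ j, H₁ j ≠ 0 → u j = e + l₂) (hH₂ : ∀ j, H₂ j ≠ 0 → u j = e + l₁)
    (hind : ∀ a b : ℂ, (∀ j, a * P₁ j + b * P₂ j = 0) → a = 0 ∧ b = 0) {w a b : ℂ} (hw : w ≠ 0)
    (h : ∀ j, a * (H₁ j - w * P₂ j) + b * (H₂ j + w * P₁ j) = 0) : a = 0 ∧ b = 0 := by
  have hz : ∀ {f : Fin 3 → ℂ} {l : ℤ} {j}, (∀ j, f j ≠ 0 → u j = l) → u j ≠ l → f j = 0 := by
    intro f l j hf hj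
    by_contra h0
    exact hj (hf j h0)
  have step₁ : l₁ ≤ l₂ → ∀ j, u j = l₁ → a * P₂ j = b * P₁ j := by
    intro hl j hj
    have h1 : H₁ j = 0 := hz hH₁ (by omega)
    have h2 : H₂ j = 0 := hz hH₂ (by omega)
    have := h j
    rw [h1, h2] at this
    apply mul_left_cancel₀ hw
    linear_combination - this
  have step₂ : l₂ ≤ l₁ → ∀ j, u j = l₂ → a * P₂ j = b * P₁ j := by
    intro hl j hj
    have h1 : H₁ j = 0 := hz hH₁ (by omega)
    have h2 : H₂ j = 0 := hz hH₂ (by omega)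
    have := h j
    rw [h1, h2] at this
    apply mul_left_cancel₀ hw
    linear_combination - this
  rcases lt_trichotomy l₁ l₂ with hl | hl | hl
  · have hb : b = 0 := by
      refine (hind b 0 fun j => ?_).1
      by_cases hj : u j = l₁
      · rw [← step₁ hl.le j hj, hz hP₂ (by omega)]; ring
      · rw [hz hP₁ hj]; ring
    subst hb
    refine ⟨(hind 0 a fun j => ?_).2, rfl⟩
    by_cases hj : u j = l₂
    · have h1 : H₁ j = 0 := hz hH₁ (by omega)
      have := h j
      rw [h1] at this
      apply mul_left_cancel₀ hw
      linear_combination - this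
    · rw [hz hP₂ hj]; ring
  · have := hind (-b) a fun j => by
      by_cases hj : u j = l₁
      · linear_combination step₁ hl.le j hj
      · rw [hz hP₁ hj, hz hP₂ (by omega)]; ring
    exact ⟨this.2, neg_eq_zero.mp this.1⟩
  · have ha : a = 0 := by
      refine (hind 0 a fun j => ?_).2
      by_cases hj : u j = l₂
      · rw [step₂ hl.le j hj, hz hP₁ (by omega)]; ring
      · rw [hz hP₂ hj]; ring
    subst ha
    refine ⟨rfl, (hind b 0 fun j => ?_).1⟩
    by_cases hj : u j = l₁
    · have h1 : H₂ j = 0 := hz hH₂ (by omega)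
      have := h j
      rw [h1] at this
      apply mul_left_cancel₀ hw
      linear_combination this
    · rw [hz hP₁ hj]; ring

lemma isWeightedHomogeneous_rename_succ {n : ℕ} {v : Fin (n + 1) → ℤ} {p : MvPolynomial (Fin n) ℂ}
    {e : ℤ} (hp : IsWeightedHomogeneous (fun j => v j.succ) p e) :
    IsWeightedHomogeneous v (rename Fin.succ p) e := by
  intro s hs
  obtain ⟨u, rfl, hu⟩ := coeff_rename_ne_zero _ _ _ hs
  rw [← hp hu, Finsupp.weight_apply, Finsupp.weight_apply,
    Finsupp.sum_mapDomain_index (by simp) (by intros; rw [add_smul])]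

lemma pderiv_zero_rename_succ {n : ℕ} (p : MvPolynomial (Fin n) ℂ) :
    pderiv 0 (rename Fin.succ p) = 0 := by
  refine pderiv_eq_zero_of_notMem_vars fun h => ?_
  classical
  obtain ⟨j, -, hj⟩ := Finset.mem_image.mp (vars_rename _ _ h)
  exact Fin.succ_ne_zero j hj

namespace KoszulData

variable {D : Deformation 3} (K : KoszulData D)

lemma eval_equations_zero (y : Fin 4 → ℂ) : eval y (K.equations 0)
    = eval (fun j => y j.succ) K.h₁ - y 0 * eval (fun j => y j.succ) K.p₂ := by
  simp [equations, eval_rename, Function.comp_def]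

lemma eval_equations_one (y : Fin 4 → ℂ) : eval y (K.equations 1)
    = eval (fun j => y j.succ) K.h₂ + y 0 * eval (fun j => y j.succ) K.p₁ := by
  simp [equations, eval_rename, Function.comp_def]

lemma isWeightedHomogeneous_equations (hL : Nonempty (D.L ≃+ ℤ)) (k : Fin 2) :
    IsWeightedHomogeneous K.weights (K.equations k) (D.deg (D.fvec - ![K.l₁, K.l₂] k)) := by
  have hX : IsWeightedHomogeneous K.weights (X 0 : MvPolynomial (Fin 4) ℂ)
      (D.deg (D.fvec - K.l₁ - K.l₂)) := isWeightedHomogeneous_X ℂ K.weights 0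
  have hr : ∀ p l, D.IsHomog p l →
      IsWeightedHomogeneous K.weights (rename Fin.succ p) (D.deg l) := fun p l hp =>
    isWeightedHomogeneous_rename_succ ((D.isHomog_iff hL p l).mp hp)
  have e1 : D.deg (D.fvec - K.l₁ - K.l₂) + D.deg K.l₂ = D.deg (D.fvec - K.l₁) := by
    simp only [map_sub]; ring
  have e2 : D.deg (D.fvec - K.l₁ - K.l₂) + D.deg K.l₁ = D.deg (D.fvec - K.l₂) := by
    simp only [map_sub]; ring
  fin_cases k
  · refine (weightedHomogeneousSubmodule ℂ K.weights _).sub_mem (hr _ _ K.homog_h₁) ?_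
    have := hX.mul (hr _ _ K.homog_p₂)
    rwa [e1] at this
  · refine (weightedHomogeneousSubmodule ℂ K.weights _).add_mem (hr _ _ K.homog_h₂) ?_
    have := hX.mul (hr _ _ K.homog_p₁)
    rwa [e2] at this

lemma eval_poly (x : Fin 3 → ℂ) :
    eval x D.poly = eval x K.p₁ * eval x K.h₁ + eval x K.p₂ * eval x K.h₂ := by
  rw [← K.eq_poly, map_add, map_mul, map_mul]

lemma eval_pderiv_poly (x : Fin 3 → ℂ) (j : Fin 3) : eval x (pderiv j D.poly)
    = eval x K.p₁ * eval x (pderiv j K.h₁) + eval x (pderiv j K.p₁) * eval x K.h₁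
      + (eval x K.p₂ * eval x (pderiv j K.h₂) + eval x (pderiv j K.p₂) * eval x K.h₂) := by
  rw [← K.eq_poly]
  simp only [map_add, pderiv_mul, map_mul]
  ring

lemma mem_puncturedCone_iff (y : Fin 4 → ℂ) : y ∈ puncturedCone K.equations ↔ y ≠ 0 ∧
    eval (fun j => y j.succ) K.h₁ = y 0 * eval (fun j => y j.succ) K.p₂ ∧
    eval (fun j => y j.succ) K.h₂ = - (y 0 * eval (fun j => y j.succ) K.p₁) := by
  rw [puncturedCone, Set.mem_ofPred_eq, Fin.forall_fin_two, eval_equations_zero,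
    eval_equations_one, sub_eq_zero, eq_neg_iff_add_eq_zero]

lemma eval_poly_of_mem {y : Fin 4 → ℂ} (hy : y ∈ puncturedCone K.equations) :
    eval (fun j => y j.succ) D.poly = 0 := by
  obtain ⟨-, h1, h2⟩ := (K.mem_puncturedCone_iff y).mp hy
  rw [K.eval_poly, h1, h2]
  ring

/-- Off the `w`-axis, `p₁` and `p₂` do not both vanish, since `f = 0` is smooth there. -/
lemma not_both_zero (hsm : ∀ x ≠ 0, eval x D.poly = 0 → ∃ j, eval x (pderiv j D.poly) ≠ 0)
    {y : Fin 4 → ℂ} (hy : y ∈ puncturedCone K.equations)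
    (h0 : (fun j => y j.succ) ≠ (0 : Fin 3 → ℂ)) :
    ¬(eval (fun j => y j.succ) K.p₁ = 0 ∧ eval (fun j => y j.succ) K.p₂ = 0) := by
  rintro ⟨h1, h2⟩
  obtain ⟨j, hj⟩ := hsm _ h0 (K.eval_poly_of_mem hy)
  obtain ⟨-, h3, h4⟩ := (K.mem_puncturedCone_iff y).mp hy
  apply hj
  rw [K.eval_pderiv_poly, h3, h4, h1, h2]
  ring

/-- The complete intersection is smooth outside the origin. Off the `w`-axis a relation between the
gradients is proportional to the one with coefficients `p₁, p₂`, which gives the gradient of `f`; on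
the axis the weights exclude a relation. -/
lemma linearIndependent_equations (hL : Nonempty (D.L ≃+ ℤ))
    (hsm : ∀ x ≠ 0, eval x D.poly = 0 → ∃ j, eval x (pderiv j D.poly) ≠ 0)
    (he : 0 < D.deg (D.fvec - K.l₁ - K.l₂))
    (hind : ∀ a b : ℂ, (∀ j, a * eval 0 (pderiv j K.p₁) + b * eval 0 (pderiv j K.p₂) = 0) →
      a = 0 ∧ b = 0) {y : Fin 4 → ℂ} (hy : y ∈ puncturedCone K.equations) :
    LinearIndependent ℂ fun k j => eval y (pderiv j (K.equations k)) := by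
  rw [Fintype.linearIndependent_iff]
  intro g hg
  obtain ⟨hy0, h3, h4⟩ := (K.mem_puncturedCone_iff y).mp hy
  set x : Fin 3 → ℂ := fun j => y j.succ with hx
  have hr : ∀ p : MvPolynomial (Fin 3) ℂ, eval y (rename Fin.succ p) = eval x p := fun p => by
    rw [eval_rename]; rfl
  have hrd : ∀ (p : MvPolynomial (Fin 3) ℂ) (j : Fin 3),
      eval y (pderiv j.succ (rename Fin.succ p)) = eval x (pderiv j p) := fun p j => by
    rw [pderiv_rename (Fin.succ_injective 3), hr]
  have g0 : g 0 * eval x K.p₂ = g 1 * eval x K.p₁ := by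
    have := congrFun hg 0
    simp [Fin.sum_univ_two, equations, pderiv_zero_rename_succ, hr] at this
    linear_combination - this
  have gj : ∀ j, g 0 * (eval x (pderiv j K.h₁) - y 0 * eval x (pderiv j K.p₂))
      + g 1 * (eval x (pderiv j K.h₂) + y 0 * eval x (pderiv j K.p₁)) = 0 := by
    intro j
    have := congrFun hg j.succ
    have hX : pderiv j.succ (X 0 : MvPolynomial (Fin 4) ℂ) = 0 :=
      pderiv_X_of_ne (Fin.succ_ne_zero j).symm
    simpa [Fin.sum_univ_two, equations, pderiv_mul, hX, hr, hrd] using this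
  have key : g 0 = 0 ∧ g 1 = 0 := by
    by_cases h0 : x = 0
    · have hw : y 0 ≠ 0 := by
        intro hw
        apply hy0
        funext j
        cases j using Fin.cases with
        | zero => exact hw
        | succ j => exact congrFun h0 j
      rw [h0] at gj
      have hd : ∀ p l, D.IsHomog p l → ∀ j, eval 0 (pderiv j p) ≠ 0 → (D.w j : ℤ) = D.deg l :=
        fun p l hp j hj =>
          weight_eq_of_eval_zero_pderiv_ne_zero ((D.isHomog_iff hL p l).mp hp) hj
      refine eq_zero_of_weighted_relation he (hd _ _ K.homog_p₁) (hd _ _ K.homog_p₂) ?_ ?_ hind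
        hw gj
      · intro j hj
        rw [hd _ _ K.homog_h₁ j hj]
        simp only [map_sub]; ring
      · intro j hj
        rw [hd _ _ K.homog_h₂ j hj]
        simp only [map_sub]; ring
    · have hp := K.not_both_zero hsm hy h0
      have hl : ∃ l : ℂ, g 0 = l * eval x K.p₁ ∧ g 1 = l * eval x K.p₂ := by
        by_cases hp1 : eval x K.p₁ = 0
        · have hp2 : eval x K.p₂ ≠ 0 := fun h => hp ⟨hp1, h⟩
          refine ⟨g 1 / eval x K.p₂, ?_, by field_simp⟩
          apply mul_right_cancel₀ hp2
          rw [g0, hp1]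
          ring
        · refine ⟨g 0 / eval x K.p₁, by field_simp, ?_⟩
          field_simp
          exact g0.symm
      obtain ⟨l, hl1, hl2⟩ := hl
      obtain ⟨j, hj⟩ := hsm x h0 (K.eval_poly_of_mem hy)
      have : l * eval x (pderiv j D.poly) = 0 := by
        rw [K.eval_pderiv_poly, h3, h4, ← gj j, hl1, hl2]
        ring
      have hl0 : l = 0 := (mul_eq_zero.mp this).resolve_right hj
      rw [hl1, hl2, hl0]
      simp
  intro k
  fin_cases k
  · exact key.1
  · exact key.2

/-- A point of `f = 0` where `p₁, p₂` do not both vanish lifts to the complete intersection. -/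
lemma exists_lift {x : Fin 3 → ℂ} (hx0 : x ≠ 0) (hx : eval x D.poly = 0)
    (hp : ¬(eval x K.p₁ = 0 ∧ eval x K.p₂ = 0)) :
    ∃ w : ℂ, (Fin.cons w x : Fin 4 → ℂ) ∈ puncturedCone K.equations := by
  have hne : ∀ w : ℂ, (Fin.cons w x : Fin 4 → ℂ) ≠ 0 := fun w h =>
    hx0 (funext fun j => congrFun h j.succ)
  rw [K.eval_poly] at hx
  by_cases hp1 : eval x K.p₁ = 0
  · have hp2 : eval x K.p₂ ≠ 0 := fun h => hp ⟨hp1, h⟩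
    refine ⟨eval x K.h₁ / eval x K.p₂, (K.mem_puncturedCone_iff _).mpr ⟨hne _, ?_, ?_⟩⟩
    · simp [div_mul_cancel₀ _ hp2]
    · rw [hp1] at hx
      have : eval x K.h₂ = 0 := by simpa [hp2] using hx
      simp [hp1, this]
  · refine ⟨-(eval x K.h₂ / eval x K.p₁), (K.mem_puncturedCone_iff _).mpr ⟨hne _, ?_, ?_⟩⟩
    · simp only [Fin.cons_zero, Fin.cons_succ]
      field_simp
      linear_combination hx
    · simp [div_mul_cancel₀ _ hp1]

/-- Off the locus `p₁ = p₂ = 0`, the coordinate `w` of a point of the complete intersection is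
determined by the other coordinates. -/
lemma eq_of_tail_eq {y y' : Fin 4 → ℂ} (hy : y ∈ puncturedCone K.equations)
    (hy' : y' ∈ puncturedCone K.equations) (h : ∀ j : Fin 3, y j.succ = y' j.succ)
    (hp : ¬(eval (fun j => y j.succ) K.p₁ = 0 ∧ eval (fun j => y j.succ) K.p₂ = 0)) : y = y' := by
  obtain ⟨-, h1, h2⟩ := (K.mem_puncturedCone_iff y).mp hy
  obtain ⟨-, h3, h4⟩ := (K.mem_puncturedCone_iff y').mp hy'
  simp only [← h] at h3 h4
  funext j
  cases j using Fin.cases with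
  | succ j => exact h j
  | zero =>
    by_cases hp1 : eval (fun j => y j.succ) K.p₁ = 0
    · have hp2 : eval (fun j => y j.succ) K.p₂ ≠ 0 := fun h => hp ⟨hp1, h⟩
      exact mul_right_cancel₀ hp2 (h1.symm.trans h3)
    · exact mul_right_cancel₀ hp1 (neg_inj.mp (h2.symm.trans h4))

end KoszulData

/-! ### The signature of the complete intersection -/

lemma card_units_pow_eq_one {n : ℕ} (hn : n ≠ 0) : Nat.card {t : ℂˣ // t ^ n = 1} = n := by
  have : NeZero n := ⟨hn⟩
  refine (Nat.card_congr ?_).trans (Complex.card_rootsOfUnity n)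
  exact Equiv.subtypeEquivRight fun t => (mem_rootsOfUnity n t).symm

namespace KoszulData

variable {D : Deformation 3} (K : KoszulData D)

lemma tail_act (t : ℂˣ) (y : Fin 4 → ℂ) :
    (fun j : Fin 3 => act K.weights t y j.succ)
      = act (fun j => (D.w j : ℤ)) t fun j => y j.succ := by
  funext j
  simp [act, weights]

/-- Passing from the hypersurface `f = 0` to the complete intersection `F_Q = 0` replaces the orbit
`p₁ = p₂ = 0` by the `w`-axis. -/
lemma hasSignature (hL : Nonempty (D.L ≃+ ℤ)) (hε : D.epsilon = -1) {r : ℕ} {A : Fin r → ℕ}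
    {P : Fin r → (Fin 3 → ℂ) → Prop} (h : IsOrbifoldSphere D.w D.poly A P) {i : Fin r}
    {c : Fin 3 → ℂ} (hc : P i c) (he : D.deg (D.fvec - K.l₁ - K.l₂) = A i + 1)
    (hlocus : ∀ x ≠ 0, (eval x K.p₁ = 0 ∧ eval x K.p₂ = 0) ↔
      ∃ t : ℂˣ, act (fun j => (D.w j : ℤ)) t c = x)
    (hind : ∀ a b : ℂ, (∀ j, a * eval 0 (pderiv j K.p₁) + b * eval 0 (pderiv j K.p₂) = 0) →
      a = 0 ∧ b = 0) :
    HasSignature K.equations K.weights (Function.update A i (A i + 1)) := by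
  classical
  have he0 : 0 < D.deg (D.fvec - K.l₁ - K.l₂) := by rw [he]; positivity
  have hw0 : ∀ j, (0 : ℤ) < D.w j := fun j => by exact_mod_cast D.w_pos j
  have hwt : ∀ j, 0 < K.weights j := fun j => by
    cases j using Fin.cases with
    | zero => exact he0
    | succ j => exact hw0 j
  have hhom := K.isWeightedHomogeneous_equations hL
  have hhomf : IsWeightedHomogeneous (fun j => (D.w j : ℤ)) D.poly (D.deg D.fvec) :=
    (D.isHomog_iff hL _ _).mp D.isHomog_poly
  obtain ⟨O, hO1, hO2, hO3, hO4⟩ := h.orbits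
  obtain ⟨t₀, ht₀⟩ := hO4 i c hc
  have hcmem : c ∈ puncturedCone (fun _ : Fin 1 => D.poly) := by
    rw [← ht₀]
    exact act_mem_puncturedCone (fun _ => hhomf) t₀ (O i).2
  have htail : ∀ y ∈ puncturedCone K.equations, (fun j : Fin 3 => y j.succ) ≠ 0 →
      (fun j : Fin 3 => y j.succ) ∈ puncturedCone (fun _ : Fin 1 => D.poly) :=
    fun y hy h0 => ⟨h0, fun _ => K.eval_poly_of_mem hy⟩
  -- the `w`-axis
  have hp0 : eval 0 K.h₁ = 0 ∧ eval 0 K.h₂ = 0 := by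
    have hdeg : ∀ p l, D.IsHomog p l → D.deg l ≠ 0 → eval 0 p = 0 := fun p l hp hl => by
      by_contra h0
      exact hl (degree_eq_of_eval_zero_ne_zero ((D.isHomog_iff hL p l).mp hp) h0)
    have hnn : ∀ p l, D.IsHomog p l → p ≠ 0 → 0 ≤ D.deg l := fun p l hp h0 => by
      by_contra! hl
      exact h0 (eq_zero_of_degree_neg ((D.isHomog_iff hL p l).mp hp) hl)
    have hp1 : K.p₁ ≠ 0 := by
      intro h0
      have := (hind 1 0 fun j => by simp [h0]).1
      simp at this
    have hp2 : K.p₂ ≠ 0 := by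
      intro h0
      have := (hind 0 1 fun j => by simp [h0]).2
      simp at this
    have d1 := hnn _ _ K.homog_p₁ hp1
    have d2 := hnn _ _ K.homog_p₂ hp2
    constructor
    · refine hdeg _ _ K.homog_h₁ ?_
      simp only [map_sub] at he0 ⊢
      omega
    · refine hdeg _ _ K.homog_h₂ ?_
      simp only [map_sub] at he0 ⊢
      omega
  have hdeg0 : ∀ p l, D.IsHomog p l → (∃ j, eval 0 (pderiv j p) ≠ 0) → eval 0 p = 0 := by
    intro p l hp ⟨j, hj⟩
    by_contra h0
    have e1 := weight_eq_of_eval_zero_pderiv_ne_zero ((D.isHomog_iff hL p l).mp hp) hj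
    have e2 := degree_eq_of_eval_zero_ne_zero ((D.isHomog_iff hL p l).mp hp) h0
    have := hw0 j
    omega
  have hax : ∀ w : ℂ, w ≠ 0 → (Fin.cons w 0 : Fin 4 → ℂ) ∈ puncturedCone K.equations := by
    intro w hw
    have hp1 : eval 0 K.p₁ = 0 := hdeg0 _ _ K.homog_p₁ (by
      by_contra! h0
      have := (hind 1 0 fun j => by rw [h0 j, mul_zero, zero_mul, add_zero]).1
      simp at this)
    have hp2 : eval 0 K.p₂ = 0 := hdeg0 _ _ K.homog_p₂ (by
      by_contra! h0
      have := (hind 0 1 fun j => by rw [h0 j, mul_zero, zero_mul, add_zero]).2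
      simp at this)
    refine (K.mem_puncturedCone_iff _).mpr ⟨fun h => hw (congrFun h 0), ?_, ?_⟩
    · show eval (0 : Fin 3 → ℂ) K.h₁ = w * eval (0 : Fin 3 → ℂ) K.p₂
      rw [hp0.1, hp2, mul_zero]
    · show eval (0 : Fin 3 → ℂ) K.h₂ = -(w * eval (0 : Fin 3 → ℂ) K.p₁)
      rw [hp0.2, hp1, mul_zero, neg_zero]
  have haxact : ∀ (t : ℂˣ) (w : ℂ), act K.weights t (Fin.cons w 0 : Fin 4 → ℂ)
      = Fin.cons (((t ^ (A i + 1) : ℂˣ) : ℂ) * w) 0 := by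
    intro t w
    funext j
    cases j using Fin.cases with
    | zero =>
      show ((t ^ D.deg (D.fvec - K.l₁ - K.l₂) : ℂˣ) : ℂ) * w = _
      rw [he]
      rfl
    | succ j => simp [act]
  have haxis : ∀ y ∈ puncturedCone K.equations, (fun j : Fin 3 => y j.succ) = 0 →
      ∃ t : ℂˣ, act K.weights t (Fin.cons 1 0 : Fin 4 → ℂ) = y := by
    intro y hy h0
    have hw : y 0 ≠ 0 := by
      intro hw
      apply hy.1
      funext j
      cases j using Fin.cases with
      | zero => exact hw
      | succ j => exact congrFun h0 j
    obtain ⟨t, ht⟩ := IsAlgClosed.exists_pow_nat_eq (y 0) (Nat.succ_pos (A i))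
    have ht0 : t ≠ 0 := by
      rintro rfl
      rw [zero_pow (Nat.succ_ne_zero _)] at ht
      exact hw ht.symm
    refine ⟨Units.mk0 t ht0, ?_⟩
    rw [haxact]
    funext j
    cases j using Fin.cases with
    | zero => simpa using ht
    | succ j => exact (congrFun h0 j).symm
  -- the points off the axis
  have hnc : ∀ y ∈ puncturedCone K.equations, (fun j : Fin 3 => y j.succ) ≠ 0 →
      ∀ t : ℂˣ, act (fun j => (D.w j : ℤ)) t c ≠ fun j => y j.succ :=
    fun y hy h0 t ht => K.not_both_zero h.smooth hy h0 ((hlocus _ h0).mpr ⟨t, ht⟩)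
  have hlift : ∀ x ∈ puncturedCone (fun _ : Fin 1 => D.poly),
      (¬ ∃ t : ℂˣ, act (fun j => (D.w j : ℤ)) t c = x) →
      ∃ w : ℂ, (Fin.cons w x : Fin 4 → ℂ) ∈ puncturedCone K.equations :=
    fun x hx hxc => K.exists_lift hx.1 (hx.2 0) fun hp => hxc ((hlocus x hx.1).mp hp)
  have hmemact : ∀ (t : ℂˣ) {y}, y ∈ puncturedCone K.equations →
      act K.weights t y ∈ puncturedCone K.equations := fun t y hy => act_mem_puncturedCone hhom t hy
  have hsame : ∀ y ∈ puncturedCone K.equations, ∀ y' ∈ puncturedCone K.equations,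
      (fun j : Fin 3 => y' j.succ) ≠ 0 → ∀ t : ℂˣ,
      act (fun j => (D.w j : ℤ)) t (fun j => y j.succ) = (fun j => y' j.succ) →
      act K.weights t y = y' := by
    intro y hy y' hy' h0 t ht
    have e : (fun j : Fin 3 => act K.weights t y j.succ) = fun j => y' j.succ := by
      rw [K.tail_act, ht]
    refine K.eq_of_tail_eq (hmemact t hy) hy' (congrFun e) ?_
    rw [e]
    exact K.not_both_zero h.smooth hy' h0
  have htail0 : ∀ (t : ℂˣ) (y : Fin 4 → ℂ), (fun j : Fin 3 => act K.weights t y j.succ) = 0 ↔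
      (fun j : Fin 3 => y j.succ) = 0 := by
    intro t y
    rw [K.tail_act]
    constructor
    · intro h0
      by_contra h1
      exact act_ne_zero h1 h0
    · intro h0
      rw [h0]
      funext j
      simp [act]
  have hOc : ∀ j, j ≠ i → ¬ ∃ t : ℂˣ, act (fun j => (D.w j : ℤ)) t c = O j := by
    rintro j hj ⟨t, ht⟩
    rw [← ht₀, ← act_mul] at ht
    exact hj (hO1 i j _ ht).symm
  refine ⟨hwt, ⟨_, hhom, ?_⟩, fun y hy => K.linearIndependent_equations hL h.smooth he0 hind hy,
    ?_, ?_⟩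
  · -- the weights
    have hs : (∑ j, (D.w j : ℤ)) - D.d = -1 := hε
    rw [Fin.sum_univ_succ]
    simp only [weights, Fin.cons_zero, Fin.cons_succ, Fin.sum_univ_two, Matrix.cons_val_zero,
      Matrix.cons_val_one, map_sub, D.deg_fvec]
    linarith
  · -- the orbit space
    obtain ⟨e⟩ := h.sphere
    let q := Quotient.mk (orbitSetoid K.weights K.equations)
    let q' := Quotient.mk (orbitSetoid (fun j => (D.w j : ℤ)) fun _ : Fin 1 => D.poly)
    have hq := isOpenQuotientMap_orbitSpace (v := K.weights) (F := K.equations)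
      fun k => ⟨_, hhom k⟩
    have hq' := isOpenQuotientMap_orbitSpace (v := fun j => (D.w j : ℤ))
      (F := fun _ : Fin 1 => D.poly) fun _ => ⟨_, hhomf⟩
    have := compactSpace_orbitSpace (v := K.weights) (F := K.equations) hwt fun k => ⟨_, hhom k⟩
    have := t2Space_orbitSpace (v := K.weights) (F := K.equations) hwt fun k => ⟨_, hhom k⟩
    have := compactSpace_orbitSpace (v := fun j => (D.w j : ℤ))
      (F := fun _ : Fin 1 => D.poly) hw0 fun _ => ⟨_, hhomf⟩
    have := t2Space_orbitSpace (v := fun j => (D.w j : ℤ))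
      (F := fun _ : Fin 1 => D.poly) hw0 fun _ => ⟨_, hhomf⟩
    let g₀ : puncturedCone K.equations →
        Quotient (orbitSetoid (fun j => (D.w j : ℤ)) fun _ : Fin 1 => D.poly) := fun y =>
      if h0 : (fun j : Fin 3 => y.1 j.succ) = 0 then q' ⟨c, hcmem⟩
        else q' ⟨fun j => y.1 j.succ, htail y.1 y.2 h0⟩
    have hg₀ : ∀ y y' : puncturedCone K.equations,
        (∃ t : ℂˣ, act K.weights t y = y') → g₀ y = g₀ y' := by
      rintro y y' ⟨t, ht⟩
      have h1 := htail0 t y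
      rw [ht] at h1
      by_cases h0 : (fun j : Fin 3 => y.1 j.succ) = 0
      · simp only [g₀, dif_pos h0, dif_pos (h1.mpr h0)]
      · simp only [g₀, dif_neg h0, dif_neg fun h => h0 (h1.mp h)]
        exact Quotient.sound ⟨t, (K.tail_act t y).symm.trans (by rw [ht])⟩
    let g : Quotient (orbitSetoid K.weights K.equations) →
        Quotient (orbitSetoid (fun j => (D.w j : ℤ)) fun _ : Fin 1 => D.poly) :=
      Quotient.lift g₀ hg₀
    have hginj : Function.Injective g := by
      intro a b
      induction a using Quotient.inductionOn with
      | h y =>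
      induction b using Quotient.inductionOn with
      | h y' =>
      intro hgy
      change g₀ y = g₀ y' at hgy
      by_cases h0 : (fun j : Fin 3 => y.1 j.succ) = 0
      · obtain ⟨t, ht⟩ := haxis y.1 y.2 h0
        by_cases h0' : (fun j : Fin 3 => y'.1 j.succ) = 0
        · obtain ⟨t', ht'⟩ := haxis y'.1 y'.2 h0'
          refine Quotient.sound ⟨t' * t⁻¹, ?_⟩
          rw [← ht, ← act_mul, inv_mul_cancel_right, ht']
        · simp only [g₀, dif_pos h0, dif_neg h0'] at hgy
          obtain ⟨s, hs⟩ := Quotient.exact hgy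
          exact absurd hs (hnc y'.1 y'.2 h0' s)
      · by_cases h0' : (fun j : Fin 3 => y'.1 j.succ) = 0
        · simp only [g₀, dif_neg h0, dif_pos h0'] at hgy
          obtain ⟨s, hs⟩ := Quotient.exact hgy.symm
          exact absurd hs (hnc y.1 y.2 h0 s)
        · simp only [g₀, dif_neg h0, dif_neg h0'] at hgy
          obtain ⟨s, hs⟩ := Quotient.exact hgy
          exact Quotient.sound ⟨s, hsame y.1 y.2 y'.1 y'.2 h0' s hs⟩
    have hgax : g (q ⟨_, hax 1 one_ne_zero⟩) = q' ⟨c, hcmem⟩ := dif_pos rfl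
    have hgcons : ∀ (x : puncturedCone (fun _ : Fin 1 => D.poly)) (w : ℂ)
        (hw : (Fin.cons w x.1 : Fin 4 → ℂ) ∈ puncturedCone K.equations),
        g (q ⟨_, hw⟩) = q' x := fun x w hw => dif_neg x.2.1
    have hgsurj : Function.Surjective g := by
      intro b
      induction b using Quotient.inductionOn with
      | h x =>
      by_cases hxc : ∃ t : ℂˣ, act (fun j => (D.w j : ℤ)) t c = x
      · exact ⟨_, hgax.trans (Quotient.sound hxc)⟩
      · obtain ⟨w, hw⟩ := hlift x.1 x.2 hxc
        exact ⟨_, hgcons x w hw⟩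
    let E := Equiv.ofBijective g ⟨hginj, hgsurj⟩
    obtain ⟨e'⟩ := nonempty_homeomorph_of_punctured E (q ⟨_, hax 1 one_ne_zero⟩) (by
      intro a ha
      induction a using Quotient.inductionOn with
      | h y =>
      have h0 : (fun j : Fin 3 => y.1 j.succ) ≠ 0 := by
        intro h0
        obtain ⟨t, ht⟩ := haxis y.1 y.2 h0
        exact ha (Quotient.sound ⟨t, ht⟩ : q ⟨_, hax 1 one_ne_zero⟩ = q y).symm
      show ContinuousAt g (q y)
      rw [← hq.continuousAt_comp_iff]
      show ContinuousAt g₀ y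
      have hc1 : Continuous fun y : puncturedCone K.equations => fun j : Fin 3 => y.1 j.succ :=
        continuous_pi fun j => (continuous_apply j.succ).comp continuous_subtype_val
      have hU : IsOpen {y : puncturedCone K.equations | (fun j : Fin 3 => y.1 j.succ) ≠ 0} :=
        isOpen_ne_fun hc1 continuous_const
      refine (ContinuousOn.continuousAt ?_ (hU.mem_nhds h0))
      rw [continuousOn_iff_continuous_domRestrict]
      have : Set.domRestrict {y : puncturedCone K.equations | (fun j : Fin 3 => y.1 j.succ) ≠ 0} g₀
          = fun y => q' ⟨fun j => y.1.1 j.succ, htail y.1.1 y.1.2 y.2⟩ := by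
        funext y
        exact dif_neg y.2
      rw [this]
      exact continuous_quotient_mk'.comp ((hc1.comp continuous_subtype_val).subtype_mk _)) (by
      intro b hb
      induction b using Quotient.inductionOn with
      | h x =>
      have hxc : ¬ ∃ t : ℂˣ, act (fun j => (D.w j : ℤ)) t c = x := by
        rintro ⟨t, ht⟩
        exact hb ((Quotient.sound ⟨t, ht⟩ : q' ⟨c, hcmem⟩ = q' x).symm.trans hgax.symm)
      have hp : ¬(eval x.1 K.p₁ = 0 ∧ eval x.1 K.p₂ = 0) := fun hp =>
        hxc ((hlocus x.1 x.2.1).mp hp)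
      show ContinuousAt E.symm (q' x)
      rw [← hq'.continuousAt_comp_iff]
      have hsymm : ∀ (x : puncturedCone (fun _ : Fin 1 => D.poly)) (w : ℂ)
          (hw : (Fin.cons w x.1 : Fin 4 → ℂ) ∈ puncturedCone K.equations),
          E.symm (q' x) = q ⟨_, hw⟩ := fun x w hw => by
        rw [Equiv.symm_apply_eq]
        exact (hgcons x w hw).symm
      -- near `x` the inverse is given by a continuous section of `(w, x) ↦ x`
      have hsec : ∀ (a b : MvPolynomial (Fin 3) ℂ), eval x.1 b ≠ 0 →
          (∀ x ∈ puncturedCone (fun _ : Fin 1 => D.poly), eval x b ≠ 0 →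
            (Fin.cons (eval x a / eval x b) x : Fin 4 → ℂ) ∈ puncturedCone K.equations) →
          ContinuousAt (E.symm ∘ q') x := by
        intro a b hb hab
        have hU : IsOpen {x : puncturedCone (fun _ : Fin 1 => D.poly) | eval x.1 b ≠ 0} :=
          isOpen_ne_fun (b.continuous_eval.comp continuous_subtype_val) continuous_const
        refine (ContinuousOn.continuousAt ?_ (hU.mem_nhds hb))
        rw [continuousOn_iff_continuous_domRestrict]
        have : Set.domRestrict {x : puncturedCone (fun _ : Fin 1 => D.poly) | eval x.1 b ≠ 0}
            (E.symm ∘ q') = fun x => q ⟨_, hab x.1.1 x.1.2 x.2⟩ := by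
          funext x
          exact hsymm x.1 _ _
        rw [this]
        refine continuous_quotient_mk'.comp (Continuous.subtype_mk (continuous_pi fun j => ?_) _)
        have hv : Continuous fun x : {x : puncturedCone (fun _ : Fin 1 => D.poly) |
            eval x.1 b ≠ 0} => x.1.1 := continuous_subtype_val.comp continuous_subtype_val
        cases j using Fin.cases with
        | zero => exact (a.continuous_eval.comp hv).div (b.continuous_eval.comp hv) fun x => x.2
        | succ j => exact (continuous_apply j).comp hv
      by_cases hp1 : eval x.1 K.p₁ = 0
      · have hp2 : eval x.1 K.p₂ ≠ 0 := fun h => hp ⟨hp1, h⟩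
        refine hsec K.h₁ K.p₂ hp2 fun x hx hx2 => ?_
        obtain ⟨w, hw⟩ := K.exists_lift hx.1 (hx.2 0) fun h => hx2 h.2
        have h1 := ((K.mem_puncturedCone_iff _).mp hw).2.1
        simp only [Fin.cons_zero, Fin.cons_succ] at h1
        rwa [h1, mul_div_cancel_right₀ _ hx2]
      · refine hsec (-K.h₂) K.p₁ hp1 fun x hx hx1 => ?_
        obtain ⟨w, hw⟩ := K.exists_lift hx.1 (hx.2 0) fun h => hx1 h.1
        have h2 := ((K.mem_puncturedCone_iff _).mp hw).2.2
        simp only [Fin.cons_zero, Fin.cons_succ] at h2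
        rwa [map_neg, h2, neg_neg, mul_div_cancel_right₀ _ hx1])
    exact ⟨e'.trans e⟩
  · -- the exceptional orbits
    choose W hW using fun (j : Fin r) (hj : j ≠ i) => hlift (O j).1 (O j).2 (hOc j hj)
    let O' : Fin r → puncturedCone K.equations := fun j =>
      if hj : j = i then ⟨_, hax 1 one_ne_zero⟩ else ⟨_, hW j hj⟩
    have hO'i : (O' i).1 = (Fin.cons 1 0 : Fin 4 → ℂ) := by simp only [O', dif_pos]
    have hO'j : ∀ j, j ≠ i → (fun k : Fin 3 => (O' j).1 k.succ) = (O j).1 := by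
      intro j hj
      simp only [O', dif_neg hj, Fin.cons_succ]
    have hO'i0 : (fun k : Fin 3 => (O' i).1 k.succ) = 0 := by rw [hO'i]; rfl
    have hO'j0 : ∀ j, j ≠ i → (fun k : Fin 3 => (O' j).1 k.succ) ≠ 0 := fun j hj => by
      rw [hO'j j hj]
      exact (O j).2.1
    refine ⟨O', ?_, ?_, ?_⟩
    · rintro j k ⟨t, ht⟩
      have h1 := htail0 t (O' j)
      rw [ht] at h1
      by_cases hj : j = i
      · by_cases hk : k = i
        · rw [hj, hk]
        · rw [hj] at h1
          exact absurd (h1.mpr hO'i0) (hO'j0 k hk)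
      · by_cases hk : k = i
        · rw [hk] at h1
          exact absurd (h1.mp hO'i0) (hO'j0 j hj)
        · refine hO1 j k t ?_
          rw [← hO'j j hj, ← hO'j k hk, ← K.tail_act, ht]
    · intro j
      by_cases hj : j = i
      · subst hj
        rw [Function.update_self]
        refine (Nat.card_congr (Equiv.subtypeEquivRight fun t => ?_)).trans
          (card_units_pow_eq_one (Nat.succ_ne_zero (A j)))
        rw [hO'i, haxact, Fin.cons_inj, mul_one]
        simp only [and_true, Units.val_eq_one]
      · rw [Function.update_of_ne hj, ← hO2 j]
        refine Nat.card_congr (Equiv.subtypeEquivRight fun t => ?_)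
        rw [← hO'j j hj]
        refine ⟨fun ht => ?_, fun ht => ?_⟩
        · rw [← K.tail_act, ht]
        · exact hsame _ (O' j).2 _ (O' j).2 (hO'j0 j hj) t ht
    · intro y hy t ht
      have h0 : (fun k : Fin 3 => y.1 k.succ) ≠ 0 := by
        intro h0
        obtain ⟨s, hs⟩ := haxis y.1 y.2 h0
        exact hy i ⟨s, by rw [hO'i, hs]⟩
      refine hO3 ⟨_, htail y.1 y.2 h0⟩ (fun j s hs => ?_) t ?_
      · by_cases hj : j = i
        · subst hj
          refine hnc y.1 y.2 h0 (s * t₀⁻¹) ?_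
          rw [← ht₀, ← act_mul, inv_mul_cancel_right, hs]
        · refine hy j ⟨s, hsame _ (O' j).2 _ y.2 h0 s ?_⟩
          rw [hO'j j hj, hs]
      · show act _ t (fun j : Fin 3 => y.1 j.succ) = _
        rw [← K.tail_act, ht]

end KoszulData

/-! ### The exceptional orbit and its Koszul matrix factorization -/

namespace OrbitCoordinates

variable {D : Deformation 3} {c : Fin 3 → ℂ} (O : OrbitCoordinates D c)

/-- If the closure of the orbit is smooth, it is the graph `x = 0`, `z = a y ^ n`. -/
lemma pres_of_p_eq_one (hp : O.p = 1) (k : Fin O.p) : ∃ (a : ℂ) (n : ℕ), 0 < n ∧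
    O.pres k k = X O.z - C a * X O.y ^ n ∧ c O.z = a * c O.y ^ n ∧
    (a ≠ 0 → D.w O.z = D.w O.y * n) := by
  have hk : (k : ℕ) = 0 := by have := k.2; omega
  by_cases hz : c O.z = 0
  · exact ⟨0, 1, one_pos, by rw [pres_apply]; simp [mulZ, hz], by simp [hz], by simp⟩
  · have hpq := O.p_le_q hz
    refine ⟨c O.z * (c O.y)⁻¹ ^ O.q, O.q, by omega, ?_, ?_, fun _ => ?_⟩
    · have e1 : ((k : ℕ) + O.q) % O.p = k := by rw [hk, hp, Nat.mod_one]
      have e2 : ((k : ℕ) + O.q) / O.p = O.q := by rw [hk, hp, Nat.div_one, zero_add]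
      rw [pres_apply, if_pos rfl, mulZ, Matrix.of_apply, if_pos e1, e2]
    · rw [mul_assoc, ← mul_pow, inv_mul_cancel₀ O.cy, one_pow, mul_one]
    · rw [← O.isotropy_mul_p, hp, mul_one, O.isotropy_mul_q hz]

/-- If the closure of the orbit is smooth, the isotropy group is cyclic of order `w_y`. -/
lemma act_eq_self_iff (hp : O.p = 1) (t : ℂˣ) :
    act (fun j => (D.w j : ℤ)) t c = c ↔ t ^ D.w O.y = 1 := by
  constructor
  · intro h
    have := congrFun h O.y
    rw [act_natCast] at this
    exact Units.ext (mul_right_cancel₀ O.cy (this.trans (one_mul _).symm))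
  · intro h
    funext j
    rw [act_natCast]
    by_cases hj : c j = 0
    · rw [hj, mul_zero]
    · have : t ^ D.w j = 1 := by
        rcases O.cover j with rfl | rfl | rfl
        · exact absurd O.cx hj
        · exact h
        · rw [← O.isotropy_mul_q hj, pow_mul, ← mul_one (isotropyOrder D c), ← hp,
            O.isotropy_mul_p, h, one_pow]
      rw [this, Units.val_one, one_mul]

lemma eval_eq_zero_iff (hp : O.p = 1) (k : Fin O.p) {x : Fin 3 → ℂ} (hx : x ≠ 0) :
    (eval x (O.pres k k) = 0 ∧ x O.x = 0) ↔
      ∃ t : ℂˣ, act (fun j => (D.w j : ℤ)) t c = x := by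
  obtain ⟨a, n, hn, hpres, hcz, hw⟩ := O.pres_of_p_eq_one hp k
  have hev : ∀ x : Fin 3 → ℂ, eval x (O.pres k k) = 0 ↔ x O.z = a * x O.y ^ n := fun x => by
    rw [hpres]
    simp [sub_eq_zero]
  rw [hev]
  constructor
  · rintro ⟨h1, h2⟩
    have hy : x O.y ≠ 0 := by
      intro hy
      refine hx (funext fun j => ?_)
      rcases O.cover j with rfl | rfl | rfl
      · exact h2
      · exact hy
      · rw [h1, hy, zero_pow hn.ne', mul_zero]; rfl
    obtain ⟨t, ht⟩ := IsAlgClosed.exists_pow_nat_eq (x O.y / c O.y) (D.w_pos O.y)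
    have ht0 : t ≠ 0 := by
      rintro rfl
      rw [zero_pow (D.w_pos O.y).ne'] at ht
      exact div_ne_zero hy O.cy ht.symm
    have hty : t ^ D.w O.y * c O.y = x O.y := by rw [ht, div_mul_cancel₀ _ O.cy]
    refine ⟨Units.mk0 t ht0, funext fun j => ?_⟩
    rw [act_natCast, Units.val_pow_eq_pow_val, Units.val_mk0]
    rcases O.cover j with rfl | rfl | rfl
    · rw [O.cx, h2, mul_zero]
    · exact hty
    · rw [hcz, h1, ← hty]
      by_cases ha : a = 0
      · rw [ha]; simp
      · rw [hw ha, pow_mul, mul_pow]; ring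
  · rintro ⟨t, rfl⟩
    simp only [act_natCast]
    refine ⟨?_, by rw [O.cx, mul_zero]⟩
    rw [hcz]
    by_cases ha : a = 0
    · rw [ha]; simp
    · rw [hw ha, pow_mul, mul_pow, Units.val_pow_eq_pow_val]; ring

lemma sum_weights : ∑ j, D.w j = D.w O.x + D.w O.y + D.w O.z := by
  have : (Finset.univ : Finset (Fin 3)) = {O.x, O.y, O.z} := by
    ext j
    simpa using O.cover j
  rw [this, Finset.sum_insert (by simp [O.xy, O.xz]), Finset.sum_insert (by simp [O.yz]),
    Finset.sum_singleton, add_assoc]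

end OrbitCoordinates

/-- If two pairs of polynomials vanishing at the origin generate the same ideal, their gradients
at the origin span the same space. -/
lemma linearIndependent_gradients_of_span_eq {n : ℕ} {p₁ p₂ q₁ q₂ : MvPolynomial (Fin n) ℂ}
    (h : Ideal.span {p₁, p₂} = Ideal.span {q₁, q₂}) (hq₁ : eval 0 q₁ = 0) (hq₂ : eval 0 q₂ = 0)
    (hq : LinearIndependent ℂ ![fun j => eval 0 (pderiv j q₁), fun j => eval 0 (pderiv j q₂)]) :
    LinearIndependent ℂ ![fun j => eval 0 (pderiv j p₁), fun j => eval 0 (pderiv j p₂)] := by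
  have hle : ∀ p ∈ Ideal.span {q₁, q₂}, eval 0 p = 0 := by
    intro p hp
    obtain ⟨a, b, rfl⟩ := Ideal.mem_span_pair.mp hp
    rw [map_add, map_mul, map_mul, hq₁, hq₂, mul_zero, mul_zero, add_zero]
  have hp₁ := hle p₁ (h ▸ Ideal.subset_span (by simp))
  have hp₂ := hle p₂ (h ▸ Ideal.subset_span (by simp))
  have hgrad : ∀ q ∈ Ideal.span {q₁, q₂}, (fun j => eval 0 (pderiv j q)) ∈
      Submodule.span ℂ (Set.range
        ![fun j => eval 0 (pderiv j p₁), fun j => eval 0 (pderiv j p₂)]) := by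
    intro q hq
    rw [← h] at hq
    obtain ⟨a, b, rfl⟩ := Ideal.mem_span_pair.mp hq
    rw [Matrix.range_cons_cons_empty, Submodule.mem_span_pair]
    refine ⟨eval 0 a, eval 0 b, funext fun j => ?_⟩
    simp only [map_add, Derivation.leibniz, smul_eq_mul, map_mul, hp₁, hp₂, Pi.add_apply,
      Pi.smul_apply]
    ring
  have hrange : Submodule.span ℂ (Set.range
        ![fun j => eval 0 (pderiv j q₁), fun j => eval 0 (pderiv j q₂)]) ≤
      Submodule.span ℂ (Set.range
        ![fun j => eval 0 (pderiv j p₁), fun j => eval 0 (pderiv j p₂)]) := by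
    rw [Submodule.span_le]
    rintro _ ⟨k, rfl⟩
    fin_cases k
    · exact hgrad q₁ (Ideal.subset_span (by simp))
    · exact hgrad q₂ (Ideal.subset_span (by simp))
  have h2 := finrank_span_eq_card hq
  have h3 := Submodule.finrank_mono hrange
  rw [h2] at h3
  exact linearIndependent_iff_card_le_finrank_span.mpr h3

end EbelingTakahashi

open EbelingTakahashi in
theorem theorem1 (D : Deformation 3) (hε : D.epsilon = -1) (hL : Nonempty (D.L ≃+ ℤ))
    (T : DolgachevData D) (i : Fin (T.form.m + 2)) (hi : 2 ≤ T.form.A i)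
    (V : GradedMF D (Fin 2) (Fin 2)) (hV : T.IsOutermost i V) :
    (∃ K : KoszulData D, K.mf.Iso V) ∧
    ∀ K : KoszulData D, K.mf.Iso V →
      HasSignature K.equations K.weights
        (Function.update T.form.A i (T.form.A i + 1)) := by
  obtain ⟨c, hcO, k₀, k₁, k₂, W, hW, hWV⟩ := hV
  have hS := T.isOrbifoldSphere
  obtain ⟨Or, -, hcard, -, hP⟩ := hS.orbits
  obtain ⟨t₀, ht₀⟩ := hP i c hcO
  have hcm : c ∈ puncturedCone (fun _ : Fin 1 => D.poly) := by
    rw [← ht₀]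
    exact act_mem_puncturedCone
      (fun _ => (D.isHomog_iff hL _ _).mp D.isHomog_poly) t₀ (Or i).2
  have hiso : Nat.card {t : ℂˣ // act (fun j => (D.w j : ℤ)) t c = c} = T.form.A i := by
    rw [← hcard i]
    refine Nat.card_congr (Equiv.subtypeEquivRight fun t => ?_)
    rw [← ht₀]
    constructor
    · intro h
      have := congrArg (act (fun j => (D.w j : ℤ)) t₀⁻¹) h
      rwa [← act_mul, ← act_mul, ← act_mul, mul_right_comm, inv_mul_cancel, one_mul,
        act_one] at this
    · intro h
      rw [← act_mul, mul_comm, act_mul, h]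
  -- a point of the torus has trivial isotropy
  have hzero : ∃ j, c j = 0 := by
    by_contra! h0
    have : Subsingleton {t : ℂˣ // act (fun j => (D.w j : ℤ)) t c = c} := by
      have h1 : ∀ t : ℂˣ, act (fun j => (D.w j : ℤ)) t c = c → t = 1 := fun t ht => by
        refine D.unit_eq_one (by decide) t fun j => Units.ext ?_
        have := congrFun ht j
        rw [act_natCast] at this
        exact mul_right_cancel₀ (h0 j) (this.trans (one_mul _).symm)
      exact ⟨fun s t => Subtype.ext ((h1 s s.2).trans (h1 t t.2).symm)⟩
    have := Finite.card_le_one_iff_subsingleton.mpr this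
    omega
  obtain ⟨O⟩ := exists_orbitCoordinates hcm.1 hzero
  obtain ⟨hp, K', hK', ⟨k, hk⟩, hK'2, hl1, hl2, h0, h1⟩ :=
    exists_koszulData_of_stabilization hL hε (hcm.2 0) O hW hWV
  refine ⟨⟨K', hK'⟩, fun K hK => ?_⟩
  -- for `p = 1` the isotropy group of the orbit is the group of `w_y`-th roots of unity
  have hA : D.w O.y = T.form.A i := by
    rw [← hiso, ← card_units_pow_eq_one (D.w_pos O.y).ne']
    exact (Nat.card_congr (Equiv.subtypeEquivRight fun t => O.act_eq_self_iff hp t)).symm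
  -- `d - w_z - w_x = w_y + 1`, as `ε_f = -1`
  have he' : D.deg (D.fvec - K'.l₁ - K'.l₂) = T.form.A i + 1 := by
    have hs : (∑ j, (D.w j : ℤ)) - D.d = -1 := hε
    have := O.sum_weights
    rw [hl1, hl2, map_sub, map_sub, D.deg_fvec, D.deg_xvec, D.deg_xvec, ← hA]
    zify at this
    linarith
  obtain ⟨he, hI⟩ := KoszulData.eq_of_iso hL (hK'.trans hK.symm) h0 h1 (by rw [he']; positivity)
  have hz : ∀ {p q p' q' : MvPolynomial (Fin 3) ℂ} (x : Fin 3 → ℂ),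
      Ideal.span {p, q} = Ideal.span {p', q'} → eval x p' = 0 ∧ eval x q' = 0 →
      eval x p = 0 ∧ eval x q = 0 := by
    intro p q p' q' x h ⟨hp, hq⟩
    have key : ∀ g ∈ Ideal.span {p, q}, eval x g = 0 := by
      intro g hg
      rw [h] at hg
      obtain ⟨a, b, rfl⟩ := Ideal.mem_span_pair.mp hg
      simp [hp, hq]
    exact ⟨key p (Ideal.subset_span (by simp)), key q (Ideal.subset_span (by simp))⟩
  -- the linear part of `p₁ = z - a y ^ n` may involve `y` if `n = 1`, but not `x`
  have hgz : ∀ j, j ≠ O.y → eval 0 (pderiv j K'.p₁) = if j = O.z then 1 else 0 := fun j hj => by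
    rw [hk, O.eval_zero_pderiv_pres hj]
    simp
  have hgx : ∀ j, eval 0 (pderiv j K'.p₂) = if j = O.x then 1 else 0 := fun j => by
    rw [hK'2, pderiv_X]
    by_cases hj : j = O.x
    · subst hj; simp
    · simp [hj]
  have hind' : LinearIndependent ℂ
      ![fun j => eval 0 (pderiv j K'.p₁), fun j => eval 0 (pderiv j K'.p₂)] := by
    rw [LinearIndependent.pair_iff]
    intro a b hab
    have e1 := congrFun hab O.z
    have e2 := congrFun hab O.x
    simp only [Pi.add_apply, Pi.smul_apply, hgz _ O.yz.symm, hgz _ O.xy, hgx, if_true,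
      if_neg O.xz, if_neg O.xz.symm, smul_eq_mul, mul_one, mul_zero, add_zero, zero_add,
      Pi.zero_apply] at e1 e2
    exact ⟨e1, e2⟩
  have hind := linearIndependent_gradients_of_span_eq hI (h1 0 0) (h1 0 1) hind'
  refine K.hasSignature hL hε hS hcO (he.trans he') (fun x hx => ?_) fun a b hab => ?_
  · rw [← O.eval_eq_zero_iff hp k hx]
    have e : eval x K'.p₁ = eval x (O.pres k k) := by rw [hk]
    have e' : eval x K'.p₂ = x O.x := by rw [hK'2, eval_X]
    rw [← e, ← e']
    exact ⟨hz x hI.symm, hz x hI⟩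
  · exact LinearIndependent.pair_iff.mp hind a b (funext hab)
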